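/- For finite sets $S,S'$ let $\mathrm{HamDist}(S,S')=|S\setminus S'|+|S'\setminus S|$, and for a list $S_1,\dots,S_r$ of finite sets (repetitions allowed) let $\mathrm{Div}(S_1,\dots,S_r)=\sum_{1\le i<j\le r}\mathrm{HamDist}(S_i,S_j)$. For a subset minimization problem $\Pi$, an instance of Diverse $\Pi$ is a tuple $(I,k,r,t)$ with $I$ an instance of $\Pi$ and $k,r,t\in\mathbb N$ (written in binary); the question is whether there are solutions $S_1,\dots,S_r$ of $I$ with $|S_i|\le k$ for all $i$ and $\mathrm{Div}(S_1,\dots,S_r)\ge t$. A polynomial kernel for Diverse $\Pi$, parameterized by $k+r$, is a polynomial-time algorithm that maps every instance $(I,k,r,t)$ to an equivalent instance $(I',k',r',t')$ of Diverse $\Pi$ such that $|I'|+k'+r'$ plus the encoding length of $t'$ is at most $s(k+r)$ for a fixed polynomial $s$. Here $|I|$ is the encoding length of $I$, except that for Point Line Cover, as is usual for this problem, $|I|$ is the number of points (their coordinates are not counted). The following diverse problems, parameterized by $k+r$, admit polynomial kernels with the stated bounds on the number of vertices or points of $I'$. (i) Diverse Vertex Cover (solutions: vertex covers of a finite simple graph):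 $\mathcal O(k(k+r))$ vertices. (ii) For every fixed $d$, Diverse $d$-Hitting Set (solutions: vertex sets meeting every hyperedge of a finite hypergraph whose hyperedges have at most $d$ elements): $\mathcal O(k^d+kr)$ vertices, with a constant that may depend on $d$. (iii) Diverse Point Line Cover (instances: finite sets $P$ of points of the plane, with rational coordinates; solutions: finite sets of lines of the plane such that every point of $P$ lies on at least one of them): $\mathcal O(k(k+r))$ points. Moreover, the variant in which a solution may use only lines through two distinct points of $P$ also admits a polynomial kernel, on $\mathcal O(k^2(k+r))$ points. (iv) Diverse Feedback Arc Set in Tournaments (solutions: sets of arcs of a tournament whose removal leaves no directed cycle): $\mathcal O(k(k+r))$ vertices. -/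

import Mathlib

/-! ### A programming language with a step count

Programs are while-programs acting on binary trees.  Every elementary step is charged the size of
the tree it reads, so that values are never larger than the time spent, and running times agree
with those of multi-tape Turing machines up to a polynomial. -/

/-- Binary trees, the data on which programs operate. -/
inductive Data : Type
  | nil : Data
  | cons : Data → Data → Data

/-- The number of nodes (leaves included). -/
def Data.size : Data → ℕ
  | .nil => 1
  | .cons a b => a.size + b.size + 1

/-- Programs transforming one tree into another. -/
inductive Prog : Type
  | id : Prog
  | nil : Prog
  | head : Prog
  | tail : Prog
  | cons : Prog → Prog → Prog
  | seq : Prog → Prog → Prog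
  | cond : Prog → Prog → Prog → Prog
  | loop : Prog → Prog → Prog

/-- `Exec p x y n`: the program `p`, started on `x`, halts with output `y` at total cost `n`.
A test counts as passed when its value is not `nil`; `loop c p` is "while `c` do `p`". -/
inductive Exec : Prog → Data → Data → ℕ → Prop
  | id (x : Data) : Exec .id x x x.size
  | nil (x : Data) : Exec .nil x .nil x.size
  | head_nil : Exec .head .nil .nil 1
  | head_cons (a b : Data) : Exec .head (.cons a b) a (Data.cons a b).size
  | tail_nil : Exec .tail .nil .nil 1
  | tail_cons (a b : Data) : Exec .tail (.cons a b) b (Data.cons a b).size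
  | cons {p q : Prog} {x a b : Data} {m n : ℕ} :
      Exec p x a m → Exec q x b n → Exec (.cons p q) x (.cons a b) (m + n + x.size)
  | seq {p q : Prog} {x y z : Data} {m n : ℕ} :
      Exec p x y m → Exec q y z n → Exec (.seq p q) x z (m + n)
  | cond_true {c p q : Prog} {x v y : Data} {m n : ℕ} :
      Exec c x v m → v ≠ .nil → Exec p x y n → Exec (.cond c p q) x y (m + n + x.size)
  | cond_false {c p q : Prog} {x y : Data} {m n : ℕ} :
      Exec c x .nil m → Exec q x y n → Exec (.cond c p q) x y (m + n + x.size)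
  | loop_stop {c p : Prog} {x : Data} {m : ℕ} :
      Exec c x .nil m → Exec (.loop c p) x x (m + x.size)
  | loop_step {c p : Prog} {x v y z : Data} {m n l : ℕ} :
      Exec c x v m → v ≠ .nil → Exec p x y n → Exec (.loop c p) y z l →
      Exec (.loop c p) x z (m + n + l + x.size)

/-- `f` is computable in polynomial time with respect to the encodings `ea` and `eb`. -/
def PolyTime {α β : Type} (ea : α → Data) (eb : β → Data) (f : α → β) : Prop :=
  ∃ (p : Prog) (T : Polynomial ℕ), ∀ x : α,
    ∃ n : ℕ, n ≤ T.eval (ea x).size ∧ Exec p (ea x) (eb (f x)) n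

/-! ### Encodings (numbers in binary) -/

def encList {α : Type} (e : α → Data) : List α → Data
  | [] => .nil
  | a :: l => .cons (e a) (encList e l)

def encBool : Bool → Data
  | false => .nil
  | true => .cons .nil .nil

/-- Binary encoding, least significant bit first. -/
def encNat (n : ℕ) : Data := encList encBool n.bits

def encInt (z : ℤ) : Data := .cons (encBool (decide (z < 0))) (encNat z.natAbs)

def encRat (q : ℚ) : Data := .cons (encInt q.num) (encNat q.den)

/-- A Boolean matrix, as the list of its rows. -/
def encMatrix {m n : ℕ} (M : Fin m → Fin n → Bool) : Data :=
  encList (encList encBool) (List.ofFn fun i => List.ofFn (M i))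

/-! ### Subset minimization problems and their diverse versions -/

/-- The Hamming distance of two finite sets. -/
noncomputable def hamDist {α : Type} (S S' : Finset α) : ℕ := by
  classical exact (S \ S').card + (S' \ S).card

/-- The diversity of a list of finite sets: the sum of all pairwise Hamming distances. -/
noncomputable def diversity {α : Type} {r : ℕ} (S : Fin r → Finset α) : ℕ :=
  ∑ i : Fin r, ∑ j ∈ Finset.Ioi i, hamDist (S i) (S j)

/-- A subset minimization problem: the solutions of an instance `I` are certain finite sets of
items, and one looks for solutions with at most `k` items. -/
structure SubsetProblem where
  /-- Instances, without the bound `k`. -/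
  Inst : Type
  /-- The encoding with respect to which running times are measured. -/
  enc : Inst → Data
  /-- The items solutions consist of. -/
  Item : Inst → Type
  /-- The solutions, of any cardinality. -/
  IsSolution : (I : Inst) → Finset (Item I) → Prop
  /-- The number of vertices (or points) of an instance. -/
  order : Inst → ℕ
  /-- The size of an instance in kernel size bounds. -/
  size : Inst → ℕ

/-- An instance `(I, k, r, t)` of the diverse version of a subset minimization problem. -/
structure DiverseInst (Q : SubsetProblem) where
  inst : Q.Inst
  k : ℕ
  r : ℕ
  t : ℕ

/-- Are there `r` solutions, each of at most `k` items, whose diversity is at least `t`? -/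
def DiverseInst.IsYes {Q : SubsetProblem} (x : DiverseInst Q) : Prop :=
  ∃ S : Fin x.r → Finset (Q.Item x.inst),
    (∀ i, Q.IsSolution x.inst (S i) ∧ (S i).card ≤ x.k) ∧ x.t ≤ diversity S

def DiverseInst.enc {Q : SubsetProblem} (x : DiverseInst Q) : Data :=
  .cons (Q.enc x.inst) (.cons (encNat x.k) (.cons (encNat x.r) (encNat x.t)))

/-- The size of an instance; `k` and `r`, which make up the parameter, count with their values. -/
def DiverseInst.size {Q : SubsetProblem} (x : DiverseInst Q) : ℕ :=
  Q.size x.inst + x.k + x.r + (encNat x.t).size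

/-- The diverse version of `Q`, parameterized by `k + r`, has a polynomial kernel on
`O(b k r)` vertices (or points). -/
def HasDiverseKernel (Q : SubsetProblem) (b : ℕ → ℕ → ℕ) : Prop :=
  ∃ K : DiverseInst Q → DiverseInst Q,
    PolyTime DiverseInst.enc DiverseInst.enc K ∧
    (∀ x, (K x).IsYes ↔ x.IsYes) ∧
    (∃ s : Polynomial ℕ, ∀ x, (K x).size ≤ s.eval (x.k + x.r)) ∧
    (∃ C : ℕ, ∀ x, Q.order (K x).inst ≤ C * b x.k x.r)

/-! ### Vertex Cover -/

/-- A finite simple graph on the vertices `0, …, n - 1`. -/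
structure GraphInst where
  n : ℕ
  G : SimpleGraph (Fin n)

open Classical in
/-- Encoding by the adjacency matrix. -/
noncomputable def GraphInst.enc (I : GraphInst) : Data :=
  encMatrix fun u v => decide (I.G.Adj u v)

noncomputable def vertexCover : SubsetProblem where
  Inst := GraphInst
  enc := GraphInst.enc
  Item I := Fin I.n
  IsSolution I S := ∀ u v, I.G.Adj u v → u ∈ S ∨ v ∈ S
  order I := I.n
  size I := I.enc.size

/-! ### `d`-Hitting Set -/

/-- A hypergraph on the vertices `0, …, n - 1`, all of whose hyperedges have at most `d`
elements. -/
structure HypergraphInst (d : ℕ) where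
  n : ℕ
  edges : List (Finset (Fin n))
  card_le : ∀ e ∈ edges, e.card ≤ d

/-- Encoding by `n` in unary and the incidence vectors of the hyperedges. -/
def HypergraphInst.enc {d : ℕ} (I : HypergraphInst d) : Data :=
  .cons (encList (fun _ => Data.nil) (List.range I.n))
    (encList (fun e => encList encBool (List.ofFn fun v => decide (v ∈ e))) I.edges)

def hittingSet (d : ℕ) : SubsetProblem where
  Inst := HypergraphInst d
  enc := HypergraphInst.enc
  Item I := Fin I.n
  IsSolution I S := ∀ e ∈ I.edges, ∃ v ∈ e, v ∈ S
  order I := I.n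
  size I := I.enc.size

/-! ### Point Line Cover -/

abbrev Plane : Type := EuclideanSpace ℝ (Fin 2)

/-- The point with the given rational coordinates. -/
noncomputable def ratPoint (p : ℚ × ℚ) : Plane := !₂[(p.1 : ℝ), (p.2 : ℝ)]

/-- A finite set of points, given as a list of rational coordinates. -/
abbrev PointsInst : Type := List (ℚ × ℚ)

def PointsInst.enc (P : PointsInst) : Data :=
  encList (fun p => .cons (encRat p.1) (encRat p.2)) P

/-- `S` consists of lines of the plane, and every point lies on one of them. -/
def IsLineCover (P : PointsInst) (S : Finset (AffineSubspace ℝ Plane)) : Prop :=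
  (∀ l ∈ S, Module.finrank ℝ l.direction = 1) ∧ ∀ p ∈ P, ∃ l ∈ S, ratPoint p ∈ l

/-- Point Line Cover. Sizes are measured by the number of points. -/
noncomputable def pointLineCover : SubsetProblem where
  Inst := PointsInst
  enc := PointsInst.enc
  Item _ := AffineSubspace ℝ Plane
  IsSolution P S := IsLineCover P S
  order P := P.length
  size P := P.length

/-- The lines through two distinct points of `P`. -/
def spannedLines (P : PointsInst) : Set (AffineSubspace ℝ Plane) :=
  {l | ∃ p ∈ P, ∃ q ∈ P, p ≠ q ∧ l = line[ℝ, ratPoint p, ratPoint q]}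

/-- Point Line Cover where a solution may only use lines through two distinct points of `P`. -/
noncomputable def spannedPointLineCover : SubsetProblem where
  Inst := PointsInst
  enc := PointsInst.enc
  Item _ := AffineSubspace ℝ Plane
  IsSolution P S := (∀ l ∈ S, l ∈ spannedLines P) ∧ IsLineCover P S
  order P := P.length
  size P := P.length

/-! ### Feedback Arc Set in Tournaments -/

/-- A tournament on the vertices `0, …, n - 1`. -/
structure TournamentInst where
  n : ℕ
  D : Digraph (Fin n)
  irrefl : ∀ u, ¬ D.Adj u u
  asymm : ∀ u v, D.Adj u v → ¬ D.Adj v u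
  total : ∀ u v, u ≠ v → D.Adj u v ∨ D.Adj v u

open Classical in
/-- Encoding by the adjacency matrix. -/
noncomputable def TournamentInst.enc (I : TournamentInst) : Data :=
  encMatrix fun u v => decide (I.D.Adj u v)

/-- A solution is a set of arcs whose removal leaves no directed cycle. -/
noncomputable def feedbackArcSet : SubsetProblem where
  Inst := TournamentInst
  enc := TournamentInst.enc
  Item I := Fin I.n × Fin I.n
  IsSolution I S := (∀ e ∈ S, I.D.Adj e.1 e.2) ∧
    ∀ v, ¬ Relation.TransGen (fun a b => I.D.Adj a b ∧ (a, b) ∉ S) v v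
  order I := I.n
  size I := I.enc.size

/-! ### Polynomial time functions between encoded types -/

/-! Outside trivial cases, every kernel keeps `k`, `r` and `t` and shrinks only the instance. The
`r` solutions together use at most `k * r` items. So a family moves to another instance as soon as
some injection on these items carries solutions to solutions; Hamming distances are then unchanged
(`DiverseInst.IsYes.transfer`). Values `t > 2 * k * r * r` are rejected, which bounds the encoding
of `t`; `HasDiverseKernel.of_reduction` packages this.

For hitting sets and vertex covers, edges are scanned greedily and an edge is dropped if a subset of
size `d - i` already lies in `(k + 1) ^ i` kept edges. Any hitting set of size at most `k` must meet
that subset, so small hitting sets are the same before and after (`reduceEdges_spec`), and at most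
`(k + 1) ^ d` edges stay. Vertices on no kept edge are interchangeable, so it is enough to keep `k *
r` of them (`isYes_iff_of_hits`).

For points, one is dropped if it lies on a line with `N` kept points. If `N > k`, such a line
belongs to every cover by at most `k` lines, so covers of the kept points cover everything
(`IsLineCover.of_keepPoints`). If only spanned lines are allowed, some lines lose their spanning
points; for `N ≥ k * r` there are enough spanned substitutes (`exists_spannedLine`).

For tournaments, an arc in more than `k` triangles is forced into every small solution. Reversing
the forced arcs leaves few vertices in triangles if a small solution exists. Together with the
forced arcs and some of their witnesses these form a core of `O(k ^ 2)` vertices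
(`length_coreVertices_le`) which decides whether a small set of arcs is a solution
(`isFas_of_core`). Keeping `2 * k * r` further vertices leaves room for dropped arcs.

Running times: `PT` is closed under composition and under folds whose states stay small
(`PT.foldl`); binary arithmetic and the algorithms are built from these, mostly by `fun_prop`. -/

theorem Polynomial.eval_mono_nat (T : Polynomial ℕ) {m n : ℕ} (h : m ≤ n) :
    T.eval m ≤ T.eval n := by
  rw [Polynomial.eval_eq_sum_range, Polynomial.eval_eq_sum_range]
  gcongr

theorem Data.size_pos (x : Data) : 0 < x.size := by cases x <;> simp [Data.size]

/-- Each instruction pays for the tree it reads, hence for its result. Thus a time bound is also an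
output bound, which is what composition needs. -/
theorem Exec.size_le {p : Prog} {x y : Data} {n : ℕ} (h : Exec p x y n) : y.size ≤ n := by
  induction h with
  | nil x => exact x.size_pos
  | @cons p q x => have := x.size_pos; simp only [Data.size]; omega
  | _ => (try simp only [Data.size] at *); omega

/-- Types whose elements are encoded by binary trees. -/
class Enc (α : Type) where
  enc : α → Data

open Enc

instance : Enc Data := ⟨id⟩
instance : Enc Bool := ⟨encBool⟩
instance : Enc ℕ := ⟨encNat⟩
instance : Enc ℤ := ⟨encInt⟩
instance : Enc ℚ := ⟨encRat⟩
instance : Enc Unit := ⟨fun _ => .nil⟩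
instance {α β : Type} [Enc α] [Enc β] : Enc (α × β) := ⟨fun x => .cons (enc x.1) (enc x.2)⟩
instance {α : Type} [Enc α] : Enc (List α) := ⟨encList enc⟩

theorem enc_pair {α β : Type} [Enc α] [Enc β] (a : α) (b : β) :
    enc (a, b) = .cons (enc a) (enc b) := rfl
theorem enc_nil {α : Type} [Enc α] : enc ([] : List α) = .nil := rfl
theorem enc_cons {α : Type} [Enc α] (a : α) (l : List α) :
    enc (a :: l) = .cons (enc a) (enc l) := rfl

theorem enc_nat (n : ℕ) : enc n = enc n.bits := rfl

/-- The size of the encoding. -/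
abbrev esize {α : Type} [Enc α] (a : α) : ℕ := (enc a).size

section
variable {α β γ δ σ : Type} [Enc α] [Enc β] [Enc γ] [Enc δ] [Enc σ]

theorem esize_pos (a : α) : 0 < esize a := Data.size_pos _
@[simp] theorem esize_pair (a : α) (b : β) : esize (a, b) = esize a + esize b + 1 := rfl
@[simp] theorem esize_nil : esize ([] : List α) = 1 := rfl
@[simp] theorem esize_cons (a : α) (l : List α) : esize (a :: l) = esize a + esize l + 1 := rfl
theorem esize_append (l l' : List α) : esize (l ++ l') + 1 = esize l + esize l' := by
  induction l with
  | nil => simp; omega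
  | cons a l ih => simp; omega
theorem esize_bool_le (b : Bool) : esize b ≤ 3 := by cases b <;> decide
theorem length_lt_esize (l : List α) : l.length < esize l := by
  induction l with
  | nil => simp
  | cons a l ih => simp; omega
theorem esize_lt_of_mem {l : List α} {a : α} (h : a ∈ l) : esize a < esize l := by
  induction l with
  | nil => simp at h
  | cons b l ih =>
    rcases List.mem_cons.1 h with rfl | h
    · simp only [esize_cons]; omega
    · have := ih h; simp; omega
theorem esize_list_le {l : List α} {B : ℕ} (h : ∀ a ∈ l, esize a ≤ B) :
    esize l ≤ l.length * (B + 1) + 1 := by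
  induction l with
  | nil => simp
  | cons a l ih =>
    have := ih fun x hx => h x (by simp [hx])
    have := h a (by simp)
    simp [add_mul]; omega

/-- Polynomial time computability with respect to the standard encodings. -/
@[fun_prop]
def PT (f : α → β) : Prop := PolyTime enc enc f

/-- Sizes of outputs are polynomially bounded. -/
theorem PT.exists_bound {f : α → β} (hf : PT f) :
    ∃ B : Polynomial ℕ, ∀ a, esize (f a) ≤ B.eval (esize a) := by
  obtain ⟨p, T, h⟩ := hf
  refine ⟨T, fun a => ?_⟩
  obtain ⟨n, hn, he⟩ := h a
  exact he.size_le.trans hn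

/-- Programs see only trees, so a type may be traded for any other with the same encodings. This
gives access to the fields of structures and allows a function to be replaced by an equal one that
is easier to program. -/
theorem PT.of_enc_eq {f : α → β} {g : α → γ} (hf : PT f) (h : ∀ a, enc (g a) = enc (f a)) :
    PT g := by
  obtain ⟨p, T, hp⟩ := hf
  refine ⟨p, T, fun a => ?_⟩
  rw [h]; exact hp a

@[fun_prop]
theorem PT.id : PT (fun a : α => a) :=
  ⟨.id, Polynomial.X, fun a => ⟨_, by simp, .id _⟩⟩

@[fun_prop]
theorem PT.comp {g : β → γ} {f : α → β} (hg : PT g) (hf : PT f) : PT (fun a => g (f a)) := by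
  obtain ⟨p, T, hp⟩ := hf
  obtain ⟨q, U, hq⟩ := hg
  refine ⟨.seq p q, T + U.comp T, fun a => ?_⟩
  obtain ⟨m, hm, h1⟩ := hp a
  obtain ⟨n, hn, h2⟩ := hq (f a)
  refine ⟨m + n, ?_, h1.seq h2⟩
  have := U.eval_mono_nat (h1.size_le.trans hm)
  simp only [Polynomial.eval_add, Polynomial.eval_comp]
  omega

theorem PT.of_node {g : α → γ} {f₁ : α → β} {f₂ : α → δ} (h₁ : PT f₁) (h₂ : PT f₂)
    (h : ∀ a, enc (g a) = .cons (enc (f₁ a)) (enc (f₂ a))) : PT g := by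
  obtain ⟨p, T, hp⟩ := h₁
  obtain ⟨q, U, hq⟩ := h₂
  refine ⟨.cons p q, T + U + Polynomial.X, fun a => ?_⟩
  obtain ⟨m, hm, h1⟩ := hp a
  obtain ⟨n, hn, h2⟩ := hq a
  refine ⟨_, ?_, h a ▸ h1.cons h2⟩
  simp; omega

@[fun_prop]
theorem PT.prodMk {f : α → β} {g : α → γ} (hf : PT f) (hg : PT g) : PT (fun a => (f a, g a)) :=
  hf.of_node hg fun _ => rfl

@[fun_prop]
theorem PT.fst {f : α → β × γ} (hf : PT f) : PT (fun a => (f a).1) :=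
  PT.comp (g := Prod.fst) ⟨.head, Polynomial.X, fun x => ⟨(enc x).size, by simp, .head_cons _ _⟩⟩ hf

@[fun_prop]
theorem PT.snd {f : α → β × γ} (hf : PT f) : PT (fun a => (f a).2) :=
  PT.comp (g := Prod.snd) ⟨.tail, Polynomial.X, fun x => ⟨(enc x).size, by simp, .tail_cons _ _⟩⟩ hf

theorem PT.nil_data : PT (fun _ : α => Data.nil) :=
  ⟨.nil, Polynomial.X, fun a => ⟨_, by simp, .nil _⟩⟩

@[fun_prop]
theorem PT.const (b : β) : PT (fun _ : α => b) := by
  suffices h : ∀ d : Data, PT (fun _ : α => d) from (h (enc b)).of_enc_eq fun _ => rfl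
  intro d
  induction d with
  | nil => exact PT.nil_data
  | cons a b iha ihb => exact iha.of_node ihb fun _ => rfl

theorem PT.of_test {c : α → Data} {b : α → Bool} {f g : α → β} (hc : PT c)
    (hb : ∀ a, b a = true ↔ c a ≠ .nil) (hf : PT f) (hg : PT g) :
    PT (fun a => bif b a then f a else g a) := by
  obtain ⟨p, T, hp⟩ := hc
  obtain ⟨q, U, hq⟩ := hf
  obtain ⟨r, V, hr⟩ := hg
  refine ⟨.cond p q r, T + U + V + Polynomial.X, fun a => ?_⟩
  obtain ⟨m, hm, h1⟩ := hp a
  obtain ⟨n, hn, h2⟩ := hq a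
  obtain ⟨l, hl, h3⟩ := hr a
  cases h : b a with
  | true =>
    refine ⟨m + n + (enc a).size, ?_, by simpa [h] using h1.cond_true ((hb a).1 h) h2⟩
    simp; omega
  | false =>
    have h0 : enc (c a) = .nil := by
      by_contra h'
      exact absurd ((hb a).2 h') (by simp [h])
    refine ⟨m + l + (enc a).size, ?_, by simpa [h] using Exec.cond_false (h0 ▸ h1) h3⟩
    simp; omega

@[fun_prop]
theorem PT.cond {b : α → Bool} {f g : α → β} (hb : PT b) (hf : PT f) (hg : PT g) :
    PT (fun a => cond (b a) (f a) (g a)) := by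
  refine PT.of_test (c := fun a => enc (b a)) (hb.of_enc_eq fun _ => rfl) (fun a => ?_) hf hg
  cases b a <;> simp [enc, encBool]

/-! ### Lists -/

@[fun_prop]
theorem PT.list_cons {f : α → β} {g : α → List β} (hf : PT f) (hg : PT g) :
    PT (fun a => f a :: g a) :=
  hf.of_node hg fun _ => rfl

@[fun_prop]
theorem PT.list_tail {f : α → List β} (hf : PT f) : PT (fun a => (f a).tail) := by
  refine PT.comp (g := List.tail) ⟨.tail, Polynomial.X, fun l => ?_⟩ hf
  cases l with
  | nil => exact ⟨1, by simp [enc_nil, Data.size], .tail_nil⟩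
  | cons a l => exact ⟨(enc (a :: l)).size, by simp, .tail_cons _ _⟩

/-- `Prog.head` maps the empty tree to itself, so only a default encoded by `nil` comes for free. -/
theorem PT.headD_of_enc {f : α → List β} (hf : PT f) (b : β) (hb : enc b = .nil) :
    PT (fun a => (f a).headD b) := by
  refine PT.comp (g := fun l : List β => l.headD b) ⟨.head, Polynomial.X, fun l => ?_⟩ hf
  cases l with
  | nil => exact ⟨1, by simp [enc_nil, Data.size], by simpa [enc_nil, hb] using Exec.head_nil⟩
  | cons a l => exact ⟨(enc (a :: l)).size, by simp, .head_cons _ _⟩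

@[fun_prop]
theorem PT.isEmpty {f : α → List β} (hf : PT f) : PT (fun a => (f a).isEmpty) := by
  have : PT (fun a => bif !(f a).isEmpty then false else true) := by
    refine PT.of_test (c := fun a => enc (f a)) (hf.of_enc_eq fun _ => rfl) (fun a => ?_)
      (PT.const _) (PT.const _)
    cases f a <;> simp [enc_nil, enc_cons]
  refine this.of_enc_eq fun a => ?_
  cases (f a).isEmpty <;> rfl

/-- The loop body of a fold, acting on `(context, state, remaining list)`. -/
def Prog.foldBody (p : Prog) : Prog :=
  .cons .head (.cons (.seq (.cons .head (.cons (.seq .tail .head) (.seq (.seq .tail .tail) .head))) p)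
    (.seq (.seq .tail .tail) .tail))

/-- The factor 30 is slack: besides `p`, the body runs a fixed number of projections and pairings,
each charged at most the size of the whole input. -/
theorem Prog.exec_foldBody {p : Prog} {C S A L S' : Data} {n : ℕ}
    (h : Exec p (.cons C (.cons S A)) S' n) :
    ∃ m, m ≤ n + 30 * (Data.cons C (.cons S (.cons A L))).size ∧
      Exec p.foldBody (.cons C (.cons S (.cons A L))) (.cons C (.cons S' L)) m := by
  have hA : Exec (.seq (.seq .tail .tail) .head) (.cons C (.cons S (.cons A L))) A _ :=
    .seq (.seq (.tail_cons _ _) (.tail_cons _ _)) (.head_cons _ _)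
  have hL : Exec (.seq (.seq .tail .tail) .tail) (.cons C (.cons S (.cons A L))) L _ :=
    .seq (.seq (.tail_cons _ _) (.tail_cons _ _)) (.tail_cons _ _)
  have hS : Exec (.seq .tail .head) (.cons C (.cons S (.cons A L))) S _ :=
    .seq (.tail_cons _ _) (.head_cons _ _)
  refine ⟨_, ?_, .cons (.head_cons _ _) (.cons (.seq (.cons (.head_cons _ _) (.cons hS hA)) h) hL)⟩
  simp only [Data.size]
  omega

/-- The states met by the loop are the folds over prefixes of `l`; a bound `B` on these bounds every
test and every pass, with `M` for one step. -/
theorem Prog.exec_fold {p : Prog} {step : σ → α → σ} {C : Data} {B M : ℕ} (l : List α) (s : σ)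
    (hp : ∀ s, esize s ≤ B → ∀ a ∈ l,
      ∃ n ≤ M, Exec p (.cons C (.cons (enc s) (enc a))) (enc (step s a)) n)
    (hB : ∀ l', l' <+: l → esize (l'.foldl step s) ≤ B) :
    ∃ n, n ≤ (l.length + 1) * (M + 40 * (C.size + B + esize l + 2)) ∧
      Exec (.loop (.seq .tail .tail) p.foldBody) (.cons C (.cons (enc s) (enc l)))
        (.cons C (.cons (enc (l.foldl step s)) .nil)) n := by
  induction l generalizing s with
  | nil =>
    refine ⟨_, ?_, Exec.loop_stop (.seq (.tail_cons _ _) (.tail_cons _ _))⟩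
    have := hB [] (by simp)
    simp only [List.foldl_nil] at this
    simp only [Data.size, enc_nil, esize, List.length_nil] at this ⊢
    omega
  | cons a l ih =>
    have h0 := hB [] (by simp)
    obtain ⟨m, hm, h1⟩ := hp s h0 a (by simp)
    obtain ⟨n, hn, h2⟩ := Prog.exec_foldBody (L := enc l) h1
    obtain ⟨k, hk, h3⟩ := ih (step s a) (fun s hs b hb => hp s hs b (by simp [hb]))
      (fun l' hl' => hB (a :: l') (by simpa using hl'))
    refine ⟨_, ?_, .loop_step (.seq (.tail_cons _ _) (.tail_cons _ _)) (by simp [enc_cons]) h2 h3⟩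
    have hl : esize (a :: l) = esize a + esize l + 1 := rfl
    have hk' : k ≤ (l.length + 1) * (M + 40 * (C.size + B + esize (a :: l) + 2)) :=
      hk.trans (by gcongr; omega)
    rw [List.length_cons, add_mul (l.length + 1), one_mul]
    simp only [List.foldl_nil] at h0
    simp only [Data.size, enc_cons, esize] at hn h0 hl hk' ⊢
    omega

/-- Folding over a list takes polynomial time if the intermediate states stay small. -/
theorem PT.foldl {l : γ → List α} {s : γ → σ} {step : γ → σ → α → σ}
    (hl : PT l) (hs : PT s) (hstep : PT (fun x : γ × σ × α => step x.1 x.2.1 x.2.2))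
    (hB : ∃ B : Polynomial ℕ, ∀ c l', l' <+: l c → esize (l'.foldl (step c) (s c)) ≤ B.eval (esize c)) :
    PT (fun c => (l c).foldl (step c) (s c)) := by
  obtain ⟨B, hB⟩ := hB
  obtain ⟨L, hL⟩ := hl.exists_bound
  obtain ⟨p, T, hp⟩ := hstep
  -- The loop halts with the context, the final state and the exhausted list; two projections then
  -- extract the state.
  have hloop : PolyTime enc (fun d : Data => d) (fun c => Data.cons (enc c) (.cons (enc ((l c).foldl (step c) (s c))) .nil)) := by
    have hinit : PT (fun c => (c, s c, l c)) := by fun_prop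
    obtain ⟨q, U, hq⟩ := hinit
    refine ⟨.seq q (.loop (.seq .tail .tail) p.foldBody),
      U + L * (T.comp (Polynomial.X + B + L + 2) + 40 * (Polynomial.X + B + L + 2)), fun c => ?_⟩
    obtain ⟨m, hm, h1⟩ := hq c
    obtain ⟨n, hn, h2⟩ := Prog.exec_fold (p := p) (C := enc c) (B := B.eval (esize c))
      (M := T.eval (esize c + B.eval (esize c) + L.eval (esize c) + 2)) (l c) (s c)
      (by
        intro s hs a ha
        obtain ⟨n, hn, h⟩ := hp (c, s, a)
        refine ⟨n, hn.trans (T.eval_mono_nat ?_), h⟩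
        have := (esize_lt_of_mem ha).le.trans (hL c)
        simp only [enc_pair, Data.size, esize] at hs this ⊢
        omega)
      (hB c)
    refine ⟨_, ?_, h1.seq h2⟩
    have h3 := (length_lt_esize (l c)).trans_le (hL c)
    simp only [Polynomial.eval_add, Polynomial.eval_mul, Polynomial.eval_comp, Polynomial.eval_X,
      Polynomial.eval_ofNat]
    refine Nat.add_le_add hm (hn.trans (Nat.mul_le_mul h3 ?_))
    have := hL c
    gcongr
  obtain ⟨q, U, hq⟩ := hloop
  refine ⟨.seq q (.seq .tail .head), U + (U + U), fun c => ?_⟩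
  obtain ⟨m, hm, h1⟩ := hq c
  refine ⟨_, ?_, h1.seq (.seq (.tail_cons _ _) (.head_cons _ _))⟩
  have := h1.size_le
  simp only [Polynomial.eval_add, Data.size] at this ⊢
  omega

/-- Folding over a list takes polynomial time if every step adds polynomially many nodes. -/
theorem PT.foldl_of_add {l : γ → List α} {s : γ → σ} {step : γ → σ → α → σ}
    (hl : PT l) (hs : PT s) (hstep : PT (fun x : γ × σ × α => step x.1 x.2.1 x.2.2))
    (hP : ∃ P : Polynomial ℕ, ∀ c s, ∀ a ∈ l c, esize (step c s a) ≤ esize s + P.eval (esize c)) :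
    PT (fun c => (l c).foldl (step c) (s c)) := by
  obtain ⟨P, hP⟩ := hP
  obtain ⟨L, hL⟩ := hl.exists_bound
  obtain ⟨S, hS⟩ := hs.exists_bound
  refine hl.foldl hs hstep ⟨S + L * P, fun c l' hl' => ?_⟩
  have key : ∀ (l' : List α) (t : σ), (∀ a ∈ l', a ∈ l c) →
      esize (l'.foldl (step c) t) ≤ esize t + l'.length * P.eval (esize c) := by
    intro l'
    induction l' with
    | nil => simp
    | cons a l' ih =>
      intro t h
      have h1 := ih (step c t a) fun b hb => h b (by simp [hb])
      have h2 := hP c t a (h a (by simp))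
      simp only [List.foldl_cons, List.length_cons, add_mul]
      omega
  refine (key l' _ fun a ha => hl'.subset ha).trans ?_
  simp only [Polynomial.eval_add, Polynomial.eval_mul]
  refine Nat.add_le_add (hS c) (Nat.mul_le_mul ?_ le_rfl)
  exact hl'.length_le.trans ((length_lt_esize _).le.trans (hL c))

end

open Enc

section
variable {α β γ δ σ : Type} [Enc α] [Enc β] [Enc γ] [Enc δ] [Enc σ]

/-! ### Boolean functions -/

@[fun_prop]
theorem PT.not {f : γ → Bool} (hf : PT f) : PT (fun c => !f c) :=
  (show PT (fun c => bif f c then false else true) by fun_prop).of_enc_eq fun c => by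
    cases f c <;> rfl

@[fun_prop]
theorem PT.and {f g : γ → Bool} (hf : PT f) (hg : PT g) : PT (fun c => f c && g c) :=
  (show PT (fun c => bif f c then g c else false) by fun_prop).of_enc_eq fun c => by
    cases f c <;> rfl

@[fun_prop]
theorem PT.or {f g : γ → Bool} (hf : PT f) (hg : PT g) : PT (fun c => f c || g c) :=
  (show PT (fun c => bif f c then true else g c) by fun_prop).of_enc_eq fun c => by
    cases f c <;> rfl

@[fun_prop]
theorem PT.xor {f g : γ → Bool} (hf : PT f) (hg : PT g) : PT (fun c => f c ^^ g c) :=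
  (show PT (fun c => bif f c then !g c else g c) by fun_prop).of_enc_eq fun c => by
    cases f c <;> cases g c <;> rfl

/-! ### Lists -/

@[fun_prop]
theorem PT.list_any {l : γ → List α} {p : γ → α → Bool} (hl : PT l)
    (hp : PT (fun x : γ × α => p x.1 x.2)) : PT (fun c => (l c).any (p c)) := by
  have h : PT (fun c => (l c).foldl (fun b a => b || p c a) false) :=
    hl.foldl (PT.const _) (step := fun c b a => b || p c a) (by
      have := PT.comp hp (f := fun x : γ × Bool × α => (x.1, x.2.2)) (by fun_prop)
      fun_prop) ⟨3, fun _ _ _ => (esize_bool_le _).trans (by simp)⟩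
  refine h.of_enc_eq fun c => congrArg _ ?_
  generalize l c = l
  suffices ∀ b, l.foldl (fun b a => b || p c a) b = (b || l.any (p c)) by simp [this]
  induction l with
  | nil => simp
  | cons a l ih => intro b; simp [ih, Bool.or_assoc]

@[fun_prop]
theorem PT.list_all {l : γ → List α} {p : γ → α → Bool} (hl : PT l)
    (hp : PT (fun x : γ × α => p x.1 x.2)) : PT (fun c => (l c).all (p c)) :=
  (show PT (fun c => !(l c).any fun a => !p c a) by fun_prop).of_enc_eq fun c => by
    rw [List.all_eq_not_any_not]

@[fun_prop]
theorem PT.list_reverse {l : γ → List α} (hl : PT l) : PT (fun c => (l c).reverse) := by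
  have h : PT (fun c => (l c).foldl (fun acc a => a :: acc) []) :=
    hl.foldl_of_add (PT.const _) (by fun_prop) (by
      obtain ⟨B, hB⟩ := hl.exists_bound
      refine ⟨B, fun c s a ha => ?_⟩
      have := (esize_lt_of_mem ha).trans_le (hB c)
      simp; omega)
  refine h.of_enc_eq fun c => congrArg _ ?_
  simp

@[fun_prop]
theorem PT.list_append {l l' : γ → List α} (hl : PT l) (hl' : PT l') :
    PT (fun c => l c ++ l' c) := by
  have h : PT (fun c => (l c).reverse.foldl (fun acc a => a :: acc) (l' c)) :=
    hl.list_reverse.foldl_of_add hl' (by fun_prop) (by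
      obtain ⟨B, hB⟩ := hl.exists_bound
      refine ⟨B, fun c s a ha => ?_⟩
      have := (esize_lt_of_mem (List.mem_reverse.1 ha)).trans_le (hB c)
      simp; omega)
  refine h.of_enc_eq fun c => congrArg _ ?_
  simp

/-- The results of a polynomial time function on the elements of a list are small. -/
theorem PT.exists_bound_of_mem {l : γ → List α} {f : γ → α → β} (hl : PT l)
    (hf : PT (fun x : γ × α => f x.1 x.2)) :
    ∃ P : Polynomial ℕ, ∀ c, ∀ a ∈ l c, esize (f c a) ≤ P.eval (esize c) := by
  obtain ⟨B, hB⟩ := hl.exists_bound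
  obtain ⟨F, hF⟩ := hf.exists_bound
  refine ⟨F.comp (Polynomial.X + B + 1), fun c a ha => (hF (c, a)).trans ?_⟩
  rw [Polynomial.eval_comp]
  apply F.eval_mono_nat
  have := (esize_lt_of_mem ha).trans_le (hB c)
  simp; omega

@[fun_prop]
theorem PT.list_flatMap {l : γ → List α} {f : γ → α → List β} (hl : PT l)
    (hf : PT (fun x : γ × α => f x.1 x.2)) : PT (fun c => (l c).flatMap (f c)) := by
  have h : PT (fun c => (l c).foldl (fun acc a => acc ++ f c a) []) :=
    hl.foldl_of_add (PT.const _) (step := fun c acc a => acc ++ f c a)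
      (by
        have := PT.comp hf (f := fun x : γ × List β × α => (x.1, x.2.2)) (by fun_prop)
        fun_prop)
      (by
        obtain ⟨B, hB⟩ := hl.exists_bound_of_mem hf
        refine ⟨B, fun c s a ha => ?_⟩
        have := hB c a ha
        have := esize_append s (f c a)
        omega)
  refine h.of_enc_eq fun c => congrArg _ ?_
  rw [List.flatMap_eq_foldl]

@[fun_prop]
theorem PT.list_map {l : γ → List α} {f : γ → α → β} (hl : PT l)
    (hf : PT (fun x : γ × α => f x.1 x.2)) : PT (fun c => (l c).map (f c)) :=
  (show PT (fun c => (l c).flatMap fun a => [f c a]) by fun_prop).of_enc_eq fun c => by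
    rw [List.map_eq_flatMap]

@[fun_prop]
theorem PT.list_filter {l : γ → List α} {p : γ → α → Bool} (hl : PT l)
    (hp : PT (fun x : γ × α => p x.1 x.2)) : PT (fun c => (l c).filter (p c)) :=
  (show PT (fun c => (l c).flatMap fun a => bif p c a then [a] else []) by
    fun_prop).of_enc_eq fun c => congrArg _ (by
      generalize l c = l
      induction l with
      | nil => rfl
      | cons a l ih => cases h : p c a <;> simp [h, ih])

/-! ### Binary arithmetic -/

theorem esize_nat_le (n : ℕ) : esize n ≤ 4 * n.size + 1 := by
  rw [← Nat.size_eq_bits_len, esize, enc_nat]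
  have := esize_list_le (l := n.bits) (B := 3) fun b _ => esize_bool_le b
  simp only [esize] at this; omega

theorem size_lt_esize_nat (n : ℕ) : n.size < esize n := by
  rw [← Nat.size_eq_bits_len, esize, enc_nat]
  exact length_lt_esize _

theorem esize_nat_le_self (n : ℕ) : esize n ≤ 4 * n + 1 := by
  have := esize_nat_le n
  have : n.size ≤ n := Nat.size_le.2 n.lt_two_pow_self
  omega

@[fun_prop]
theorem PT.nat_bits {f : γ → ℕ} (hf : PT f) : PT (fun c => (f c).bits) :=
  hf.of_enc_eq fun _ => rfl

@[fun_prop]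
theorem PT.nat_div2 {f : γ → ℕ} (hf : PT f) : PT (fun c => (f c).div2) :=
  (show PT (fun c => (f c).bits.tail) by fun_prop).of_enc_eq fun c => by
    rw [enc_nat, Nat.div2_bits_eq_tail]

@[fun_prop]
theorem PT.nat_bodd {f : γ → ℕ} (hf : PT f) : PT (fun c => (f c).bodd) :=
  (PT.headD_of_enc hf.nat_bits false rfl).of_enc_eq fun c => by
    rw [Nat.bodd_eq_bits_head]; cases (f c).bits <;> rfl

/-- Zero has no digits, so `false` put below the empty list must give the empty list; this is the
only exception to prepending. -/
theorem bits_bit (b : Bool) (n : ℕ) :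
    (Nat.bit b n).bits = bif !b && n.bits.isEmpty then [] else b :: n.bits := by
  rcases Nat.eq_zero_or_pos n with rfl | h
  · cases b <;> simp
  · rw [Nat.bits_append_bit _ _ (by omega)]
    have : n.bits ≠ [] := by
      intro h'
      have := Nat.size_eq_bits_len n
      rw [h', List.length_nil, eq_comm, Nat.size_eq_zero] at this
      omega
    cases hb : n.bits <;> simp_all

theorem esize_bit_le (b : Bool) (n : ℕ) : esize (Nat.bit b n) ≤ esize n + 4 := by
  have h1 : esize (Nat.bit b n) = esize (Nat.bit b n).bits := rfl
  have h2 : esize n = esize n.bits := rfl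
  have := esize_bool_le b
  rw [h1, bits_bit, h2]
  cases !b && n.bits.isEmpty <;> simp
  omega

@[fun_prop]
theorem PT.nat_bit {b : γ → Bool} {f : γ → ℕ} (hb : PT b) (hf : PT f) :
    PT (fun c => Nat.bit (b c) (f c)) :=
  (show PT (fun c => bif !b c && (f c).bits.isEmpty then [] else b c :: (f c).bits) by
    fun_prop).of_enc_eq fun c => by rw [enc_nat, bits_bit]

/-- The number with the given binary digits, most significant first. -/
def ofDigits (l : List Bool) (n : ℕ) : ℕ := l.foldl (fun n b => Nat.bit b n) n

@[fun_prop]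
theorem PT.of_digits {l : γ → List Bool} {f : γ → ℕ} (hl : PT l) (hf : PT f) :
    PT (fun c => ofDigits (l c) (f c)) :=
  hl.foldl_of_add hf (step := fun _ n b => Nat.bit b n) (by fun_prop)
    ⟨4, fun c s a _ => (esize_bit_le a s).trans (by simp)⟩

/-- One step of binary addition on (remaining summands, carry, digits). -/
def addStep (s : ℕ × ℕ × Bool × List Bool) : ℕ × ℕ × Bool × List Bool :=
  (s.1.div2, s.2.1.div2, (s.1.bodd && s.2.1.bodd) || (s.2.2.1 && (s.1.bodd ^^ s.2.1.bodd)),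
    (s.1.bodd ^^ s.2.1.bodd ^^ s.2.2.1) :: s.2.2.2)

@[fun_prop]
theorem PT.binary_add_step {f : γ → ℕ × ℕ × Bool × List Bool} (hf : PT f) :
    PT (fun c => addStep (f c)) := by
  unfold addStep; fun_prop

/-- The invariant of binary addition: the new digit is the parity of the sum, and the remaining
summands with the new carry add up to its half. -/
theorem addStep_sum (x y : ℕ) (b : Bool) (l : List Bool) :
    (addStep (x, y, b, l)).1 + (addStep (x, y, b, l)).2.1 +
      (addStep (x, y, b, l)).2.2.1.toNat = (x + y + b.toNat) / 2 ∧
    Nat.bit (x.bodd ^^ y.bodd ^^ b) ((x + y + b.toNat) / 2) = x + y + b.toNat := by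
  have hx := Nat.bodd_add_div2 x
  have hy := Nat.bodd_add_div2 y
  simp only [addStep]
  rw [Nat.bit_val]
  cases b <;> cases hx' : x.bodd <;> cases hy' : y.bodd <;> simp [hx', hy'] at hx hy ⊢ <;> omega

/-- `l` is only a clock, long enough for the remaining sum to reach zero. Digits are pushed in
front, so the most significant one ends up first, as `ofDigits` expects. -/
theorem ofDigits_addStep {δ : Type} (l : List δ) (x y : ℕ) (b : Bool) (out : List Bool)
    (h : x + y + b.toNat < 2 ^ l.length) :
    ofDigits (l.foldl (fun s _ => addStep s) (x, y, b, out)).2.2.2 0 =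
      ofDigits out (x + y + b.toNat) := by
  induction l generalizing x y b out with
  | nil => simp at h; simp [h]
  | cons d l ih =>
    obtain ⟨h1, h2⟩ := addStep_sum x y b out
    rw [List.length_cons, pow_succ] at h
    rw [List.foldl_cons]
    refine (ih _ _ _ _ (h1.trans_lt (by omega))).trans ?_
    refine (congrArg (ofDigits _) h1).trans ?_
    conv_rhs => rw [← h2]
    rfl

theorem esize_div2_le (n : ℕ) : esize n.div2 ≤ esize n := by
  have h1 : esize n.div2 = esize n.div2.bits := rfl
  have h2 : esize n = esize n.bits := rfl
  rw [h1, h2, Nat.div2_bits_eq_tail]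
  cases n.bits <;> simp
  omega

@[fun_prop]
theorem PT.nat_add {f g : γ → ℕ} (hf : PT f) (hg : PT g) : PT (fun c => f c + g c) := by
  -- Both digit lists and one more entry make a sufficient clock: `x + y < 2 ^ (size x + size y +
  -- 1)`.
  have h : PT (fun c => ((f c).bits ++ (g c).bits ++ [true]).foldl (fun s _ => addStep s)
      (f c, g c, false, [])) := by
    refine PT.foldl_of_add (step := fun _ s _ => addStep s) (by fun_prop) (by fun_prop)
      (by fun_prop) ⟨10, ?_⟩
    rintro c ⟨x, y, b, l⟩ a -
    have h1 := esize_div2_le x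
    have h2 := esize_div2_le y
    have h3 := esize_bool_le (x.bodd ^^ y.bodd ^^ b)
    have h4 := esize_bool_le ((x.bodd && y.bodd) || (b && (x.bodd ^^ y.bodd)))
    simp only [addStep, esize_pair, esize_cons, Polynomial.eval_ofNat]
    have := esize_pos b
    omega
  refine (show PT (fun c => ofDigits (((f c).bits ++ (g c).bits ++ [true]).foldl
    (fun s _ => addStep s) (f c, g c, false, [])).2.2.2 0) by fun_prop).of_enc_eq fun c => ?_
  rw [ofDigits_addStep]
  · simp [ofDigits]
  · have h1 := Nat.lt_size_self (f c)
    have h2 := Nat.lt_size_self (g c)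
    simp only [List.length_append, Nat.size_eq_bits_len, List.length_singleton, pow_succ,
      pow_add, Bool.toNat_false]
    have h3 : 0 < 2 ^ (f c).size := by positivity
    have h4 : 0 < 2 ^ (g c).size := by positivity
    nlinarith

/-- The summand `b` on the left makes the induction close: `2 * a + b + b ≤ 2 * (a + b)`. The bound
keeps intermediate products short. -/
theorem mul_fold_add_le (b : ℕ) (l : List Bool) :
    l.foldl (fun a d => a + a + bif d then b else 0) 0 + b ≤ 2 ^ l.length * b := by
  induction l using List.reverseRecOn with
  | nil => simp
  | append_singleton l d ih =>
    rw [List.foldl_append, List.length_append, List.length_singleton, pow_succ]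
    cases d <;> simp <;> nlinarith

/-- Horner's scheme, reading the most significant digit first. -/
theorem mul_fold_eq (b : ℕ) (a : ℕ) :
    a.bits.reverse.foldl (fun a d => a + a + bif d then b else 0) 0 = a * b := by
  rw [List.foldl_reverse]
  induction a using Nat.binaryRec' with
  | zero => simp
  | bit d n h ih =>
    rw [Nat.bits_append_bit _ _ h, List.foldr_cons, ih, Nat.bit_val]
    cases d <;> simp <;> ring

@[fun_prop]
theorem PT.nat_mul {f g : γ → ℕ} (hf : PT f) (hg : PT g) : PT (fun c => f c * g c) := by
  have h : PT (fun c => (f c).bits.reverse.foldl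
      (fun a d => a + a + bif d then g c else 0) 0) := by
    obtain ⟨F, hF⟩ := hf.exists_bound
    obtain ⟨G, hG⟩ := hg.exists_bound
    refine PT.foldl (step := fun c a d => a + a + bif d then g c else 0) (by fun_prop)
      (by fun_prop) (by fun_prop) ⟨4 * (F + G) + 1, fun c l' hl' => ?_⟩
    have h1 := mul_fold_add_le (g c) l'
    have h2 : (l'.foldl (fun a d => a + a + bif d then g c else 0) 0).size ≤
        l'.length + (g c).size := by
      rw [Nat.size_le, pow_add]
      have := Nat.lt_size_self (g c)
      have h0 : 0 < 2 ^ l'.length := by positivity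
      nlinarith
    have h3 := hl'.length_le
    rw [List.length_reverse, Nat.size_eq_bits_len] at h3
    have h4 := size_lt_esize_nat (f c)
    have h5 := size_lt_esize_nat (g c)
    have h6 := hF c
    have h7 := hG c
    refine (esize_nat_le _).trans ?_
    simp only [Polynomial.eval_add, Polynomial.eval_mul, Polynomial.eval_ofNat,
      Polynomial.eval_one]
    omega
  exact h.of_enc_eq fun c => by rw [mul_fold_eq]

@[fun_prop]
theorem PT.nat_pow {f : γ → ℕ} (hf : PT f) (j : ℕ) : PT (fun c => f c ^ j) := by
  induction j with
  | zero => simpa using PT.const 1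
  | succ j ih => simp only [pow_succ]; fun_prop

/-- One step of binary comparison on (remaining numbers, comparison of the digits read). -/
def leStep (s : ℕ × ℕ × Bool) : ℕ × ℕ × Bool :=
  (s.1.div2, s.2.1.div2, bif s.1.bodd ^^ s.2.1.bodd then s.2.1.bodd else s.2.2)

@[fun_prop]
theorem PT.binary_le_step {f : γ → ℕ × ℕ × Bool} (hf : PT f) : PT (fun c => leStep (f c)) := by
  unfold leStep; fun_prop

/-- Digits are read from the least significant one, so a later difference overrides the verdict so
far; `b` is the answer for equal numbers. -/
theorem foldl_leStep {δ : Type} (l : List δ) (x y : ℕ) (b : Bool)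
    (hx : x < 2 ^ l.length) (hy : y < 2 ^ l.length) :
    (l.foldl (fun s _ => leStep s) (x, y, b)).2.2 = decide (x < y ∨ x = y ∧ b) := by
  induction l generalizing x y b with
  | nil => simp at hx hy; simp [hx, hy]
  | cons d l ih =>
    rw [List.length_cons, pow_succ] at hx hy
    have h1 := Nat.bodd_add_div2 x
    have h2 := Nat.bodd_add_div2 y
    have h3 : x.div2 < 2 ^ l.length := by rw [Nat.div2_val]; omega
    have h4 : y.div2 < 2 ^ l.length := by rw [Nat.div2_val]; omega
    rw [List.foldl_cons, leStep, ih _ _ _ h3 h4]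
    rw [decide_eq_decide]
    generalize x.div2 = x' at *
    generalize y.div2 = y' at *
    cases b <;> cases hx' : x.bodd <;> cases hy' : y.bodd <;>
      simp only [hx', hy', Bool.toNat_true, Bool.toNat_false, Bool.xor_self, Bool.xor_false,
        Bool.xor_true, Bool.not_false, cond_true, cond_false, and_true, and_false, eq_self, or_false,
        Bool.false_eq_true] at h1 h2 ⊢ <;> omega

@[fun_prop]
theorem PT.nat_le {f g : γ → ℕ} (hf : PT f) (hg : PT g) : PT (fun c => decide (f c ≤ g c)) := by
  have h : PT (fun c => ((f c).bits ++ (g c).bits).foldl (fun s _ => leStep s)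
      (f c, g c, true)) := by
    refine PT.foldl_of_add (step := fun _ s _ => leStep s) (by fun_prop) (by fun_prop)
      (by fun_prop) ⟨10, ?_⟩
    rintro c ⟨x, y, b⟩ a -
    have h1 := esize_div2_le x
    have h2 := esize_div2_le y
    have h3 := esize_bool_le (bif x.bodd ^^ y.bodd then y.bodd else b)
    simp only [leStep, esize_pair, Polynomial.eval_ofNat]
    omega
  refine h.snd.snd.of_enc_eq fun c => ?_
  rw [foldl_leStep]
  · congr 1; simp [Nat.le_iff_lt_or_eq]
  · rw [List.length_append, Nat.size_eq_bits_len, pow_add]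
    exact (Nat.lt_size_self _).trans_le (Nat.le_mul_of_pos_right _ (by positivity))
  · rw [List.length_append, Nat.size_eq_bits_len, Nat.size_eq_bits_len, pow_add]
    exact (Nat.lt_size_self _).trans_le (Nat.le_mul_of_pos_left _ (by positivity))

@[fun_prop]
theorem PT.nat_lt {f g : γ → ℕ} (hf : PT f) (hg : PT g) : PT (fun c => decide (f c < g c)) :=
  (show PT (fun c => decide (f c + 1 ≤ g c)) by fun_prop).of_enc_eq fun _ => rfl

/-- Types on which equality can be tested in polynomial time. -/
class PTEq (α : Type) [Enc α] [DecidableEq α] : Prop where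
  pt_eq : PT (fun x : α × α => decide (x.1 = x.2))

@[fun_prop]
theorem PT.eq [DecidableEq α] [PTEq α] {f g : γ → α} (hf : PT f) (hg : PT g) :
    PT (fun c => decide (f c = g c)) :=
  PT.comp (g := fun x : α × α => decide (x.1 = x.2)) PTEq.pt_eq (f := fun c => (f c, g c))
    (by fun_prop)

instance : PTEq ℕ where
  pt_eq := (show PT (fun x : ℕ × ℕ => decide (x.1 ≤ x.2) && decide (x.2 ≤ x.1)) by
    fun_prop).of_enc_eq fun x => congrArg _ (by
      rw [← Bool.decide_and]; exact decide_eq_decide.2 (by omega))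

theorem PTEq.of_injective [DecidableEq α] [DecidableEq β] [PTEq β] {f : α → β} (hf : PT f)
    (hi : Function.Injective f) : PTEq α where
  pt_eq := (show PT (fun x : α × α => decide (f x.1 = f x.2)) by fun_prop).of_enc_eq fun x =>
    congrArg _ (decide_eq_decide.2 hi.eq_iff.symm)

instance [DecidableEq α] [DecidableEq β] [PTEq α] [PTEq β] : PTEq (α × β) where
  pt_eq := (show PT (fun x : (α × β) × α × β => decide (x.1.1 = x.2.1) && decide (x.1.2 = x.2.2)) by
    fun_prop).of_enc_eq fun x => congrArg _ (by
      rw [← Bool.decide_and]; exact decide_eq_decide.2 Prod.ext_iff)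

/-! ### Integers and rationals through their natural components. -/

@[fun_prop]
theorem PT.int_neg {f : γ → ℤ} (hf : PT f) : PT (fun c => decide (f c < 0)) :=
  PT.comp (g := fun x : Bool × ℕ => x.1) (f := fun c => (decide (f c < 0), (f c).natAbs))
    (by fun_prop) (hf.of_enc_eq fun _ => rfl)

@[fun_prop]
theorem PT.int_natAbs {f : γ → ℤ} (hf : PT f) : PT (fun c => (f c).natAbs) :=
  PT.comp (g := fun x : Bool × ℕ => x.2) (f := fun c => (decide (f c < 0), (f c).natAbs))
    (by fun_prop) (hf.of_enc_eq fun _ => rfl)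

@[fun_prop]
theorem PT.int_toNat {f : γ → ℤ} (hf : PT f) : PT (fun c => (f c).toNat) :=
  (show PT (fun c => bif decide (f c < 0) then 0 else (f c).natAbs) by
    fun_prop).of_enc_eq fun c => congrArg _ (by
      by_cases h : f c < 0 <;> simp [h] <;> omega)

@[fun_prop]
theorem PT.int_neg_toNat {f : γ → ℤ} (hf : PT f) : PT (fun c => (-f c).toNat) :=
  (show PT (fun c => bif decide (f c < 0) then (f c).natAbs else 0) by
    fun_prop).of_enc_eq fun c => congrArg _ (by
      by_cases h : f c < 0 <;> simp [h] <;> omega)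

@[fun_prop]
theorem PT.rat_num {f : γ → ℚ} (hf : PT f) : PT (fun c => (f c).num) :=
  PT.comp (g := fun x : ℤ × ℕ => x.1) (f := fun c => ((f c).num, (f c).den))
    (by fun_prop) (hf.of_enc_eq fun _ => rfl)

@[fun_prop]
theorem PT.rat_den {f : γ → ℚ} (hf : PT f) : PT (fun c => (f c).den) :=
  PT.comp (g := fun x : ℤ × ℕ => x.2) (f := fun c => ((f c).num, (f c).den))
    (by fun_prop) (hf.of_enc_eq fun _ => rfl)

instance : PTEq ℤ :=
  PTEq.of_injective (f := fun z : ℤ => (z.toNat, (-z).toNat)) (by fun_prop) fun x y h => by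
    simp only [Prod.mk.injEq] at h; omega

instance : PTEq ℚ :=
  PTEq.of_injective (f := fun q : ℚ => (q.num, q.den)) (by fun_prop) fun x y h => by
    simp only [Prod.mk.injEq] at h; exact Rat.ext h.1 h.2

/-! ### Lists and numbers -/

@[fun_prop]
theorem PT.list_length {l : γ → List α} (hl : PT l) : PT (fun c => (l c).length) := by
  obtain ⟨L, hL⟩ := hl.exists_bound
  have key : ∀ l' : List α, l'.foldl (fun n _ => n + 1) 0 = l'.length := by simp
  have h : PT (fun c => (l c).foldl (fun n _ => n + 1) 0) := by
    refine PT.foldl (step := fun _ n _ => n + 1) hl (by fun_prop) (by fun_prop)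
      ⟨4 * L + 1, fun c l' hl' => ?_⟩
    have h1 := hl'.length_le
    have h2 := length_lt_esize (l c)
    have h3 := hL c
    rw [key]
    refine (esize_nat_le_self _).trans ?_
    simp only [Polynomial.eval_add, Polynomial.eval_mul, Polynomial.eval_ofNat,
      Polynomial.eval_one]
    omega
  exact h.of_enc_eq fun c => by rw [key]

@[fun_prop]
theorem PT.list_contains [DecidableEq α] [PTEq α] {l : γ → List α} {f : γ → α} (hl : PT l)
    (hf : PT f) : PT (fun c => decide (f c ∈ l c)) :=
  (show PT (fun c => (l c).any fun a => decide (a = f c)) by fun_prop).of_enc_eq fun c =>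
    congrArg _ (by rw [Bool.eq_iff_iff]; simp)

@[fun_prop]
theorem PT.list_range_length {l : γ → List α} (hl : PT l) :
    PT (fun c => List.range (l c).length) := by
  obtain ⟨L, hL⟩ := hl.exists_bound
  have key : ∀ l' : List α, l'.foldl (fun acc _ => acc ++ [acc.length]) [] =
      List.range l'.length := by
    intro l'
    induction l' using List.reverseRecOn with
    | nil => rfl
    | append_singleton l d ih => simp [ih, List.range_succ]
  have h : PT (fun c => (l c).foldl (fun acc _ => acc ++ [acc.length]) []) := by
    refine PT.foldl (step := fun _ acc _ => acc ++ [acc.length]) hl (by fun_prop) (by fun_prop)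
      ⟨L * (4 * L + 2) + 1, fun c l' hl' => ?_⟩
    have h1 := hl'.length_le
    have h2 := length_lt_esize (l c)
    have h3 := hL c
    rw [key]
    refine (esize_list_le (B := 4 * L.eval (esize c) + 1) fun a ha => ?_).trans ?_
    · have := List.mem_range.1 ha
      refine (esize_nat_le_self _).trans ?_
      omega
    · simp only [Polynomial.eval_add, Polynomial.eval_mul, Polynomial.eval_ofNat,
        Polynomial.eval_one, List.length_range]
      exact Nat.add_le_add_right (Nat.mul_le_mul (by omega) (by omega)) 1
  exact h.of_enc_eq fun c => by rw [key]

@[fun_prop]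
theorem PT.list_take {l : γ → List α} {f : γ → ℕ} (hl : PT l) (hf : PT f) :
    PT (fun c => (l c).take (f c)) := by
  have h : PT (fun c => (l c).foldl
      (fun acc a => acc ++ bif decide (acc.length < f c) then [a] else []) []) := by
    refine PT.foldl_of_add (s := fun _ => [])
      (step := fun c acc a => acc ++ bif decide (acc.length < f c) then [a] else [])
      hl (by fun_prop) (by fun_prop) ?_
    obtain ⟨L, hL⟩ := hl.exists_bound
    refine ⟨L + 1, fun c s a ha => ?_⟩
    have h1 := hL c
    have h2 := esize_lt_of_mem ha
    have h3 := esize_append s (bif decide (s.length < f c) then [a] else [])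
    simp only [Polynomial.eval_add, Polynomial.eval_one]
    cases h : decide (s.length < f c) <;> simp [h] at h3 ⊢
    omega
  refine h.of_enc_eq fun c => congrArg _ ?_
  generalize l c = l
  induction l using List.reverseRecOn with
  | nil => simp
  | append_singleton l a ih =>
    rw [List.foldl_append, ← ih, List.take_append]
    by_cases h : l.length < f c
    · obtain ⟨m, hm⟩ : ∃ m, f c - l.length = m + 1 := ⟨f c - l.length - 1, by omega⟩
      simp [hm, h]
    · have : f c - l.length = 0 := by omega
      simp [this, h]

@[fun_prop]
theorem PT.list_getD {l : γ → List α} {f : γ → ℕ} {d : γ → α} (hl : PT l) (hf : PT f)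
    (hd : PT d) : PT (fun c => (l c).getD (f c) (d c)) := by
  -- The wanted entry is the last one of this prefix; indices out of range are treated by a separate
  -- test.
  have h : PT (fun c => ((l c).take (f c + 1)).foldl (fun _ a => a) (d c)) := by
    refine PT.foldl_of_add (s := d) (step := fun _ _ a => a) (by fun_prop) hd (by fun_prop) ?_
    obtain ⟨L, hL⟩ := hl.exists_bound
    refine ⟨L, fun c s a ha => ?_⟩
    have h1 := hL c
    have h2 := esize_lt_of_mem (List.mem_of_mem_take ha)
    omega
  refine (show PT (fun c => bif decide (f c < (l c).length) then
    ((l c).take (f c + 1)).foldl (fun _ a => a) (d c) else d c) by fun_prop).of_enc_eq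
      fun c => congrArg _ ?_
  by_cases h : f c < (l c).length
  · rw [List.take_succ_eq_append_getElem h, List.foldl_append]
    simp [h]
  · simp [h]

end

open Enc

/-! ### Diversity -/

section
open Classical

theorem hamDist_image {α β : Type} {τ : α → β} {S S' : Finset α}
    (h : Set.InjOn τ (S ∪ S' : Set α)) :
    hamDist (S.image τ) (S'.image τ) = hamDist S S' := by
  have key : ∀ A B : Finset α, Set.InjOn τ (A ∪ B : Set α) →
      (A.image τ \ B.image τ).card = (A \ B).card := by
    intro A B h
    rw [← Finset.card_image_of_injOn (s := A \ B) (f := τ)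
      (h.mono fun a ha => Or.inl (by simpa using (Finset.mem_sdiff.1 ha).1))]
    congr 1
    ext b
    simp only [Finset.mem_sdiff, Finset.mem_image, not_exists, not_and]
    constructor
    · rintro ⟨⟨a, ha, rfl⟩, hb⟩
      exact ⟨a, ⟨ha, fun h' => hb a h' rfl⟩, rfl⟩
    · rintro ⟨a, ⟨ha, hb⟩, rfl⟩
      refine ⟨⟨a, ha, rfl⟩, fun c hc hca => hb ?_⟩
      rwa [← h (Or.inr hc) (Or.inl ha) hca]
  unfold hamDist
  congr 1
  · convert key S S' h
  · convert key S' S (by rwa [Set.union_comm])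

theorem diversity_image {α β : Type} {r : ℕ} {τ : α → β} {S : Fin r → Finset α} {U : Finset α}
    (hU : ∀ i, S i ⊆ U) (h : Set.InjOn τ U) :
    diversity (fun i => (S i).image τ) = diversity S := by
  unfold diversity
  refine Finset.sum_congr rfl fun i _ => Finset.sum_congr rfl fun j _ => hamDist_image ?_
  exact h.mono (Set.union_subset (by exact_mod_cast hU i) (by exact_mod_cast hU j))

theorem hamDist_le {α : Type} {S S' : Finset α} {k : ℕ} (h : S.card ≤ k) (h' : S'.card ≤ k) :
    hamDist S S' ≤ 2 * k := by
  have h1 : (S \ S').card ≤ S.card := Finset.card_le_card Finset.sdiff_subset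
  have h2 : (S' \ S).card ≤ S'.card := Finset.card_le_card Finset.sdiff_subset
  unfold hamDist
  convert (show (S \ S').card + (S' \ S).card ≤ 2 * k by omega) using 3

/-- Larger values of `t` can be rejected, so that `t` stays short in the kernel. -/
theorem diversity_le {α : Type} {r k : ℕ} {S : Fin r → Finset α} (h : ∀ i, (S i).card ≤ k) :
    diversity S ≤ 2 * k * r * r := by
  calc diversity S ≤ ∑ i : Fin r, ∑ j : Fin r, hamDist (S i) (S j) :=
        Finset.sum_le_sum fun i _ => Finset.sum_le_sum_of_subset (Finset.subset_univ _)
    _ ≤ ∑ i : Fin r, ∑ j : Fin r, 2 * k :=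
        Finset.sum_le_sum fun i _ => Finset.sum_le_sum fun j _ => hamDist_le (h i) (h j)
    _ = 2 * k * r * r := by simp; ring

/-- Solutions can be transferred injectively from one instance to another. -/
theorem DiverseInst.IsYes.transfer {Q : SubsetProblem} {I J : Q.Inst} {k r t : ℕ}
    (h : ∀ U : Finset (Q.Item I), U.card ≤ k * r → ∃ τ : Q.Item I → Q.Item J, Set.InjOn τ U ∧
      ∀ S ⊆ U, Q.IsSolution I S → S.card ≤ k → Q.IsSolution J (S.image τ))
    (hI : (⟨I, k, r, t⟩ : DiverseInst Q).IsYes) : (⟨J, k, r, t⟩ : DiverseInst Q).IsYes := by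
  obtain ⟨S, hS, ht⟩ := hI
  have hsub : ∀ i, S i ⊆ Finset.univ.biUnion S := fun i =>
    Finset.subset_biUnion_of_mem S (Finset.mem_univ i)
  -- One injection has to serve all `r` solutions at once; their union has at most `k * r` items.
  obtain ⟨τ, hτ, hsol⟩ := h (Finset.univ.biUnion S) (by
    calc _ ≤ ∑ i : Fin r, (S i).card := Finset.card_biUnion_le
      _ ≤ ∑ i : Fin r, k := Finset.sum_le_sum fun i _ => (hS i).2
      _ = k * r := by simp [mul_comm])
  refine ⟨fun i => (S i).image τ, fun i => ⟨hsol _ (hsub i) (hS i).1 (hS i).2,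
    Finset.card_image_le.trans (hS i).2⟩, ?_⟩
  exact ht.trans (diversity_image hsub hτ).ge

/-- A partial injection extends to a finite set if all other elements have many candidates. -/
theorem exists_injOn_extension {α β : Type} {U : Finset α} {keep : α → Prop} {f : α → β}
    {C : α → Set β} (hf : Set.InjOn f {a | keep a})
    (hC : ∀ a ∈ U, ¬ keep a → ∀ F : Finset β, F.card < U.card → ∃ b ∈ C a, b ∉ F) :
    ∃ τ : α → β, Set.InjOn τ U ∧ (∀ a, keep a → τ a = f a) ∧
      ∀ a ∈ U, ¬ keep a → τ a ∈ C a := by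
  have key : ∀ A : Finset α, A ⊆ U → (∀ a ∈ A, ¬ keep a) →
      ∃ τ : α → β, Set.InjOn τ (A ∪ U.filter keep : Finset α) ∧ (∀ a, keep a → τ a = f a) ∧
        ∀ a ∈ A, τ a ∈ C a := by
    intro A
    induction A using Finset.induction_on with
    | empty => exact fun _ _ => ⟨f, hf.mono fun a ha => by simp_all, fun _ _ => rfl, by simp⟩
    | insert a A ha ih =>
      intro hA hk
      obtain ⟨τ, h1, h2, h3⟩ := ih (fun x hx => hA (by simp [hx])) fun x hx => hk x (by simp [hx])
      have hak := hk a (by simp)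
      have haU := hA (Finset.mem_insert_self a A)
      have hsub : A ∪ U.filter keep ⊆ U :=
        Finset.union_subset (fun x hx => hA (by simp [hx])) (Finset.filter_subset _ _)
      have hna : a ∉ A ∪ U.filter keep := by simp [ha, hak]
      -- Elements are placed one at a time; the values already taken are fewer than `U.card` because
      -- `a` is still missing.
      obtain ⟨b, hb, hbF⟩ := hC a haU hak ((A ∪ U.filter keep).image τ)
        (Finset.card_image_le.trans_lt (Finset.card_lt_card ⟨hsub, fun h => hna (h haU)⟩))
      refine ⟨Function.update τ a b, ?_, fun x hx => ?_, fun x hx => ?_⟩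
      · have hne : ∀ x ∈ A ∪ U.filter keep, x ≠ a := fun x hx h => hna (h ▸ hx)
        rw [Finset.insert_union, Finset.coe_insert, Set.injOn_insert (by exact_mod_cast hna)]
        refine ⟨h1.congr fun x hx => ?_, ?_⟩
        · rw [Function.update_of_ne (hne x hx)]
        · rintro ⟨x, hx, hxb⟩
          rw [Function.update_self, Function.update_of_ne (hne x hx)] at hxb
          exact hbF (Finset.mem_image.2 ⟨x, hx, hxb⟩)
      · rw [Function.update_of_ne (by rintro rfl; exact hak hx), h2 x hx]
      · by_cases hxa : x = a
        · subst hxa; simpa using hb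
        · rw [Function.update_of_ne hxa]
          exact h3 x ((Finset.mem_insert.1 hx).resolve_left hxa)
  obtain ⟨τ, h1, h2, h3⟩ := key (U.filter fun a => ¬ keep a) (Finset.filter_subset _ _)
    fun a ha => (Finset.mem_filter.1 ha).2
  refine ⟨τ, h1.mono fun a ha => ?_, h2, fun a ha hk => h3 a (Finset.mem_filter.2 ⟨ha, hk⟩)⟩
  by_cases hk : keep a
  · exact_mod_cast Finset.mem_union_right _ (Finset.mem_filter.2 ⟨ha, hk⟩)
  · exact_mod_cast Finset.mem_union_left _ (Finset.mem_filter.2 ⟨ha, hk⟩)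

end

/-! ### Kernels that do not change the parameters -/

instance (Q : SubsetProblem) : Enc Q.Inst := ⟨Q.enc⟩
instance (Q : SubsetProblem) : Enc (DiverseInst Q) := ⟨DiverseInst.enc⟩

section
variable {γ : Type} [Enc γ] {Q : SubsetProblem}

theorem PT.diverse_tuple {f : γ → DiverseInst Q} (hf : PT f) :
    PT (fun c => ((f c).inst, (f c).k, (f c).r, (f c).t)) := hf.of_enc_eq fun _ => rfl

@[fun_prop]
theorem PT.diverse_inst {f : γ → DiverseInst Q} (hf : PT f) : PT (fun c => (f c).inst) :=
  hf.diverse_tuple.fst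
@[fun_prop]
theorem PT.diverse_k {f : γ → DiverseInst Q} (hf : PT f) : PT (fun c => (f c).k) :=
  hf.diverse_tuple.snd.fst
@[fun_prop]
theorem PT.diverse_r {f : γ → DiverseInst Q} (hf : PT f) : PT (fun c => (f c).r) :=
  hf.diverse_tuple.snd.snd.fst
@[fun_prop]
theorem PT.diverse_t {f : γ → DiverseInst Q} (hf : PT f) : PT (fun c => (f c).t) :=
  hf.diverse_tuple.snd.snd.snd

@[fun_prop]
theorem PT.diverse_mk {I : γ → Q.Inst} {k r t : γ → ℕ} (hI : PT I) (hk : PT k) (hr : PT r)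
    (ht : PT t) : PT (fun c => (⟨I c, k c, r c, t c⟩ : DiverseInst Q)) :=
  (show PT (fun c => (I c, k c, r c, t c)) by fun_prop).of_enc_eq fun _ => rfl

/-- Provides constant yes- and no-instances over any fixed `I`, by `t = 0` and `t = 1`. -/
theorem DiverseInst.isYes_zero_iff {I : Q.Inst} {k t : ℕ} :
    (⟨I, k, 0, t⟩ : DiverseInst Q).IsYes ↔ t = 0 := by
  constructor
  · rintro ⟨S, -, h⟩
    simpa [diversity] using h
  · rintro rfl
    exact ⟨fun i => i.elim0, fun i => i.elim0, Nat.zero_le _⟩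

/-- A reduction that keeps `k`, `r` and `t`, and detects when there is no small solution, gives a
kernel. -/
theorem HasDiverseKernel.of_reduction {b : ℕ → ℕ → ℕ} (I₀ : Q.Inst) (hI₀ : Q.order I₀ = 0)
    (good : Q.Inst → ℕ → ℕ → Bool) (red : Q.Inst → ℕ → ℕ → Q.Inst)
    (hgood : PT (fun x : Q.Inst × ℕ × ℕ => good x.1 x.2.1 x.2.2))
    (hred : PT (fun x : Q.Inst × ℕ × ℕ => red x.1 x.2.1 x.2.2))
    (hno : ∀ I k r, r ≠ 0 → good I k r = false → ∀ S, Q.IsSolution I S → k < S.card)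
    (hzero : ∀ I r, good I 0 r = true → Q.IsSolution I ∅)
    (hyes : ∀ I k r t, k ≠ 0 → r ≠ 0 → good I k r = true →
      ((⟨red I k r, k, r, t⟩ : DiverseInst Q).IsYes ↔ (⟨I, k, r, t⟩ : DiverseInst Q).IsYes))
    (hsize : ∃ s : Polynomial ℕ, ∀ I k r, k ≠ 0 → r ≠ 0 → good I k r = true →
      Q.size (red I k r) ≤ s.eval (k + r))
    (horder : ∃ C : ℕ, ∀ I k r, k ≠ 0 → r ≠ 0 → good I k r = true →
      Q.order (red I k r) ≤ C * b k r) :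
    HasDiverseKernel Q b := by
  -- Decided cases become constant instances with `r = 0`. If `k = 0`, passing the test on `t` means
  -- `t = 0`, and `good` makes the empty set a solution that can be repeated.
  let K : DiverseInst Q → DiverseInst Q := fun x =>
    bif decide (x.r = 0) then ⟨I₀, 0, 0, bif decide (x.t = 0) then 0 else 1⟩
    else bif good x.inst x.k x.r && decide (x.t ≤ 2 * x.k * x.r * x.r) then
      bif decide (x.k = 0) then ⟨I₀, 0, 0, 0⟩ else ⟨red x.inst x.k x.r, x.k, x.r, x.t⟩
    else ⟨I₀, 0, 0, 1⟩
  have hK : ∀ x, (x.r = 0 ∧ K x = ⟨I₀, 0, 0, if x.t = 0 then 0 else 1⟩) ∨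
      (x.r ≠ 0 ∧ x.k = 0 ∧ x.t = 0 ∧ good x.inst x.k x.r = true ∧ K x = ⟨I₀, 0, 0, 0⟩) ∨
      (x.r ≠ 0 ∧ x.k ≠ 0 ∧ good x.inst x.k x.r = true ∧ x.t ≤ 2 * x.k * x.r * x.r ∧
        K x = ⟨red x.inst x.k x.r, x.k, x.r, x.t⟩) ∨
      (x.r ≠ 0 ∧ (good x.inst x.k x.r = false ∨ 2 * x.k * x.r * x.r < x.t) ∧
        K x = ⟨I₀, 0, 0, 1⟩) := by
    intro x
    by_cases h : x.r = 0
    · refine Or.inl ⟨h, ?_⟩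
      by_cases ht : x.t = 0 <;> simp [K, h, ht]
    · refine Or.inr ?_
      cases hg : good x.inst x.k x.r with
      | false => exact Or.inr <| Or.inr ⟨h, Or.inl rfl, by simp [K, h, hg]⟩
      | true =>
        by_cases ht : x.t ≤ 2 * x.k * x.r * x.r
        · by_cases hk : x.k = 0
          · exact Or.inl ⟨h, hk, by simpa [hk] using ht, rfl, by
              have ht0 : x.t = 0 := by simpa [hk] using ht
              have hg0 := hk ▸ hg
              simp [K, h, hg0, ht0, hk]⟩
          · exact Or.inr <| Or.inl ⟨h, hk, rfl, ht, by simp [K, h, hg, ht, hk]⟩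
        · exact Or.inr <| Or.inr ⟨h, Or.inr (by omega), by simp [K, h, ht]⟩
  refine ⟨K, ?_, fun x => ?_, ?_, ?_⟩
  · have h1 := PT.comp hgood (f := fun x : DiverseInst Q => (x.inst, x.k, x.r)) (by fun_prop)
    have h2 := PT.comp hred (f := fun x : DiverseInst Q => (x.inst, x.k, x.r)) (by fun_prop)
    exact (show PT K by fun_prop)
  · rcases hK x with ⟨h, hx⟩ | ⟨h, hk, ht, hg, hx⟩ | ⟨h, hk, hg, ht, hx⟩ | ⟨h, hg, hx⟩
    · obtain ⟨I, k, r, t⟩ := x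
      dsimp only at h hx ⊢
      subst h
      rw [hx, DiverseInst.isYes_zero_iff, DiverseInst.isYes_zero_iff]
      by_cases ht : t = 0 <;> simp [ht]
    · rw [hx, DiverseInst.isYes_zero_iff]
      refine iff_of_true rfl ⟨fun _ => ∅, fun i => ⟨hzero _ x.r (hk ▸ hg), by simp⟩, ?_⟩
      rw [ht]; exact Nat.zero_le _
    · rw [hx]
      exact hyes _ _ _ _ hk h hg
    · rw [hx, DiverseInst.isYes_zero_iff]
      refine iff_of_false (by simp) ?_
      rintro ⟨S, hS, ht⟩
      rcases hg with hg | hg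
      · have := hno _ _ _ h hg _ (hS ⟨0, Nat.pos_of_ne_zero h⟩).1
        exact absurd (hS ⟨0, Nat.pos_of_ne_zero h⟩).2 (by omega)
      · have := diversity_le fun i => (hS i).2
        omega
  · obtain ⟨s, hs⟩ := hsize
    -- The cubic term bounds the encoding of `t ≤ 2 * k * r * r`, of size at most `4 * t + 1`; `5`
    -- covers the encodings of `0` and `1`.
    refine ⟨Polynomial.C (Q.size I₀) + 5 + s + Polynomial.X +
      8 * Polynomial.X * Polynomial.X * Polynomial.X, fun x => ?_⟩
    simp only [Polynomial.eval_add, Polynomial.eval_mul, Polynomial.eval_ofNat, Polynomial.eval_X,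
      Polynomial.eval_C]
    rcases hK x with ⟨h, hx⟩ | ⟨h, hk, ht, hg, hx⟩ | ⟨h, hk, hg, ht, hx⟩ | ⟨h, hg, hx⟩
    · rw [hx]
      have := esize_nat_le_self (if x.t = 0 then 0 else 1)
      have h1 : (if x.t = 0 then 0 else 1) ≤ 1 := by split_ifs <;> omega
      simp only [DiverseInst.size, esize, enc] at this ⊢
      omega
    · rw [hx]
      have := esize_nat_le_self 0
      simp only [DiverseInst.size, esize, enc] at this ⊢
      omega
    · rw [hx]
      have h1 := esize_nat_le_self x.t
      have h2 := hs _ _ _ hk h hg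
      have h3 : 2 * x.k * x.r * x.r ≤ 2 * (x.k + x.r) * (x.k + x.r) * (x.k + x.r) := by
        gcongr <;> omega
      simp only [DiverseInst.size, esize, enc] at h1 ⊢
      nlinarith
    · rw [hx]
      have := esize_nat_le_self 1
      simp only [DiverseInst.size, esize, enc] at this ⊢
      omega
  · obtain ⟨C, hC⟩ := horder
    refine ⟨C, fun x => ?_⟩
    rcases hK x with ⟨h, hx⟩ | ⟨h, hk, ht, hg, hx⟩ | ⟨h, hk, hg, ht, hx⟩ | ⟨h, hg, hx⟩
    · rw [hx]; simp [hI₀]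
    · rw [hx]; simp [hI₀]
    · rw [hx]; exact hC _ _ _ hk h hg
    · rw [hx]; simp [hI₀]

end

open Enc

/-! ### Reducing the number of hyperedges -/

/-- The number of edges in `L` containing `C`. -/
def edgeCount (L : List (List ℕ)) (C : List ℕ) : ℕ :=
  (L.filter fun f => C.all fun v => decide (v ∈ f)).length

/-- Does some extension of `C` by at most `j` further vertices of `e`, leaving a budget of `i`
vertices, lie in at least `(k + 1) ^ i` edges of `L`? -/
def heavy (k : ℕ) (L : List (List ℕ)) (e : List ℕ) : ℕ → List ℕ → Bool
  | 0, C => decide ((k + 1) ^ 0 ≤ edgeCount L C)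
  | j + 1, C => decide ((k + 1) ^ (j + 1) ≤ edgeCount L C) ||
      e.any fun v => !decide (v ∈ C) && heavy k L e j (v :: C)

/-- Keep only edges none of whose subsets lies in too many edges kept before. -/
def reduceEdges (d k : ℕ) (E : List (List ℕ)) : List (List ℕ) :=
  E.foldl (fun L e => bif heavy k L e d [] then L else e :: L) []

section
variable {γ : Type} [Enc γ]

@[fun_prop]
theorem PT.edge_count {L : γ → List (List ℕ)} {C : γ → List ℕ} (hL : PT L) (hC : PT C) :
    PT (fun c => edgeCount (L c) (C c)) := by
  unfold edgeCount; fun_prop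

@[fun_prop]
theorem PT.heavy_edge (j : ℕ) {k : γ → ℕ} {L : γ → List (List ℕ)} {e C : γ → List ℕ} (hk : PT k)
    (hL : PT L) (he : PT e) (hC : PT C) : PT (fun c => heavy (k c) (L c) (e c) j (C c)) := by
  suffices h : PT (fun x : ℕ × List (List ℕ) × List ℕ × List ℕ =>
      heavy x.1 x.2.1 x.2.2.1 j x.2.2.2) from
    PT.comp h (f := fun c => (k c, L c, e c, C c)) (by fun_prop)
  induction j with
  | zero => unfold heavy; fun_prop
  | succ j ih =>
    unfold heavy
    have := PT.comp ih (f := fun x : (ℕ × List (List ℕ) × List ℕ × List ℕ) × ℕ =>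
      (x.1.1, x.1.2.1, x.1.2.2.1, x.2 :: x.1.2.2.2)) (by fun_prop)
    fun_prop

@[fun_prop]
theorem PT.reduce_edges (d : ℕ) {k : γ → ℕ} {E : γ → List (List ℕ)} (hk : PT k) (hE : PT E) :
    PT (fun c => reduceEdges d (k c) (E c)) := by
  unfold reduceEdges
  refine PT.foldl_of_add (s := fun _ => [])
    (step := fun c L e => bif heavy (k c) L e d [] then L else e :: L) hE (by fun_prop)
    (by fun_prop) ?_
  obtain ⟨B, hB⟩ := hE.exists_bound
  refine ⟨B, fun c L e he => ?_⟩
  have h1 := hB c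
  have h2 := esize_lt_of_mem he
  cases heavy (k c) L e d [] <;> simp
  omega

end

/-! ### Correctness of the edge reduction. -/

theorem edgeCount_cons (e : List ℕ) (L : List (List ℕ)) (C : List ℕ) :
    edgeCount (e :: L) C = edgeCount L C + if C ⊆ e then 1 else 0 := by
  unfold edgeCount
  rw [List.filter_cons]
  by_cases h : C ⊆ e
  · have : (C.all fun v => decide (v ∈ e)) = true := by simpa using fun v hv => h hv
    simp [this, h]
  · have : ¬ (C.all fun v => decide (v ∈ e)) = true := by
      simpa [List.subset_def] using h
    simp only [this, h, if_false, add_zero]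
    simp

theorem edgeCount_nil (L : List (List ℕ)) : edgeCount L [] = L.length := by
  simp [edgeCount]

theorem edgeCount_pos {L : List (List ℕ)} {C : List ℕ} :
    0 < edgeCount L C ↔ ∃ f ∈ L, C ⊆ f := by
  simp [edgeCount, List.length_pos_iff, List.eq_nil_iff_forall_not_mem, List.subset_def]

/-- If every edge containing `C` meets `S`, some vertex of `S` extends `C` in many edges. -/
theorem edgeCount_le_sum {L : List (List ℕ)} {C : List ℕ} {S : Finset ℕ}
    (h : ∀ f ∈ L, C ⊆ f → ∃ v ∈ f, v ∈ S) :
    edgeCount L C ≤ ∑ v ∈ S, edgeCount L (v :: C) := by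
  induction L with
  | nil => simp [edgeCount]
  | cons f L ih =>
    have ih := ih fun g hg => h g (by simp [hg])
    simp only [edgeCount_cons, Finset.sum_add_distrib]
    refine Nat.add_le_add ih ?_
    split_ifs with hC
    · obtain ⟨v, hv, hvS⟩ := h f (by simp) hC
      refine (le_of_eq ?_).trans (Finset.single_le_sum (fun _ _ => Nat.zero_le _) hvS)
      rw [if_pos]
      exact List.cons_subset.2 ⟨hv, hC⟩
    · exact Nat.zero_le _

/-- Each vertex added along a branch of the search uses one unit of budget; `C'` is where the
successful branch ends. -/
theorem heavy_sound {k : ℕ} {L : List (List ℕ)} {e : List ℕ} {j : ℕ} {C : List ℕ}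
    (h : heavy k L e j C = true) (hC : C.Nodup) (hCe : C ⊆ e) :
    ∃ C' i, C'.Nodup ∧ C' ⊆ e ∧ C'.length + i = C.length + j ∧ (k + 1) ^ i ≤ edgeCount L C' := by
  induction j generalizing C with
  | zero => exact ⟨C, 0, hC, hCe, rfl, by simpa [heavy] using h⟩
  | succ j ih =>
    rw [heavy, Bool.or_eq_true, decide_eq_true_eq, List.any_eq_true] at h
    rcases h with h | ⟨v, hv, h⟩
    · exact ⟨C, j + 1, hC, hCe, rfl, h⟩
    · simp only [Bool.and_eq_true, Bool.not_eq_true', decide_eq_false_iff_not] at h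
      obtain ⟨C', i, h1, h2, h3, h4⟩ := ih h.2 (List.nodup_cons.2 ⟨h.1, hC⟩)
        (List.cons_subset.2 ⟨hv, hCe⟩)
      exact ⟨C', i, h1, h2, by rw [h3, List.length_cons]; omega, h4⟩

/-- The search pushes vertices in front, so following it along `D` leads to `D.reverse ++ C`. -/
theorem heavy_complete {k : ℕ} {L : List (List ℕ)} {e : List ℕ} {j i : ℕ} {C D : List ℕ}
    (hj : D.length + i = j) (hn : (D.reverse ++ C).Nodup) (he : D ⊆ e)
    (h : (k + 1) ^ i ≤ edgeCount L (D.reverse ++ C)) : heavy k L e j C = true := by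
  induction D generalizing C j with
  | nil =>
    simp only [List.length_nil, zero_add] at hj
    subst hj
    cases i <;> simp_all [heavy]
  | cons v D ih =>
    obtain ⟨hv, hD⟩ := List.cons_subset.1 he
    simp only [List.reverse_cons, List.append_assoc, List.singleton_append] at hn h
    obtain ⟨j, rfl⟩ : ∃ j', j = j' + 1 := ⟨j - 1, by simp at hj; omega⟩
    have h1 := ih (j := j) (by simp at hj; omega) hn hD h
    rw [heavy, Bool.or_eq_true, List.any_eq_true]
    refine Or.inr ⟨v, hv, ?_⟩
    have : v ∉ C := (List.nodup_cons.1 (List.nodup_append.1 hn).2.1).1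
    simp [this, h1]

/-- No set of vertices lies in too many edges. -/
def Sparse (d k : ℕ) (L : List (List ℕ)) : Prop :=
  ∀ (C : List ℕ) (i : ℕ), C.Nodup → C.length + i = d → edgeCount L C ≤ (k + 1) ^ i

/-- The new edge raises only the counts of its own subsets, and a subset already at its bound would
have made the edge `heavy`. -/
theorem Sparse.cons {d k : ℕ} {L : List (List ℕ)} {e : List ℕ} (hL : Sparse d k L)
    (h : heavy k L e d [] = false) : Sparse d k (e :: L) := by
  intro C i hC hi
  rw [edgeCount_cons]
  split_ifs with hCe
  · by_contra! hlt
    have : heavy k L e d [] = true :=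
      heavy_complete (D := C.reverse) (i := i) (by simpa using hi) (by simpa using hC)
        (by simpa [List.subset_def] using hCe) (by simpa using Nat.lt_succ_iff.1 hlt)
    simp [h] at this
  · exact hL C i hC hi

/-- The list `E` of edges is hit by `S`. -/
def Hits (E : List (List ℕ)) (S : Finset ℕ) : Prop := ∀ e ∈ E, ∃ v ∈ e, v ∈ S

/-- If `S` misses `C`, every kept edge through `C` contains a vertex of `S` outside `C`. For `i >
0`, sparsity allows each of these at most `k` vertices only `(k + 1) ^ (i - 1)` such edges, fewer
than `(k + 1) ^ i` in total. -/
theorem Sparse.hits_of_heavy {d k : ℕ} {L : List (List ℕ)} {S : Finset ℕ} (hL : Sparse d k L)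
    (hd : ∀ f ∈ L, f.length ≤ d) (hS : S.card ≤ k) (hit : Hits L S) {C : List ℕ} {i : ℕ}
    (hC : C.Nodup) (hi : C.length + i = d) (h : (k + 1) ^ i ≤ edgeCount L C) :
    ∃ v ∈ C, v ∈ S := by
  by_contra! hno
  cases i with
  | zero =>
    -- No budget left: `C` has `d` elements, so an edge containing it is `C` up to order, and edges
    -- are hit.
    obtain ⟨f, hf, hCf⟩ := edgeCount_pos.1 (lt_of_lt_of_le (by simp) h)
    obtain ⟨v, hv, hvS⟩ := hit f hf
    have hperm := (List.subperm_of_subset hC hCf).perm_of_length_le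
      ((hd f hf).trans (by omega))
    exact hno v (hperm.mem_iff.2 hv) hvS
  | succ i =>
    have h1 : edgeCount L C ≤ ∑ v ∈ S, edgeCount L (v :: C) :=
      edgeCount_le_sum fun f hf _ => hit f hf
    have h2 : ∑ v ∈ S, edgeCount L (v :: C) ≤ ∑ v ∈ S, (k + 1) ^ i := by
      refine Finset.sum_le_sum fun v hv => hL _ _ (List.nodup_cons.2 ⟨fun hvC => hno v hvC hv, hC⟩) ?_
      rw [List.length_cons]; omega
    have h3 : ∑ v ∈ S, (k + 1) ^ i ≤ k * (k + 1) ^ i := by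
      rw [Finset.sum_const, smul_eq_mul]
      exact Nat.mul_le_mul_right _ hS
    have h4 : 0 < (k + 1) ^ i := by positivity
    rw [pow_succ] at h
    nlinarith

/-- A dropped edge contains a set at its bound among the edges kept so far. A small set hitting
those meets it by `Sparse.hits_of_heavy`, and so hits the dropped edge too. -/
theorem reduceEdges_spec {d k : ℕ} {E : List (List ℕ)} (hd : ∀ e ∈ E, e.length ≤ d) :
    (∀ e ∈ reduceEdges d k E, e ∈ E) ∧ Sparse d k (reduceEdges d k E) ∧
      ∀ S : Finset ℕ, S.card ≤ k → Hits (reduceEdges d k E) S → Hits E S := by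
  unfold reduceEdges
  induction E using List.reverseRecOn with
  | nil => exact ⟨by simp, fun C i _ _ => by simp [edgeCount], fun _ _ h => h⟩
  | append_singleton E e ih =>
    obtain ⟨h1, h2, h3⟩ := ih fun f hf => hd f (by simp [hf])
    rw [List.foldl_append, List.foldl_cons, List.foldl_nil]
    generalize E.foldl (fun L e => bif heavy k L e d [] then L else e :: L) [] = L at *
    cases h : heavy k L e d [] with
    | true =>
      refine ⟨fun f hf => by simp [h1 f hf], h2, fun S hS hit f hf => ?_⟩
      rcases List.mem_append.1 hf with hf | hf
      · exact h3 S hS hit f hf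
      · obtain rfl := List.mem_singleton.1 hf
        obtain ⟨C, i, hC, hCe, hi, hcount⟩ := heavy_sound h List.nodup_nil (by simp)
        obtain ⟨v, hv, hvS⟩ := h2.hits_of_heavy (fun g hg => hd g (by simp [h1 g hg])) hS hit hC
          (by simpa using hi) hcount
        exact ⟨v, hCe hv, hvS⟩
    | false =>
      refine ⟨fun f hf => ?_, h2.cons h, fun S hS hit f hf => ?_⟩
      · rcases List.mem_cons.1 hf with rfl | hf
        · simp
        · simp [h1 f hf]
      · rcases List.mem_append.1 hf with hf | hf
        · exact h3 S hS (fun g hg => hit g (by simp [hg])) f hf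
        · obtain rfl := List.mem_singleton.1 hf
          exact hit f (by simp)

theorem Sparse.length_le {d k : ℕ} {L : List (List ℕ)} (hL : Sparse d k L) :
    L.length ≤ (k + 1) ^ d := by
  have := hL [] d List.nodup_nil (by simp)
  rwa [edgeCount_nil] at this

/-! ### The kept vertices -/

/-- The elements of `V` satisfying `p`, followed by up to `m` others. -/
def keepVertices (V : List ℕ) (p : ℕ → Bool) (m : ℕ) : List ℕ :=
  V.filter p ++ (V.filter fun v => !p v).take m

section
variable {γ : Type} [Enc γ]

@[fun_prop]
theorem PT.keep_vertices {V : γ → List ℕ} {p : γ → ℕ → Bool} {m : γ → ℕ} (hV : PT V)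
    (hp : PT (fun x : γ × ℕ => p x.1 x.2)) (hm : PT m) :
    PT (fun c => keepVertices (V c) (p c) (m c)) := by
  unfold keepVertices; fun_prop

end

theorem mem_keepVertices_of {V : List ℕ} {p : ℕ → Bool} {m v : ℕ} (hv : v ∈ V) (h : p v = true) :
    v ∈ keepVertices V p m := by simp [keepVertices, hv, h]

theorem mem_of_mem_keepVertices {V : List ℕ} {p : ℕ → Bool} {m v : ℕ}
    (h : v ∈ keepVertices V p m) : v ∈ V := by
  rcases List.mem_append.1 h with h | h
  · exact (List.mem_filter.1 h).1
  · exact (List.mem_filter.1 (List.mem_of_mem_take h)).1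

theorem nodup_keepVertices {V : List ℕ} {p : ℕ → Bool} {m : ℕ} (h : V.Nodup) :
    (keepVertices V p m).Nodup := by
  refine List.nodup_append.2 ⟨h.filter _, (h.filter _).sublist (List.take_sublist _ _), ?_⟩
  rintro a ha b hb rfl
  have h1 := (List.mem_filter.1 ha).2
  have h2 := (List.mem_filter.1 (List.mem_of_mem_take hb)).2
  simp [h1] at h2

theorem length_keepVertices_le {V : List ℕ} {p : ℕ → Bool} {m : ℕ} :
    (keepVertices V p m).length ≤ (V.filter p).length + m := by
  simp [keepVertices]

/-- Either many vertices are kept or all of them. -/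
theorem le_length_keepVertices {V : List ℕ} {p : ℕ → Bool} {m v : ℕ} (hv : v ∈ V)
    (h : v ∉ keepVertices V p m) : m ≤ (keepVertices V p m).length := by
  rw [keepVertices, List.length_append, List.length_take]
  by_contra! hlt
  refine h (List.mem_append.2 ?_)
  cases hp : p v
  · right
    rw [List.take_of_length_le (by omega)]
    simp [hv, hp]
  · left; simp [hv, hp]

theorem length_filter_le_of_subset {V : List ℕ} {p : ℕ → Bool} (hV : V.Nodup) {F : Finset ℕ}
    (h : ∀ v ∈ V, p v = true → v ∈ F) : (V.filter p).length ≤ F.card := by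
  rw [← List.toFinset_card_of_nodup (hV.filter _)]
  refine Finset.card_le_card fun v hv => ?_
  have := List.mem_filter.1 (List.mem_toFinset.1 hv)
  exact h v this.1 this.2

open Enc

/-! ### Comparing instances whose items carry labels -/

/-- `ok` describes the items of `J` that may be added to every solution. -/
theorem isYes_iff_of_labels {Q : SubsetProblem} {I J : Q.Inst} {k r t : ℕ} {Λ : Type}
    (ok : Q.Item J → Prop) {φ : Q.Item I → Λ} {ψ : Q.Item J → Λ} (hk : k ≠ 0) (hr : r ≠ 0)
    (hφ : Function.Injective φ) (hψ : Function.Injective ψ) (hrange : ∀ b, ∃ a, φ a = ψ b)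
    (hcand : ∀ a, (∀ b, ψ b ≠ φ a) → ∀ F : Finset (Q.Item J), F.card < k * r →
      ∃ b, ok b ∧ b ∉ F)
    (hIJ : ∀ S T, Q.IsSolution I S → S.card ≤ k → T.card ≤ k →
      (∀ a ∈ S, ∀ b, ψ b = φ a → b ∈ T) → (∀ b ∈ T, ok b ∨ ∃ a ∈ S, ψ b = φ a) →
      Q.IsSolution J T)
    (hJI : ∀ S T, Q.IsSolution J S → S.card ≤ k → T.card ≤ k →
      (∀ a ∈ S, ∀ b, φ b = ψ a → b ∈ T) → (∀ b ∈ T, ∃ a ∈ S, φ b = ψ a) → Q.IsSolution I T) :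
    (⟨J, k, r, t⟩ : DiverseInst Q).IsYes ↔ (⟨I, k, r, t⟩ : DiverseInst Q).IsYes := by
  classical
  constructor
  · refine DiverseInst.IsYes.transfer fun U _ => ?_
    -- Every label of `J` occurs in `I`, so in this direction items are matched by label alone.
    choose τ hτ using hrange
    have hinj : Function.Injective τ := fun a b h => hψ (by rw [← hτ, ← hτ, h])
    refine ⟨τ, hinj.injOn, fun S _ hS hSk => hJI S _ hS hSk (Finset.card_image_le.trans hSk) ?_ ?_⟩
    · intro a ha b hb
      exact Finset.mem_image.2 ⟨a, ha, hφ (by rw [hτ, hb])⟩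
    · intro b hb
      obtain ⟨a, ha, rfl⟩ := Finset.mem_image.1 hb
      exact ⟨a, ha, hτ a⟩
  · refine DiverseInst.IsYes.transfer fun U hU => ?_
    -- `f` needs a value even where no label matches; `hcand` with nothing excluded supplies one,
    -- since `k * r > 0`.
    have : ∀ a, ∃ b, (∃ b', ψ b' = φ a) → ψ b = φ a := by
      intro a
      by_cases h : ∃ b', ψ b' = φ a
      · obtain ⟨b, hb⟩ := h
        exact ⟨b, fun _ => hb⟩
      · obtain ⟨b, -⟩ := hcand a (fun b hb => h ⟨b, hb⟩) ∅ (by simp; omega)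
        exact ⟨b, fun h' => absurd h' h⟩
    choose f hf using this
    -- Items whose label survives keep it; the others go to unused items satisfying `ok`.
    obtain ⟨τ, h1, h2, h3⟩ := exists_injOn_extension (U := U)
      (keep := fun a => ∃ b, ψ b = φ a) (f := f) (C := fun _ => {b | ok b})
      (fun a ha b hb hab => hφ (by rw [← hf a ha, ← hf b hb, hab]))
      (fun a _ ha F hF => by
        exact hcand a (fun b hb => ha ⟨b, hb⟩) F (by omega))
    refine ⟨τ, h1, fun S hSU hS hSk => hIJ S _ hS hSk (Finset.card_image_le.trans hSk) ?_ ?_⟩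
    · intro a ha b hb
      refine Finset.mem_image.2 ⟨a, ha, hψ ?_⟩
      rw [h2 a ⟨b, hb⟩, hf a ⟨b, hb⟩, hb]
    · intro b hb
      obtain ⟨a, ha, rfl⟩ := Finset.mem_image.1 hb
      by_cases h : ∃ b, ψ b = φ a
      · exact Or.inr ⟨a, ha, by rw [h2 a h, hf a h]⟩
      · exact Or.inl (h3 a (hSU ha) h)

theorem getElem_injective {W : List ℕ} (hW : W.Nodup) :
    Function.Injective fun i : Fin W.length => W[i] := fun _ _ h =>
  Fin.ext ((List.Nodup.getElem_inj_iff hW).1 h)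

theorem exists_notMem_fin {m : ℕ} {F : Finset (Fin m)} (h : F.card < m) : ∃ b, b ∉ F := by
  obtain ⟨b, -, hb⟩ := Finset.exists_mem_notMem_of_card_lt_card (s := F) (t := Finset.univ)
    (by simpa using h)
  exact ⟨b, hb⟩

/-- An instance whose solutions are the sets hitting the edges `L`, and its restriction to the
kept vertices `W`. -/
theorem isYes_iff_of_hits {Q : SubsetProblem} {I J : Q.Inst} {n k r t : ℕ} {W : List ℕ}
    {L : List (List ℕ)} {φ : Q.Item I → ℕ} {ψ : Q.Item J → ℕ} (hk : k ≠ 0) (hr : r ≠ 0)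
    (hφ : Function.Injective φ) (hφr : ∀ v, (∃ a, φ a = v) ↔ v < n)
    (hψ : Function.Injective ψ) (hψr : ∀ v, (∃ b, ψ b = v) ↔ v ∈ W)
    (hcard : ∀ F : Finset (Q.Item J), F.card < W.length → ∃ b, b ∉ F)
    (hLW : ∀ e ∈ L, ∀ v ∈ e, v ∈ W) (hWn : ∀ v ∈ W, v < n)
    (hW : ∀ v < n, v ∉ W → k * r ≤ W.length)
    (hI : ∀ S : Finset (Q.Item I), S.card ≤ k →
      (Q.IsSolution I S ↔ ∀ e ∈ L, ∃ v ∈ e, ∃ s ∈ S, φ s = v))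
    (hJ : ∀ S : Finset (Q.Item J), S.card ≤ k →
      (Q.IsSolution J S ↔ ∀ e ∈ L, ∃ v ∈ e, ∃ s ∈ S, ψ s = v)) :
    (⟨J, k, r, t⟩ : DiverseInst Q).IsYes ↔ (⟨I, k, r, t⟩ : DiverseInst Q).IsYes := by
  refine isYes_iff_of_labels (fun _ => True) hk hr hφ hψ (fun b => (hφr _).2 (hWn _ ((hψr _).1 ⟨b, rfl⟩)))
    (fun a ha F hF => ?_) (fun S T hS hSk hTk h _ => ?_) (fun S T hS hSk hTk h _ => ?_)
  · obtain ⟨b, hb⟩ := hcard F (hF.trans_le (hW (φ a) ((hφr _).1 ⟨a, rfl⟩) fun h => by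
      obtain ⟨b, hb⟩ := (hψr _).2 h
      exact ha b hb))
    exact ⟨b, trivial, hb⟩
  · rw [hJ _ hTk]
    rw [hI _ hSk] at hS
    intro e he
    obtain ⟨v, hv, s, hs, hsv⟩ := hS e he
    obtain ⟨b, hb⟩ := (hψr v).2 (hLW e he v hv)
    exact ⟨v, hv, b, h s hs b (hb.trans hsv.symm), hb⟩
  · rw [hI _ hTk]
    rw [hJ _ hSk] at hS
    intro e he
    obtain ⟨v, hv, s, hs, hsv⟩ := hS e he
    obtain ⟨b, hb⟩ := (hφr v).2 (hWn _ (hLW e he v hv))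
    exact ⟨v, hv, b, h s hs b (hb.trans hsv.symm), hb⟩

/-! ### Hitting Set and Vertex Cover: the algorithm -/

/-- The positions of `true`. -/
def support (b : List Bool) : List ℕ :=
  (List.range b.length).filter fun v => b.getD v false

/-- The kept vertices when `L` are the kept edges. -/
def edgeVertices (n : List ℕ) (L : List (List ℕ)) (m : ℕ) : List ℕ :=
  keepVertices n (fun v => L.any fun e => decide (v ∈ e)) m

section
variable {γ : Type} [Enc γ]

@[fun_prop]
theorem PT.bits_support {b : γ → List Bool} (hb : PT b) : PT (fun c => support (b c)) := by
  unfold support; fun_prop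

@[fun_prop]
theorem PT.edge_vertices {V : γ → List ℕ} {L : γ → List (List ℕ)} {m : γ → ℕ} (hV : PT V)
    (hL : PT L) (hm : PT m) : PT (fun c => edgeVertices (V c) (L c) (m c)) := by
  unfold edgeVertices; fun_prop
end

theorem mem_support_ofFn {n : ℕ} {p : Fin n → Bool} {v : ℕ} :
    v ∈ support (List.ofFn p) ↔ ∃ h : v < n, p ⟨v, h⟩ = true := by
  simp only [support, List.length_ofFn, List.mem_filter, List.mem_range]
  constructor
  · rintro ⟨h, h'⟩
    exact ⟨h, by simpa [h] using h'⟩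
  · rintro ⟨h, h'⟩
    exact ⟨h, by simpa [h] using h'⟩

theorem length_support_ofFn {n : ℕ} {e : Finset (Fin n)} :
    (support (List.ofFn fun v => decide (v ∈ e))).length = e.card := by
  have hnd : (support (List.ofFn fun v => decide (v ∈ e))).Nodup :=
    (List.nodup_range).filter _
  rw [← List.toFinset_card_of_nodup hnd, ← Finset.card_map (Fin.valEmbedding)]
  congr 1
  ext v
  simp only [List.mem_toFinset, mem_support_ofFn, decide_eq_true_eq, Finset.mem_map,
    Fin.valEmbedding_apply]
  constructor
  · rintro ⟨h, h'⟩; exact ⟨_, h', rfl⟩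
  · rintro ⟨a, ha, rfl⟩; exact ⟨a.2, ha⟩

theorem length_edgeVertices_le {n d m : ℕ} {L : List (List ℕ)} (hL : ∀ e ∈ L, e.length ≤ d) :
    (edgeVertices (List.range n) L m).length ≤ d * L.length + m := by
  refine length_keepVertices_le.trans (Nat.add_le_add_right ?_ m)
  refine (length_filter_le_of_subset (F := (L.flatMap id).toFinset) List.nodup_range
    fun v _ hv => ?_).trans ?_
  · simpa using hv
  · refine (List.toFinset_card_le _).trans ?_
    rw [List.length_flatMap]
    refine (List.sum_le_card_nsmul _ d ?_).trans ?_
    · simpa using hL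
    · simp [mul_comm]

theorem mem_edgeVertices_of_mem {n m v : ℕ} {L : List (List ℕ)} {e : List ℕ} (he : e ∈ L)
    (hv : v ∈ e) (hn : v < n) : v ∈ edgeVertices (List.range n) L m :=
  mem_keepVertices_of (List.mem_range.2 hn) (by simpa using ⟨e, he, hv⟩)

theorem encList_map {α β : Type} (e : β → Data) (f : α → β) (l : List α) :
    encList e (l.map f) = encList (fun a => e (f a)) l := by
  induction l with
  | nil => rfl
  | cons a l ih => simp [encList, ih]

theorem encList_const_nil {α β : Type} {l : List α} {l' : List β} (h : l.length = l'.length) :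
    encList (fun _ => Data.nil) l = encList (fun _ => Data.nil) l' := by
  induction l generalizing l' with
  | nil => cases l' with
    | nil => rfl
    | cons => simp at h
  | cons a l ih => cases l' with
    | nil => simp at h
    | cons b l' => simp [encList, ih (l' := l') (by simpa using h)]

theorem ofFn_getElem_eq_map {α : Type} (W : List ℕ) (g : ℕ → α) :
    List.ofFn (fun i : Fin W.length => g W[i]) = W.map g := by
  refine List.ext_getElem (by simp) fun i h1 h2 => by simp

/-! ### Hitting Set -/

namespace HypergraphInst
variable {d : ℕ}

/-- The number of vertices in unary. -/
def unary (I : HypergraphInst d) : List Unit := List.replicate I.n ()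

/-- The incidence vectors of the hyperedges. -/
def rows (I : HypergraphInst d) : List (List Bool) :=
  I.edges.map fun e => List.ofFn fun v => decide (v ∈ e)

/-- Lets programs treat a hypergraph as a pair of lists. -/
theorem enc_rep (I : HypergraphInst d) : Enc.enc (I.unary, I.rows) = I.enc := by
  have h1 : Enc.enc (List.replicate I.n ()) = encList (fun _ => Data.nil) (List.range I.n) :=
    encList_const_nil (by simp)
  have h2 : Enc.enc I.rows =
      encList (fun e => encList encBool (List.ofFn fun v => decide (v ∈ e))) I.edges :=
    encList_map _ _ _
  rw [HypergraphInst.enc, ← h1, ← h2]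
  rfl

/-- The hyperedges as lists of vertices. -/
def edgeLists (I : HypergraphInst d) : List (List ℕ) := I.rows.map support

theorem length_le_of_mem_edgeLists {I : HypergraphInst d} {e : List ℕ} (h : e ∈ I.edgeLists) :
    e.length ≤ d := by
  simp only [edgeLists, rows, List.map_map, List.mem_map, Function.comp] at h
  obtain ⟨e, he, rfl⟩ := h
  rw [length_support_ofFn]
  exact I.card_le e he

theorem lt_of_mem_edgeLists {I : HypergraphInst d} {e : List ℕ} (h : e ∈ I.edgeLists) {v : ℕ}
    (hv : v ∈ e) : v < I.n := by
  simp only [edgeLists, rows, List.map_map, List.mem_map, Function.comp] at h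
  obtain ⟨e, he, rfl⟩ := h
  exact (mem_support_ofFn.1 hv).1

theorem isSolution_iff (I : HypergraphInst d) (S : Finset (Fin I.n)) :
    (hittingSet d).IsSolution I S ↔ ∀ e ∈ I.edgeLists, ∃ v ∈ e, ∃ s ∈ S, (s : ℕ) = v := by
  simp only [hittingSet, edgeLists, rows, List.map_map, List.mem_map, Function.comp,
    forall_exists_index, and_imp, forall_apply_eq_imp_iff₂, mem_support_ofFn, decide_eq_true_eq]
  refine forall₂_congr fun e _ => ?_
  constructor
  · rintro ⟨v, hv, hS⟩; exact ⟨v, ⟨v.2, hv⟩, v, hS, rfl⟩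
  · rintro ⟨v, ⟨h, hv⟩, s, hs, rfl⟩; exact ⟨s, hv, hs⟩

/-- The kept hyperedges. -/
def keptEdges (I : HypergraphInst d) (k : ℕ) : List (List ℕ) := reduceEdges d k I.edgeLists

/-- The kept vertices. -/
def kept (I : HypergraphInst d) (k m : ℕ) : List ℕ :=
  edgeVertices (List.range I.n) (I.keptEdges k) m

theorem mem_of_mem_keptEdges {I : HypergraphInst d} {k : ℕ} {e : List ℕ} (h : e ∈ I.keptEdges k) :
    e ∈ I.edgeLists :=
  (reduceEdges_spec fun _ => length_le_of_mem_edgeLists).1 e h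

theorem isSolution_iff_kept {I : HypergraphInst d} {k : ℕ} {S : Finset (Fin I.n)}
    (hS : S.card ≤ k) :
    (hittingSet d).IsSolution I S ↔ ∀ e ∈ I.keptEdges k, ∃ v ∈ e, ∃ s ∈ S, (s : ℕ) = v := by
  rw [isSolution_iff]
  refine ⟨fun h e he => h e (mem_of_mem_keptEdges he), fun h => ?_⟩
  have := (reduceEdges_spec (k := k) fun _ => length_le_of_mem_edgeLists (I := I)).2.2
    (S.map Fin.valEmbedding) (by simpa using hS)
  simp only [Hits, Finset.mem_map, Fin.valEmbedding_apply] at this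
  exact this h

/-- The kernel. -/
def reduced (I : HypergraphInst d) (k r : ℕ) : HypergraphInst d where
  n := (I.kept k (k * r)).length
  edges := (I.keptEdges k).map fun e =>
    Finset.univ.filter fun i : Fin (I.kept k (k * r)).length => (I.kept k (k * r))[i] ∈ e
  card_le := by
    intro e he
    obtain ⟨e, he', rfl⟩ := List.mem_map.1 he
    refine le_trans ?_ (length_le_of_mem_edgeLists (mem_of_mem_keptEdges he'))
    refine (Finset.card_le_card_of_injOn (t := e.toFinset) (fun i => (I.kept k (k * r))[i])
      (fun i hi => ?_) (getElem_injective (nodup_keepVertices List.nodup_range)).injOn).trans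
      (List.toFinset_card_le e)
    exact List.mem_toFinset.2 (Finset.mem_filter.1 (Finset.mem_coe.1 hi)).2

theorem rep_reduced (I : HypergraphInst d) (k r : ℕ) :
    ((I.reduced k r).unary, (I.reduced k r).rows) = ((I.kept k (k * r)).map fun _ => (),
      (I.keptEdges k).map fun e => (I.kept k (k * r)).map fun v => decide (v ∈ e)) := by
  simp only [unary, rows, reduced, List.map_map, Prod.mk.injEq]
  refine ⟨(List.map_const' ..).symm, List.map_congr_left fun e _ => ?_⟩
  refine Eq.trans ?_ (ofFn_getElem_eq_map _ _)
  refine congrArg List.ofFn (funext fun v => decide_eq_decide.2 ?_)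
  exact ⟨fun h => (Finset.mem_filter.1 h).2, fun h => Finset.mem_filter.2 ⟨Finset.mem_univ _, h⟩⟩

instance : Enc (HypergraphInst d) := ⟨HypergraphInst.enc⟩

section
variable {γ : Type} [Enc γ]

@[fun_prop]
theorem pt_unary {f : γ → HypergraphInst d} (hf : PT f) : PT (fun c => (f c).unary) :=
  (show PT (fun c => ((f c).unary, (f c).rows)) from hf.of_enc_eq fun _ => enc_rep _).fst

@[fun_prop]
theorem pt_rows {f : γ → HypergraphInst d} (hf : PT f) : PT (fun c => (f c).rows) :=
  (show PT (fun c => ((f c).unary, (f c).rows)) from hf.of_enc_eq fun _ => enc_rep _).snd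

@[fun_prop]
theorem pt_keptEdges {f : γ → HypergraphInst d} {k : γ → ℕ} (hf : PT f) (hk : PT k) :
    PT (fun c => (f c).keptEdges (k c)) := by
  unfold keptEdges edgeLists; fun_prop

@[fun_prop]
theorem pt_kept {f : γ → HypergraphInst d} {k m : γ → ℕ} (hf : PT f) (hk : PT k) (hm : PT m) :
    PT (fun c => (f c).kept (k c) (m c)) := by
  have : ∀ I : HypergraphInst d, List.range I.n = List.range I.unary.length := fun I => by
    simp [unary]
  unfold kept
  simp only [this]
  fun_prop

theorem pt_reduced : PT (fun x : HypergraphInst d × ℕ × ℕ => x.1.reduced x.2.1 x.2.2) := by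
  refine (show PT (fun x : HypergraphInst d × ℕ × ℕ =>
      ((x.1.kept x.2.1 (x.2.1 * x.2.2)).map fun _ => (),
        (x.1.keptEdges x.2.1).map fun e => (x.1.kept x.2.1 (x.2.1 * x.2.2)).map fun v =>
          decide (v ∈ e))) by fun_prop).of_enc_eq fun x => ?_
  rw [← rep_reduced, enc_rep]
  rfl

end

theorem length_keptEdges_le (I : HypergraphInst d) (k : ℕ) :
    (I.keptEdges k).length ≤ (k + 1) ^ d :=
  (reduceEdges_spec fun _ => length_le_of_mem_edgeLists).2.1.length_le

theorem length_kept_le (I : HypergraphInst d) (k m : ℕ) :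
    (I.kept k m).length ≤ d * (k + 1) ^ d + m :=
  (length_edgeVertices_le fun _ he => length_le_of_mem_edgeLists (mem_of_mem_keptEdges he)).trans
    (Nat.add_le_add_right (Nat.mul_le_mul_left _ (I.length_keptEdges_le k)) m)

theorem mem_kept_of_mem {I : HypergraphInst d} {k m v : ℕ} {e : List ℕ} (he : e ∈ I.keptEdges k)
    (hv : v ∈ e) : v ∈ I.kept k m :=
  mem_edgeVertices_of_mem he hv (lt_of_mem_edgeLists (mem_of_mem_keptEdges he) hv)

theorem size_le (I : HypergraphInst d) :
    I.enc.size ≤ I.n * 2 + (I.edges.length * (I.n * 4 + 2) + 1) + 2 := by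
  rw [← enc_rep]
  have h1 : esize I.unary ≤ I.n * 2 + 1 := by
    have := esize_list_le (l := I.unary) (B := 1) fun _ _ => le_rfl
    simpa [unary, rows] using this
  have h2 : esize I.rows ≤ I.edges.length * (I.n * 4 + 1 + 1) + 1 := by
    have := esize_list_le (l := I.rows) (B := I.n * 4 + 1) fun b hb => by
      obtain ⟨e, -, rfl⟩ := List.mem_map.1 hb
      have := esize_list_le (l := List.ofFn fun v => decide (v ∈ e)) (B := 3)
        fun b _ => esize_bool_le b
      simpa using this
    simpa [unary, rows] using this
  have h3 : esize (I.unary, I.rows) = esize I.unary + esize I.rows + 1 := rfl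
  have h4 : I.n * 4 + 1 + 1 = I.n * 4 + 2 := rfl
  rw [h4] at h2
  simp only [esize] at h1 h2 h3 ⊢
  omega

/-- Dropped vertices lie on no kept edge, and enlarging a hitting set is harmless. Hence any unused
kept vertex may stand in for a dropped one. -/
theorem isYes_reduced_iff (I : HypergraphInst d) {k r t : ℕ} (hk : k ≠ 0) (hr : r ≠ 0) :
    (⟨I.reduced k r, k, r, t⟩ : DiverseInst (hittingSet d)).IsYes ↔
      (⟨I, k, r, t⟩ : DiverseInst (hittingSet d)).IsYes := by
  have hnd : (I.kept k (k * r)).Nodup := nodup_keepVertices List.nodup_range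
  refine isYes_iff_of_hits (Q := hittingSet d) (n := I.n) (W := I.kept k (k * r))
    (L := I.keptEdges k) (φ := fun v : Fin I.n => (v : ℕ))
    (ψ := fun i : Fin (I.kept k (k * r)).length => (I.kept k (k * r))[i]) hk hr
    Fin.val_injective (fun v => ⟨?_, fun h => ⟨⟨v, h⟩, rfl⟩⟩) (getElem_injective hnd)
    (fun v => ⟨?_, fun h => ?_⟩) (fun F hF => exists_notMem_fin hF)
    (fun e he v hv => mem_kept_of_mem he hv)
    (fun v hv => List.mem_range.1 (mem_of_mem_keepVertices hv))
    (fun v hv hvW => le_length_keepVertices (List.mem_range.2 hv) hvW)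
    (fun S hS => isSolution_iff_kept hS) (fun S _ => ?_)
  · rintro ⟨a, rfl⟩; exact a.2
  · rintro ⟨i, rfl⟩; exact List.getElem_mem _
  · obtain ⟨i, hi, h⟩ := List.getElem_of_mem h
    exact ⟨⟨i, hi⟩, h⟩
  · change (∀ e ∈ (I.keptEdges k).map _, ∃ v ∈ e, v ∈ S) ↔ _
    constructor
    · intro h e he
      obtain ⟨i, hi, hiS⟩ := h _ (List.mem_map.2 ⟨e, he, rfl⟩)
      exact ⟨_, (Finset.mem_filter.1 hi).2, i, hiS, rfl⟩
    · intro h e' he'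
      obtain ⟨e, he, rfl⟩ := List.mem_map.1 he'
      obtain ⟨v, hv, i, hiS, rfl⟩ := h e he
      exact ⟨i, Finset.mem_filter.2
        ⟨Finset.mem_univ (α := Fin (I.kept k (k * r)).length) i, hv⟩, hiS⟩

end HypergraphInst

theorem succ_pow_le {k : ℕ} (hk : k ≠ 0) (d : ℕ) : (k + 1) ^ d ≤ 2 ^ d * k ^ d := by
  rw [← mul_pow]
  exact Nat.pow_le_pow_left (by omega) d

open HypergraphInst in
theorem hasDiverseKernel_hittingSet (d : ℕ) :
    HasDiverseKernel (hittingSet d) (fun k r => k ^ d + k * r) := by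
  refine HasDiverseKernel.of_reduction (Q := hittingSet d) ⟨0, [], by simp⟩ rfl
    -- Sparsity bounds the kept edges unconditionally, so only `k = 0` needs a test: there the empty
    -- set is the only candidate.
    (fun I k _ => !decide (k = 0) || (keptEdges I k).isEmpty) (fun I k r => reduced I k r)
    ?_ pt_reduced ?_ ?_ (fun I k r t hk hr _ => isYes_reduced_iff I hk hr) ?_ ?_
  · exact show PT (fun x : HypergraphInst d × ℕ × ℕ =>
      !decide (x.2.1 = 0) || (keptEdges x.1 x.2.1).isEmpty) by fun_prop
  · intro I k r _ h S hS
    simp only [Bool.or_eq_false_iff, Bool.not_eq_false', decide_eq_true_eq] at h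
    obtain ⟨rfl, h⟩ := h
    rw [Finset.card_pos, Finset.nonempty_iff_ne_empty]
    rintro rfl
    replace hS := (isSolution_iff_kept (I := I) (k := 0) (S := ∅) (by simp)).1 hS
    refine absurd h ?_
    cases hL : keptEdges I 0 with
    | nil => simp
    | cons e L => simpa using hS e (by simp [hL])
  · intro I r h
    simp only [decide_true, Bool.not_true, Bool.false_or, List.isEmpty_iff] at h
    refine (isSolution_iff_kept (I := I) (k := 0) (S := ∅) (by simp)).2 ?_
    rw [h]
    simp
  · let s : Polynomial ℕ := Polynomial.C d * (Polynomial.X + 1) ^ d + Polynomial.X * Polynomial.X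
    refine ⟨s * 2 + ((Polynomial.X + 1) ^ d * (s * 4 + 2) + 1) + 2, fun I k r _ _ _ => ?_⟩
    have hn : (reduced I k r).n ≤ s.eval (k + r) := by
      refine (length_kept_le I k (k * r)).trans ?_
      simp only [s, Polynomial.eval_add, Polynomial.eval_mul, Polynomial.eval_C,
        Polynomial.eval_pow, Polynomial.eval_X, Polynomial.eval_one]
      gcongr <;> omega
    have he : (reduced I k r).edges.length ≤ (k + r + 1) ^ d := by
      refine (le_of_eq ?_).trans ((length_keptEdges_le I k).trans
        (Nat.pow_le_pow_left (by omega) d))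
      exact List.length_map ..
    refine (size_le (reduced I k r)).trans ?_
    simp only [Polynomial.eval_add, Polynomial.eval_mul, Polynomial.eval_pow, Polynomial.eval_X,
      Polynomial.eval_one, Polynomial.eval_ofNat]
    gcongr
  -- From `d * (k + 1) ^ d + k * r`, using `k + 1 ≤ 2 * k`.
  · refine ⟨d * 2 ^ d + 1, fun I k r hk _ _ => (length_kept_le I k (k * r)).trans ?_⟩
    have := succ_pow_le hk d
    have := Nat.mul_le_mul_left d this
    have : 0 ≤ d * 2 ^ d * (k * r) := Nat.zero_le _
    nlinarith [Nat.zero_le (k ^ d)]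

open Enc

/-! ### Boolean matrices -/

/-- The entry of a matrix given by its rows. -/
def entry (M : List (List Bool)) (u v : ℕ) : Bool := (M.getD u []).getD v false

/-- The matrix with rows and columns indexed by `W`. -/
def matrixOf (W : List ℕ) (p : ℕ → ℕ → Bool) : List (List Bool) := W.map fun u => W.map (p u)

section
variable {γ : Type} [Enc γ]

@[fun_prop]
theorem PT.matrix_entry {M : γ → List (List Bool)} {u v : γ → ℕ} (hM : PT M) (hu : PT u)
    (hv : PT v) : PT (fun c => entry (M c) (u c) (v c)) := by
  unfold entry; fun_prop

@[fun_prop]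
theorem PT.matrix_of {W : γ → List ℕ} {p : γ → ℕ → ℕ → Bool} (hW : PT W)
    (hp : PT (fun x : γ × ℕ × ℕ => p x.1 x.2.1 x.2.2)) : PT (fun c => matrixOf (W c) (p c)) := by
  unfold matrixOf
  have := PT.comp hp (f := fun x : (γ × ℕ) × ℕ => (x.1.1, x.1.2, x.2)) (by fun_prop)
  fun_prop

end

/-- The rows of a matrix. -/
def matrixRows {n : ℕ} (M : Fin n → Fin n → Bool) : List (List Bool) :=
  List.ofFn fun i => List.ofFn (M i)

theorem enc_matrixRows {n : ℕ} (M : Fin n → Fin n → Bool) :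
    Enc.enc (matrixRows M) = encMatrix M := rfl

theorem length_matrixRows {n : ℕ} (M : Fin n → Fin n → Bool) : (matrixRows M).length = n := by
  simp [matrixRows]

theorem entry_matrixRows {n : ℕ} {M : Fin n → Fin n → Bool} {u v : ℕ} :
    entry (matrixRows M) u v = true ↔
      ∃ (hu : u < n) (hv : v < n), M ⟨u, hu⟩ ⟨v, hv⟩ = true := by
  unfold entry matrixRows
  by_cases hu : u < n
  · by_cases hv : v < n <;> simp [hu, hv]
  · simp [hu]

theorem matrixRows_getElem (W : List ℕ) (p : ℕ → ℕ → Bool) :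
    matrixRows (fun i j : Fin W.length => p W[i] W[j]) = matrixOf W p := by
  unfold matrixRows matrixOf
  rw [← ofFn_getElem_eq_map]
  exact congrArg List.ofFn (funext fun i => ofFn_getElem_eq_map W _)

theorem encMatrix_size_le {n : ℕ} (M : Fin n → Fin n → Bool) :
    (encMatrix M).size ≤ n * (n * 4 + 2) + 1 := by
  rw [← enc_matrixRows]
  have := esize_list_le (l := matrixRows M) (B := n * 4 + 1) fun b hb => by
    obtain ⟨i, rfl⟩ := (List.mem_ofFn' _ _).1 hb
    have := esize_list_le (l := List.ofFn (M i)) (B := 3) fun b _ => esize_bool_le b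
    simpa using this
  rwa [length_matrixRows] at this

/-! ### Vertex Cover -/

namespace GraphInst

open Classical in
/-- The rows of the adjacency matrix. -/
noncomputable def rows (I : GraphInst) : List (List Bool) :=
  matrixRows fun u v => decide (I.G.Adj u v)

theorem entry_rows {I : GraphInst} {u v : ℕ} :
    entry I.rows u v = true ↔ ∃ (hu : u < I.n) (hv : v < I.n), I.G.Adj ⟨u, hu⟩ ⟨v, hv⟩ := by
  simp [rows, entry_matrixRows]

/-- The edges, in both orientations, as lists of vertices. -/
noncomputable def edgeLists (I : GraphInst) : List (List ℕ) :=
  (List.range I.rows.length).flatMap fun u =>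
    ((List.range I.rows.length).filter fun v => entry I.rows u v).map fun v => [u, v]

theorem mem_edgeLists {I : GraphInst} {e : List ℕ} :
    e ∈ I.edgeLists ↔ ∃ u v, entry I.rows u v = true ∧ e = [u, v] := by
  simp only [edgeLists, List.mem_flatMap, List.mem_map, List.mem_filter, List.mem_range]
  constructor
  · rintro ⟨u, -, v, ⟨-, h⟩, rfl⟩; exact ⟨u, v, h, rfl⟩
  · rintro ⟨u, v, h, rfl⟩
    obtain ⟨hu, hv, -⟩ := entry_rows.1 h
    have : I.rows.length = I.n := length_matrixRows _
    exact ⟨u, by omega, v, ⟨by omega, h⟩, rfl⟩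

theorem length_le_of_mem_edgeLists {I : GraphInst} {e : List ℕ} (h : e ∈ I.edgeLists) :
    e.length ≤ 2 := by
  obtain ⟨u, v, -, rfl⟩ := mem_edgeLists.1 h
  simp

theorem lt_of_mem_edgeLists {I : GraphInst} {e : List ℕ} (h : e ∈ I.edgeLists) {v : ℕ}
    (hv : v ∈ e) : v < I.n := by
  obtain ⟨u, w, huw, rfl⟩ := mem_edgeLists.1 h
  obtain ⟨hu, hw, -⟩ := entry_rows.1 huw
  simp only [List.mem_cons, List.not_mem_nil, or_false] at hv
  rcases hv with rfl | rfl <;> assumption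

theorem isSolution_iff (I : GraphInst) (S : Finset (Fin I.n)) :
    vertexCover.IsSolution I S ↔ ∀ e ∈ I.edgeLists, ∃ v ∈ e, ∃ s ∈ S, (s : ℕ) = v := by
  constructor
  · intro h e he
    obtain ⟨u, v, huv, rfl⟩ := mem_edgeLists.1 he
    obtain ⟨hu, hv, huv⟩ := entry_rows.1 huv
    rcases h _ _ huv with h | h
    · exact ⟨u, by simp, _, h, rfl⟩
    · exact ⟨v, by simp, _, h, rfl⟩
  · intro h u v huv
    obtain ⟨w, hw, s, hs, hsw⟩ := h _ (mem_edgeLists.2 ⟨u, v, entry_rows.2 ⟨u.2, v.2, huv⟩, rfl⟩)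
    simp only [List.mem_cons, List.not_mem_nil, or_false] at hw
    rcases hw with rfl | rfl
    · exact Or.inl (by rwa [← Fin.ext hsw])
    · exact Or.inr (by rwa [← Fin.ext hsw])

/-- The kept edges. -/
noncomputable def keptEdges (I : GraphInst) (k : ℕ) : List (List ℕ) := reduceEdges 2 k I.edgeLists

/-- The kept vertices. -/
noncomputable def kept (I : GraphInst) (k m : ℕ) : List ℕ :=
  edgeVertices (List.range I.rows.length) (I.keptEdges k) m

theorem kept_eq (I : GraphInst) (k m : ℕ) :
    I.kept k m = edgeVertices (List.range I.n) (I.keptEdges k) m := by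
  rw [kept, rows, length_matrixRows]

theorem mem_of_mem_keptEdges {I : GraphInst} {k : ℕ} {e : List ℕ} (h : e ∈ I.keptEdges k) :
    e ∈ I.edgeLists :=
  (reduceEdges_spec fun _ => length_le_of_mem_edgeLists).1 e h

theorem isSolution_iff_kept {I : GraphInst} {k : ℕ} {S : Finset (Fin I.n)} (hS : S.card ≤ k) :
    vertexCover.IsSolution I S ↔ ∀ e ∈ I.keptEdges k, ∃ v ∈ e, ∃ s ∈ S, (s : ℕ) = v := by
  rw [isSolution_iff]
  refine ⟨fun h e he => h e (mem_of_mem_keptEdges he), fun h => ?_⟩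
  have := (reduceEdges_spec (k := k) fun _ => length_le_of_mem_edgeLists (I := I)).2.2
    (S.map Fin.valEmbedding) (by simpa using hS)
  simp only [Hits, Finset.mem_map, Fin.valEmbedding_apply] at this
  exact this h

/-- Adjacency along kept edges. -/
noncomputable def keptAdj (I : GraphInst) (k u v : ℕ) : Bool :=
  !decide (u = v) && (I.keptEdges k).any fun e => decide (u ∈ e) && decide (v ∈ e)

theorem keptAdj_iff {I : GraphInst} {k u v : ℕ} :
    I.keptAdj k u v = true ↔ u ≠ v ∧ ∃ e ∈ I.keptEdges k, u ∈ e ∧ v ∈ e := by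
  simp [keptAdj]

/-- The kernel. -/
noncomputable def reduced (I : GraphInst) (k r : ℕ) : GraphInst where
  n := (I.kept k (k * r)).length
  G :=
    { Adj := fun i j => I.keptAdj k (I.kept k (k * r))[i] (I.kept k (k * r))[j] = true
      symm := ⟨fun i j h => by
        obtain ⟨h, e, he, hu, hv⟩ := keptAdj_iff.1 h
        exact keptAdj_iff.2 ⟨h.symm, e, he, hv, hu⟩⟩
      loopless := ⟨fun i h => (keptAdj_iff.1 h).1 rfl⟩ }

theorem rows_reduced (I : GraphInst) (k r : ℕ) :
    (I.reduced k r).rows = matrixOf (I.kept k (k * r)) (I.keptAdj k) := by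
  rw [← matrixRows_getElem]
  refine congrArg matrixRows (funext₂ fun i j => Bool.eq_iff_iff.2 ?_)
  exact @decide_eq_true_iff _ (Classical.propDecidable _)

noncomputable instance : Enc GraphInst := ⟨GraphInst.enc⟩

section
variable {γ : Type} [Enc γ]

@[fun_prop]
theorem pt_rows {f : γ → GraphInst} (hf : PT f) : PT (fun c => (f c).rows) :=
  hf.of_enc_eq fun _ => rfl

@[fun_prop]
theorem pt_keptEdges {f : γ → GraphInst} {k : γ → ℕ} (hf : PT f) (hk : PT k) :
    PT (fun c => (f c).keptEdges (k c)) := by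
  unfold keptEdges edgeLists; fun_prop

@[fun_prop]
theorem pt_kept {f : γ → GraphInst} {k m : γ → ℕ} (hf : PT f) (hk : PT k) (hm : PT m) :
    PT (fun c => (f c).kept (k c) (m c)) := by
  unfold kept; fun_prop

@[fun_prop]
theorem pt_keptAdj {f : γ → GraphInst} {k u v : γ → ℕ} (hf : PT f) (hk : PT k) (hu : PT u)
    (hv : PT v) : PT (fun c => (f c).keptAdj (k c) (u c) (v c)) := by
  unfold keptAdj; fun_prop

theorem pt_reduced : PT (fun x : GraphInst × ℕ × ℕ => x.1.reduced x.2.1 x.2.2) := by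
  refine (show PT (fun x : GraphInst × ℕ × ℕ =>
    matrixOf (x.1.kept x.2.1 (x.2.1 * x.2.2)) (x.1.keptAdj x.2.1)) by fun_prop).of_enc_eq
      fun x => ?_
  rw [← rows_reduced]
  rfl

end

theorem length_kept_le (I : GraphInst) (k m : ℕ) :
    (I.kept k m).length ≤ 2 * (k + 1) ^ 2 + m := by
  rw [kept_eq]
  exact (length_edgeVertices_le fun _ he =>
    length_le_of_mem_edgeLists (mem_of_mem_keptEdges he)).trans
    (Nat.add_le_add_right (Nat.mul_le_mul_left _
      (reduceEdges_spec fun _ => length_le_of_mem_edgeLists).2.1.length_le) m)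

/-- The hitting set argument with `d = 2`. What is new is that the covers of the reduced graph are
the sets hitting the kept edges. -/
theorem isYes_reduced_iff (I : GraphInst) {k r t : ℕ} (hk : k ≠ 0) (hr : r ≠ 0) :
    (⟨I.reduced k r, k, r, t⟩ : DiverseInst vertexCover).IsYes ↔
      (⟨I, k, r, t⟩ : DiverseInst vertexCover).IsYes := by
  have hW := kept_eq I k (k * r)
  have hnd : (I.kept k (k * r)).Nodup := hW ▸ nodup_keepVertices List.nodup_range
  refine isYes_iff_of_hits (Q := vertexCover) (n := I.n) (W := I.kept k (k * r))
    (L := I.keptEdges k) (φ := fun v : Fin I.n => (v : ℕ))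
    (ψ := fun i : Fin (I.kept k (k * r)).length => (I.kept k (k * r))[i]) hk hr
    Fin.val_injective (fun v => ⟨?_, fun h => ⟨⟨v, h⟩, rfl⟩⟩) (getElem_injective hnd)
    (fun v => ⟨?_, fun h => ?_⟩) (fun F hF => exists_notMem_fin hF)
    (fun e he v hv => hW ▸ mem_edgeVertices_of_mem he hv
      (lt_of_mem_edgeLists (mem_of_mem_keptEdges he) hv))
    (fun v hv => List.mem_range.1 (mem_of_mem_keepVertices (hW ▸ hv)))
    (fun v hv hvW => ?_) (fun S hS => isSolution_iff_kept hS) (fun S _ => ?_)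
  · rintro ⟨a, rfl⟩; exact a.2
  · rintro ⟨i, rfl⟩; exact List.getElem_mem _
  · obtain ⟨i, hi, h⟩ := List.getElem_of_mem h
    exact ⟨⟨i, hi⟩, h⟩
  · rw [hW] at hvW ⊢
    exact le_length_keepVertices (List.mem_range.2 hv) hvW
  · constructor
    · intro h e he
      obtain ⟨u, v, huv, rfl⟩ := mem_edgeLists.1 (mem_of_mem_keptEdges he)
      have hmem : ∀ w ∈ [u, v], w ∈ I.kept k (k * r) := fun w hw =>
        hW ▸ mem_edgeVertices_of_mem he hw (lt_of_mem_edgeLists (mem_of_mem_keptEdges he) hw)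
      obtain ⟨i, hi, hiu⟩ := List.getElem_of_mem (hmem u (by simp))
      obtain ⟨j, hj, hjv⟩ := List.getElem_of_mem (hmem v (by simp))
      obtain ⟨hu, hv, huv⟩ := entry_rows.1 huv
      have hne : u ≠ v := fun h => huv.ne (Fin.ext h)
      subst hiu
      subst hjv
      rcases h ⟨i, hi⟩ ⟨j, hj⟩ (keptAdj_iff.2 ⟨hne, _, he,
        List.mem_cons_self, List.mem_cons_of_mem _ List.mem_cons_self⟩) with h | h
      · exact ⟨_, List.mem_cons_self, _, h, rfl⟩
      · exact ⟨_, List.mem_cons_of_mem _ List.mem_cons_self, _, h, rfl⟩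
    · intro h i j hij
      obtain ⟨hne, e, he, hie, hje⟩ := keptAdj_iff.1 hij
      obtain ⟨w, hw, s, hs, hsw⟩ := h _ he
      obtain ⟨a, b, -, rfl⟩ := mem_edgeLists.1 (mem_of_mem_keptEdges he)
      -- The edge `[a, b]` contains the two distinct vertices at `i` and `j`, so it consists of
      -- them.
      have : w = (I.kept k (k * r))[i] ∨ w = (I.kept k (k * r))[j] := by
        simp only [List.mem_cons, List.not_mem_nil, or_false] at hie hje hw
        omega
      rcases this with h | h
      · exact Or.inl (getElem_injective hnd (hsw.trans h) ▸ hs)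
      · exact Or.inr (getElem_injective hnd (hsw.trans h) ▸ hs)

end GraphInst

open GraphInst in
theorem hasDiverseKernel_vertexCover :
    HasDiverseKernel vertexCover (fun k r => k * (k + r)) := by
  refine HasDiverseKernel.of_reduction (Q := vertexCover) ⟨0, ⊥⟩ rfl
    (fun I k _ => !decide (k = 0) || (keptEdges I k).isEmpty) (fun I k r => reduced I k r)
    ?_ pt_reduced ?_ ?_ (fun I k r t hk hr _ => isYes_reduced_iff I hk hr) ?_ ?_
  · exact show PT (fun x : GraphInst × ℕ × ℕ =>
      !decide (x.2.1 = 0) || (keptEdges x.1 x.2.1).isEmpty) by fun_prop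
  · intro I k r _ h S hS
    simp only [Bool.or_eq_false_iff, Bool.not_eq_false', decide_eq_true_eq] at h
    obtain ⟨rfl, h⟩ := h
    rw [Finset.card_pos, Finset.nonempty_iff_ne_empty]
    rintro rfl
    replace hS := (isSolution_iff_kept (I := I) (k := 0) (S := ∅) (by simp)).1 hS
    refine absurd h ?_
    cases hL : keptEdges I 0 with
    | nil => simp
    | cons e L => simpa using hS e (by simp [hL])
  · intro I r h
    simp only [decide_true, Bool.not_true, Bool.false_or, List.isEmpty_iff] at h
    refine (isSolution_iff_kept (I := I) (k := 0) (S := ∅) (by simp)).2 ?_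
    rw [h]
    simp
  · let s : Polynomial ℕ := 2 * (Polynomial.X + 1) ^ 2 + Polynomial.X * Polynomial.X
    refine ⟨s * (s * 4 + 2) + 1, fun I k r _ _ _ => ?_⟩
    have hn : (reduced I k r).n ≤ s.eval (k + r) := by
      refine (length_kept_le I k (k * r)).trans ?_
      simp only [s, Polynomial.eval_add, Polynomial.eval_mul, Polynomial.eval_ofNat,
        Polynomial.eval_pow, Polynomial.eval_X, Polynomial.eval_one]
      gcongr <;> omega
    refine (encMatrix_size_le _).trans ?_
    simp only [Polynomial.eval_add, Polynomial.eval_mul, Polynomial.eval_one,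
      Polynomial.eval_ofNat]
    gcongr
  · refine ⟨8, fun I k r hk _ _ => (length_kept_le I k (k * r)).trans ?_⟩
    have : 1 ≤ k := by omega
    nlinarith

open Enc

/-! ### Rational points on lines -/

/-- A pair of natural numbers whose difference is `x - y` times the denominators. -/
def scaledDiff (x y : ℚ) : ℕ × ℕ :=
  (x.num.toNat * y.den + (-y.num).toNat * x.den, (-x.num).toNat * y.den + y.num.toNat * x.den)

/-- Multiplying by the denominators clears fractions and splitting numerators by sign avoids
negative numbers, so arithmetic on `ℕ` suffices. -/
theorem scaledDiff_eq (x y : ℚ) :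
    ((scaledDiff x y).1 : ℚ) - (scaledDiff x y).2 = (x - y) * (x.den * y.den) := by
  have h : ∀ z : ℤ, (z.toNat : ℚ) - (-z).toNat = z := fun z => by
    have : (z.toNat : ℤ) - (-z).toNat = z := by omega
    exact_mod_cast this
  have hx : (x.num : ℚ) = x * x.den := (Rat.mul_den_eq_num x).symm
  have hy : (y.num : ℚ) = y * y.den := (Rat.mul_den_eq_num y).symm
  have h1 := h x.num
  have h2 := h y.num
  rw [hx] at h1
  rw [hy] at h2
  simp only [scaledDiff]
  push_cast
  linear_combination (y.den : ℚ) * h1 - (x.den : ℚ) * h2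

/-- Are three points collinear, the first two being distinct? -/
def coll (p q s : ℚ × ℚ) : Bool :=
  decide (((scaledDiff q.1 p.1).1 * (scaledDiff s.2 p.2).1 +
        (scaledDiff q.1 p.1).2 * (scaledDiff s.2 p.2).2) * (q.2.den * s.1.den) +
      ((scaledDiff q.2 p.2).1 * (scaledDiff s.1 p.1).2 +
        (scaledDiff q.2 p.2).2 * (scaledDiff s.1 p.1).1) * (q.1.den * s.2.den) =
    ((scaledDiff q.1 p.1).1 * (scaledDiff s.2 p.2).2 +
        (scaledDiff q.1 p.1).2 * (scaledDiff s.2 p.2).1) * (q.2.den * s.1.den) +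
      ((scaledDiff q.2 p.2).1 * (scaledDiff s.1 p.1).1 +
        (scaledDiff q.2 p.2).2 * (scaledDiff s.1 p.1).2) * (q.1.den * s.2.den))

/-- The collinearity determinant times all six denominators, with the negative terms moved to the
other side. -/
theorem coll_iff (p q s : ℚ × ℚ) :
    coll p q s = true ↔ (q.1 - p.1) * (s.2 - p.2) = (q.2 - p.2) * (s.1 - p.1) := by
  have h1 := scaledDiff_eq q.1 p.1
  have h2 := scaledDiff_eq s.2 p.2
  have h3 := scaledDiff_eq q.2 p.2
  have h4 := scaledDiff_eq s.1 p.1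
  rw [coll, decide_eq_true_eq, ← Nat.cast_inj (R := ℚ)]
  push_cast
  generalize ((scaledDiff q.1 p.1).1 : ℚ) = a at *
  generalize ((scaledDiff q.1 p.1).2 : ℚ) = a' at *
  generalize ((scaledDiff s.2 p.2).1 : ℚ) = b at *
  generalize ((scaledDiff s.2 p.2).2 : ℚ) = b' at *
  generalize ((scaledDiff q.2 p.2).1 : ℚ) = c at *
  generalize ((scaledDiff q.2 p.2).2 : ℚ) = c' at *
  generalize ((scaledDiff s.1 p.1).1 : ℚ) = d at *
  generalize ((scaledDiff s.1 p.1).2 : ℚ) = d' at *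
  have hD : (q.1.den * q.2.den * s.1.den * s.2.den * p.1.den * p.2.den : ℚ) ≠ 0 := by positivity
  have key : (a - a') * (b - b') * (q.2.den * s.1.den) - (c - c') * (d - d') * (q.1.den * s.2.den)
      = ((q.1 - p.1) * (s.2 - p.2) - (q.2 - p.2) * (s.1 - p.1)) *
        (q.1.den * q.2.den * s.1.den * s.2.den * p.1.den * p.2.den) := by
    rw [h1, h2, h3, h4]; ring
  constructor
  · intro h
    have h0 : ((q.1 - p.1) * (s.2 - p.2) - (q.2 - p.2) * (s.1 - p.1)) *
        (q.1.den * q.2.den * s.1.den * s.2.den * p.1.den * p.2.den) = 0 := by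
      rw [← key]; linear_combination h
    exact sub_eq_zero.1 ((mul_eq_zero.1 h0).resolve_right hD)
  · intro h
    rw [sub_eq_zero.2 h, zero_mul] at key
    linear_combination key

/-- Keep only points that do not lie on a line through `N` points kept before. -/
def keepPoints (N : ℕ) (P : List (ℚ × ℚ)) : List (ℚ × ℚ) :=
  P.foldl (fun L p => bif L.any fun q => decide (q = p) || decide (N ≤ (L.filter (coll p q)).length)
    then L else p :: L) []

section
variable {γ : Type} [Enc γ]

@[fun_prop]
theorem PT.collinear {p q s : γ → ℚ × ℚ} (hp : PT p) (hq : PT q) (hs : PT s) :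
    PT (fun c => coll (p c) (q c) (s c)) := by
  unfold coll; fun_prop

@[fun_prop]
theorem PT.keep_points {N : γ → ℕ} {P : γ → List (ℚ × ℚ)} (hN : PT N) (hP : PT P) :
    PT (fun c => keepPoints (N c) (P c)) := by
  unfold keepPoints
  refine PT.foldl_of_add (s := fun _ => [])
    (step := fun c L p => bif L.any fun q =>
      decide (q = p) || decide (N c ≤ (L.filter (coll p q)).length) then L else p :: L)
    hP (by fun_prop) (by fun_prop) ?_
  obtain ⟨B, hB⟩ := hP.exists_bound
  refine ⟨B, fun c L p hp => ?_⟩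
  have h1 := hB c
  have h2 := esize_lt_of_mem hp
  cases L.any fun q => decide (q = p) || decide (N c ≤ (L.filter (coll p q)).length) <;> simp
  omega

end

theorem ratPoint_injective : Function.Injective ratPoint := by
  intro p q h
  have h0 : (ratPoint p) 0 = (ratPoint q) 0 := by rw [h]
  have h1 : (ratPoint p) 1 = (ratPoint q) 1 := by rw [h]
  simp only [ratPoint, PiLp.toLp_apply, Matrix.cons_val_zero, Matrix.cons_val_one] at h0 h1
  exact Prod.ext (by exact_mod_cast h0) (by exact_mod_cast h1)

/-- `l` is a line of the plane. -/
def IsLine (l : AffineSubspace ℝ Plane) : Prop := Module.finrank ℝ l.direction = 1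

theorem isLine_line {a b : Plane} (h : a ≠ b) : IsLine line[ℝ, a, b] := by
  rw [IsLine, direction_affineSpan, vectorSpan_pair_rev]
  exact finrank_span_singleton (by simpa [vsub_eq_sub, sub_eq_zero] using h.symm)

theorem IsLine.eq_line {l : AffineSubspace ℝ Plane} (hl : IsLine l) {a b : Plane} (ha : a ∈ l)
    (hb : b ∈ l) (h : a ≠ b) : l = line[ℝ, a, b] := by
  have hle : line[ℝ, a, b] ≤ l := affineSpan_pair_le_of_mem_of_mem ha hb
  refine (AffineSubspace.ext_of_direction_eq ?_ ⟨a, left_mem_affineSpan_pair ℝ a b, ha⟩).symm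
  refine Submodule.eq_of_le_of_finrank_eq (AffineSubspace.direction_le hle) ?_
  rw [isLine_line h, hl]

theorem IsLine.eq_of_mem {l l' : AffineSubspace ℝ Plane} (hl : IsLine l) (hl' : IsLine l')
    {p q : ℚ × ℚ} (h : p ≠ q) (hp : ratPoint p ∈ l) (hq : ratPoint q ∈ l) (hp' : ratPoint p ∈ l')
    (hq' : ratPoint q ∈ l') : l = l' := by
  have h' := ratPoint_injective.ne h
  rw [hl.eq_line hp hq h', hl'.eq_line hp' hq' h']

theorem ratPoint_mem_line_iff {p q s : ℚ × ℚ} (h : p ≠ q) :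
    ratPoint s ∈ line[ℝ, ratPoint p, ratPoint q] ↔ coll p q s = true := by
  rw [mem_affineSpan_pair_iff_exists_lineMap_eq, coll_iff]
  have hcoord : ∀ t : ℝ, AffineMap.lineMap (ratPoint p) (ratPoint q) t = ratPoint s ↔
      t * (q.1 - p.1) + p.1 = s.1 ∧ t * (q.2 - p.2) + p.2 = s.2 := by
    intro t
    rw [AffineMap.lineMap_apply, PiLp.ext_iff, Fin.forall_fin_two]
    simp [ratPoint]
  simp only [hcoord]
  have hcast : (q.1 - p.1) * (s.2 - p.2) = (q.2 - p.2) * (s.1 - p.1) ↔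
      ((q.1 : ℝ) - p.1) * (s.2 - p.2) = (q.2 - p.2) * (s.1 - p.1) := by
    exact_mod_cast Iff.rfl
  rw [hcast]
  constructor
  · rintro ⟨t, h1, h2⟩
    rw [← h1, ← h2]; ring
  · intro h'
    -- The parameter is read off a coordinate in which `p` and `q` differ.
    by_cases h1 : (q.1 : ℝ) - p.1 = 0
    · have h2 : (q.2 : ℝ) - p.2 ≠ 0 := by
        intro h2
        refine h (Prod.ext ?_ ?_)
        · exact_mod_cast (sub_eq_zero.1 h1).symm
        · exact_mod_cast (sub_eq_zero.1 h2).symm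
      refine ⟨(s.2 - p.2) / (q.2 - p.2), ?_, ?_⟩
      · rw [h1, zero_mul, eq_comm, mul_eq_zero] at h'
        rw [h1, mul_zero, zero_add]
        exact (sub_eq_zero.1 (h'.resolve_left h2)).symm
      · rw [div_mul_cancel₀ _ h2]; ring
    · refine ⟨(s.1 - p.1) / (q.1 - p.1), ?_, ?_⟩
      · rw [div_mul_cancel₀ _ h1]; ring
      · rw [div_mul_eq_mul_div, mul_comm ((s.1 : ℝ) - p.1), ← h', mul_div_cancel_left₀ _ h1]; ring

/-! ### The kept points -/

open Classical in
/-- The points of `L` on a line. -/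
noncomputable def onLine (l : AffineSubspace ℝ Plane) (L : List (ℚ × ℚ)) : Finset (ℚ × ℚ) :=
  L.toFinset.filter fun p => ratPoint p ∈ l

theorem mem_onLine {l : AffineSubspace ℝ Plane} {L : List (ℚ × ℚ)} {p : ℚ × ℚ} :
    p ∈ onLine l L ↔ p ∈ L ∧ ratPoint p ∈ l := by
  simp [onLine]

theorem card_onLine_line {L : List (ℚ × ℚ)} (hL : L.Nodup) {p q : ℚ × ℚ} (h : p ≠ q) :
    (onLine line[ℝ, ratPoint p, ratPoint q] L).card = (L.filter (coll p q)).length := by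
  rw [← List.toFinset_card_of_nodup (hL.filter _)]
  congr 1
  ext s
  rw [mem_onLine, ratPoint_mem_line_iff h, List.mem_toFinset, List.mem_filter]

theorem onLine_subset_cons (l : AffineSubspace ℝ Plane) (p : ℚ × ℚ) (L : List (ℚ × ℚ)) :
    onLine l L ⊆ onLine l (p :: L) := fun q hq => by
  rw [mem_onLine] at hq ⊢
  exact ⟨List.mem_cons_of_mem _ hq.1, hq.2⟩

/-- A point is added only if each line joining it to a kept point has fewer than `N` kept points, so
no line exceeds `N`. The line that caused a rejection has `N` kept points and retains them as the
list grows. -/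
theorem keepPoints_spec {N : ℕ} (hN : 0 < N) (P : List (ℚ × ℚ)) :
    (∀ p ∈ keepPoints N P, p ∈ P) ∧ (keepPoints N P).Nodup ∧
      (∀ l, IsLine l → (onLine l (keepPoints N P)).card ≤ N) ∧
      ∀ p ∈ P, p ∉ keepPoints N P →
        ∃ l, IsLine l ∧ ratPoint p ∈ l ∧ N ≤ (onLine l (keepPoints N P)).card := by
  unfold keepPoints
  induction P using List.reverseRecOn with
  | nil => exact ⟨by simp, List.nodup_nil, fun l _ => by simp [onLine], by simp⟩
  | append_singleton P p ih =>
    rw [List.foldl_append, List.foldl_cons, List.foldl_nil]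
    generalize P.foldl (fun L p => bif L.any fun q =>
      decide (q = p) || decide (N ≤ (L.filter (coll p q)).length) then L else p :: L) [] = L at *
    obtain ⟨h1, h2, h3, h4⟩ := ih
    cases h : L.any fun q => decide (q = p) || decide (N ≤ (L.filter (coll p q)).length) with
    | true =>
      refine ⟨fun q hq => List.mem_append_left _ (h1 q hq), h2, h3, fun q hq hqL => ?_⟩
      rcases List.mem_append.1 hq with hq | hq
      · exact h4 q hq hqL
      · obtain rfl := List.mem_singleton.1 hq
        obtain ⟨s, hs, h⟩ := List.any_eq_true.1 h
        have hne : q ≠ s := fun h => hqL (h ▸ hs)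
        simp only [hne.symm, decide_false, Bool.false_or, decide_eq_true_eq] at h
        exact ⟨_, isLine_line (ratPoint_injective.ne hne), left_mem_affineSpan_pair ℝ _ _,
          (card_onLine_line h2 hne).symm ▸ h⟩
    | false =>
      have h5 : ∀ q ∈ L, q ≠ p ∧ (L.filter (coll p q)).length < N := by
        intro q hq
        have := List.any_eq_false.1 h q hq
        simpa using this
      have hpL : p ∉ L := fun hp => (h5 p hp).1 rfl
      refine ⟨fun q hq => ?_, List.nodup_cons.2 ⟨hpL, h2⟩, fun l hl => ?_, fun q hq hqL => ?_⟩
      · rcases List.mem_cons.1 hq with rfl | hq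
        · simp
        · simp [h1 q hq]
      · have hsub : onLine l (p :: L) ⊆ insert p (onLine l L) := fun q hq => by
          rw [mem_onLine, List.mem_cons] at hq
          rw [Finset.mem_insert, mem_onLine]
          tauto
        by_cases hp : ratPoint p ∈ l
        · rcases (onLine l L).eq_empty_or_nonempty with he | ⟨q, hq⟩
          · rw [he] at hsub
            exact (Finset.card_le_card hsub).trans hN
          · rw [mem_onLine] at hq
            have h6 := h5 q hq.1
            have h7 := card_onLine_line h2 h6.1.symm
            rw [← hl.eq_line hp hq.2 (ratPoint_injective.ne h6.1.symm)] at h7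
            refine ((Finset.card_le_card hsub).trans (Finset.card_insert_le _ _)).trans ?_
            omega
        · refine (Finset.card_le_card fun q hq => ?_).trans (h3 l hl)
          refine (Finset.mem_insert.1 (hsub hq)).resolve_left ?_
          rintro rfl
          exact hp (mem_onLine.1 hq).2
      · rcases List.mem_append.1 hq with hq | hq
        · obtain ⟨l, hl, hql, hc⟩ := h4 q hq fun h => hqL (List.mem_cons_of_mem _ h)
          exact ⟨l, hl, hql, hc.trans (Finset.card_le_card (onLine_subset_cons l p L))⟩
        · obtain rfl := List.mem_singleton.1 hq
          exact absurd List.mem_cons_self hqL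

/-- Pigeonhole: a dropped point lies on a line with `N > k` kept points. Two of them share a line of
`S`, which must be that line. -/
theorem IsLineCover.of_keepPoints {N k : ℕ} (hN : k < N) {P : List (ℚ × ℚ)}
    {S : Finset (AffineSubspace ℝ Plane)} (hS : S.card ≤ k)
    (h : IsLineCover (keepPoints N P) S) : IsLineCover P S := by
  classical
  refine ⟨h.1, fun p hp => ?_⟩
  obtain ⟨-, -, -, h4⟩ := keepPoints_spec (N := N) (by omega) P
  by_cases hpL : p ∈ keepPoints N P
  · exact h.2 p hpL
  · obtain ⟨l, hl, hpl, hc⟩ := h4 p hp hpL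
    have : ∀ q ∈ onLine l (keepPoints N P), ∃ l' ∈ S, ratPoint q ∈ l' := fun q hq =>
      h.2 q (mem_onLine.1 hq).1
    choose! f hf using this
    obtain ⟨a, ha, b, hb, hab, hfab⟩ := Finset.exists_ne_map_eq_of_card_lt_of_maps_to
      (show S.card < (onLine l (keepPoints N P)).card by omega) (f := f)
      (fun q hq => (hf q hq).1)
    have hlf : l = f a := hl.eq_of_mem (h.1 _ (hf a ha).1) hab (mem_onLine.1 ha).2
      (mem_onLine.1 hb).2 (hf a ha).2 (hfab ▸ (hf b hb).2)
    exact ⟨l, hlf ▸ (hf a ha).1, hpl⟩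

theorem IsLineCover.mono {P P' : List (ℚ × ℚ)} (h : ∀ p ∈ P', p ∈ P)
    {S : Finset (AffineSubspace ℝ Plane)} (hS : IsLineCover P S) : IsLineCover P' S :=
  ⟨hS.1, fun p hp => hS.2 p (h p hp)⟩

/-- Each line of `S` covers at most `N` kept points. Too many kept points therefore rule out small
covers. -/
theorem IsLineCover.length_keepPoints_le {N : ℕ} (hN : 0 < N) {P : List (ℚ × ℚ)}
    {S : Finset (AffineSubspace ℝ Plane)} (h : IsLineCover P S) :
    (keepPoints N P).length ≤ S.card * N := by
  classical
  obtain ⟨h1, h2, h3, -⟩ := keepPoints_spec hN P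
  rw [← List.toFinset_card_of_nodup h2]
  refine (Finset.card_le_card (t := S.biUnion fun l => onLine l (keepPoints N P)) fun p hp => ?_).trans
    (Finset.card_biUnion_le_card_mul _ _ _ fun l hl => h3 l (h.1 l hl))
  rw [List.mem_toFinset] at hp
  obtain ⟨l, hl, hpl⟩ := h.2 p (h1 p hp)
  exact Finset.mem_biUnion.2 ⟨l, hl, mem_onLine.2 ⟨hp, hpl⟩⟩

theorem isLineCover_empty {N : ℕ} (hN : 0 < N) {P : List (ℚ × ℚ)}
    (h : (keepPoints N P).length ≤ 0) : IsLineCover P ∅ := by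
  refine IsLineCover.of_keepPoints hN (k := 0) (by simp) ⟨by simp, fun p hp => ?_⟩
  have := List.length_pos_of_mem hp
  omega

/-- The items are all lines of the plane, whatever the points, so the same families solve both
instances and no spare points are needed; `N = k + 1` is enough. -/
theorem hasDiverseKernel_pointLineCover :
    HasDiverseKernel pointLineCover (fun k r => k * (k + r)) := by
  refine HasDiverseKernel.of_reduction (Q := pointLineCover) ([] : List (ℚ × ℚ)) rfl
    (fun P k _ => decide ((keepPoints (k + 1) P).length ≤ k * (k + 1)))
    (fun P k _ => keepPoints (k + 1) P) ?_ ?_ ?_ ?_ ?_ ?_ ?_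
  · exact show PT (fun x : List (ℚ × ℚ) × ℕ × ℕ =>
      decide ((keepPoints (x.2.1 + 1) x.1).length ≤ x.2.1 * (x.2.1 + 1))) by fun_prop
  · exact show PT (fun x : List (ℚ × ℚ) × ℕ × ℕ => keepPoints (x.2.1 + 1) x.1) by fun_prop
  · intro P k r _ h S hS
    by_contra! hSk
    have h1 := IsLineCover.length_keepPoints_le (N := k + 1) (by omega) hS
    have h2 := Nat.mul_le_mul_right (k + 1) hSk
    exact decide_eq_false_iff_not.1 h (h1.trans h2)
  · intro P r h
    have h' : (keepPoints 1 P).length ≤ 0 := by simpa using of_decide_eq_true h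
    exact isLineCover_empty (by omega) h'
  · intro P k r t _ _ _
    constructor
    · rintro ⟨S, hS, ht⟩
      exact ⟨S, fun i => ⟨IsLineCover.of_keepPoints (Nat.lt_succ_self k) (hS i).2 (hS i).1,
        (hS i).2⟩, ht⟩
    · rintro ⟨S, hS, ht⟩
      exact ⟨S, fun i => ⟨IsLineCover.mono (keepPoints_spec (by omega) P).1 (hS i).1,
        (hS i).2⟩, ht⟩
  · refine ⟨Polynomial.X * (Polynomial.X + 1), fun P k r _ _ h => (of_decide_eq_true h).trans ?_⟩
    simp only [Polynomial.eval_mul, Polynomial.eval_add, Polynomial.eval_X, Polynomial.eval_one]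
    gcongr <;> omega
  · refine ⟨2, fun P k r hk _ h => (of_decide_eq_true h).trans ?_⟩
    have : 1 ≤ k := by omega
    nlinarith

/-! ### Solutions consisting of spanned lines -/

theorem spannedLines_mono {P P' : List (ℚ × ℚ)} (h : ∀ p ∈ P', p ∈ P) :
    spannedLines P' ⊆ spannedLines P := by
  rintro l ⟨p, hp, q, hq, hpq, rfl⟩
  exact ⟨p, h p hp, q, h q hq, hpq, rfl⟩

theorem IsLine.mem_spannedLines {l : AffineSubspace ℝ Plane} (hl : IsLine l) {P : List (ℚ × ℚ)}
    (h : 1 < (onLine l P).card) : l ∈ spannedLines P := by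
  obtain ⟨p, hp, q, hq, hpq⟩ := Finset.one_lt_card.1 h
  rw [mem_onLine] at hp hq
  exact ⟨p, hp.1, q, hq.1, hpq, hl.eq_line hp.2 hq.2 (ratPoint_injective.ne hpq)⟩

theorem isLine_of_mem_spannedLines {P : List (ℚ × ℚ)} {l : AffineSubspace ℝ Plane}
    (h : l ∈ spannedLines P) : IsLine l := by
  obtain ⟨p, -, q, -, hpq, rfl⟩ := h
  exact isLine_line (ratPoint_injective.ne hpq)

/-- A line that is not spanned by the kept points can be replaced by many lines that are. -/
theorem exists_spannedLine {N : ℕ} (hN : 1 < N) {P : List (ℚ × ℚ)} {l : AffineSubspace ℝ Plane}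
    (hl : l ∈ spannedLines P) (hl' : l ∉ spannedLines (keepPoints N P))
    {F : Finset (AffineSubspace ℝ Plane)} (hF : F.card < N) :
    ∃ l' ∈ spannedLines (keepPoints N P), l' ∉ F ∧
      ∀ p ∈ keepPoints N P, ratPoint p ∈ l → ratPoint p ∈ l' := by
  classical
  obtain ⟨-, -, -, h4⟩ := keepPoints_spec (N := N) (by omega) P
  generalize keepPoints N P = L at *
  have hline := isLine_of_mem_spannedLines hl
  -- One of the two points spanning `l` was dropped; it becomes `a`. The line `H` through it with
  -- `N` kept points then differs from `l`.
  obtain ⟨a, b, ha, hb, hab, haL, hal, hbl⟩ : ∃ a b, a ∈ P ∧ b ∈ P ∧ a ≠ b ∧ a ∉ L ∧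
      ratPoint a ∈ l ∧ ratPoint b ∈ l := by
    obtain ⟨p, hp, q, hq, hpq, rfl⟩ := hl
    by_cases hpL : p ∈ L
    · refine ⟨q, p, hq, hp, hpq.symm, fun hqL => hl' ⟨p, hpL, q, hqL, hpq, rfl⟩,
        right_mem_affineSpan_pair ℝ _ _, left_mem_affineSpan_pair ℝ _ _⟩
    · exact ⟨p, q, hp, hq, hpq, hpL, left_mem_affineSpan_pair ℝ _ _,
        right_mem_affineSpan_pair ℝ _ _⟩
  obtain ⟨H, hH, haH, hHc⟩ := h4 a ha haL
  have hHl : H ≠ l := by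
    rintro rfl
    exact hl' (hH.mem_spannedLines (by omega))
  -- All substitutes will pass through `c`. If `l` has a kept point, it is unique, as `l` is not
  -- spanned by kept points, and serves as `c`. Otherwise `b` was dropped too; if all kept points
  -- were on `H`, the rich line through `b` would be `H`, which would then contain `a` and `b` and
  -- equal `l`.
  obtain ⟨c, hcL, hcH, hc⟩ : ∃ c ∈ L, ratPoint c ∉ H ∧ ∀ x ∈ L, ratPoint x ∈ l → x = c := by
    by_cases h : ∃ c ∈ L, ratPoint c ∈ l
    · obtain ⟨c, hcL, hcl⟩ := h
      refine ⟨c, hcL, fun hcH => hHl ?_, fun x hxL hxl => ?_⟩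
      · exact hH.eq_of_mem hline (fun h : a = c => haL (h ▸ hcL)) haH hcH hal hcl
      · by_contra hxc
        exact hl' ⟨x, hxL, c, hcL, hxc, hline.eq_line hxl hcl (ratPoint_injective.ne hxc)⟩
    · push Not at h
      obtain ⟨H', hH', hbH', hHc'⟩ := h4 b hb fun hbL => h b hbL hbl
      by_contra! hno
      obtain ⟨p, hp, q, hq, hpq⟩ := Finset.one_lt_card.1 (lt_of_lt_of_le hN hHc')
      rw [mem_onLine] at hp hq
      have hmem : ∀ x ∈ L, ratPoint x ∈ H := by
        intro x hx
        by_contra hxH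
        obtain ⟨y, hy, hyl, -⟩ := hno x hx hxH
        exact h y hy hyl
      have : H = H' := hH.eq_of_mem hH' hpq (hmem p hp.1) (hmem q hq.1) hp.2 hq.2
      subst this
      exact hHl (hH.eq_of_mem hline hab haH hbH' hal hbl)
  have hcx : ∀ x ∈ onLine H L, c ≠ x := by
    rintro x hx rfl
    exact hcH (mem_onLine.1 hx).2
  -- As `c` is not on `H`, joining it to the kept points of `H` gives at least `N` distinct lines,
  -- more than `F` can exclude.
  have hinj : Set.InjOn (fun x => line[ℝ, ratPoint c, ratPoint x]) (onLine H L) := by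
    intro x hx y hy hxy
    by_contra hne
    have hxl := isLine_line (ratPoint_injective.ne (hcx x hx))
    refine hcH ?_
    rw [hH.eq_of_mem hxl hne (mem_onLine.1 hx).2 (mem_onLine.1 hy).2
      (right_mem_affineSpan_pair ℝ _ _) (by
        dsimp only at hxy; rw [hxy]; exact right_mem_affineSpan_pair ℝ _ _)]
    exact left_mem_affineSpan_pair ℝ _ _
  obtain ⟨l', hl'm, hl'F⟩ := Finset.exists_mem_notMem_of_card_lt_card (s := F)
    (t := (onLine H L).image fun x => line[ℝ, ratPoint c, ratPoint x])
    (by rw [Finset.card_image_of_injOn hinj]; omega)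
  obtain ⟨x, hx, rfl⟩ := Finset.mem_image.1 hl'm
  refine ⟨_, ⟨c, hcL, x, (mem_onLine.1 hx).1, hcx x hx, rfl⟩, hl'F, fun p hp hpl => ?_⟩
  rw [hc p hp hpl]
  exact left_mem_affineSpan_pair ℝ _ _

open Classical in
theorem exists_spanned_injection {N : ℕ} (hN : 1 < N) (P : List (ℚ × ℚ))
    (U : Finset (AffineSubspace ℝ Plane)) (hU : U.card ≤ N) :
    ∃ τ : AffineSubspace ℝ Plane → AffineSubspace ℝ Plane, Set.InjOn τ U ∧
      ∀ S ⊆ U, ((∀ l ∈ S, l ∈ spannedLines P) ∧ IsLineCover P S) →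
        (∀ l ∈ S.image τ, l ∈ spannedLines (keepPoints N P)) ∧
          IsLineCover (keepPoints N P) (S.image τ) := by
  have hsub := (keepPoints_spec (N := N) (by omega) P).1
  -- `keep` is an implication so that only lines losing their spanning points are moved; lines not
  -- spanned by `P` occur in no solution and stay fixed.
  obtain ⟨τ, h1, h2, h3⟩ := exists_injOn_extension (U := U)
    (keep := fun l => l ∈ spannedLines P → l ∈ spannedLines (keepPoints N P)) (f := id)
    (C := fun l => {l' | l' ∈ spannedLines (keepPoints N P) ∧
      ∀ p ∈ keepPoints N P, ratPoint p ∈ l → ratPoint p ∈ l'})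
    Function.injective_id.injOn (fun l _ hl F hF => by
      push Not at hl
      obtain ⟨l', h, hF, hp⟩ := exists_spannedLine hN hl.1 hl.2 (hF.trans_le hU)
      exact ⟨l', ⟨h, hp⟩, hF⟩)
  refine ⟨τ, h1, fun S hSU hS => ?_⟩
  have key : ∀ l ∈ S, τ l ∈ spannedLines (keepPoints N P) ∧
      ∀ p ∈ keepPoints N P, ratPoint p ∈ l → ratPoint p ∈ τ l := by
    intro l hl
    by_cases hk : l ∈ spannedLines P → l ∈ spannedLines (keepPoints N P)
    · rw [h2 l hk]
      exact ⟨hk (hS.1 l hl), fun p _ h => h⟩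
    · exact h3 l (hSU hl) hk
  have himage : ∀ l ∈ S.image τ, l ∈ spannedLines (keepPoints N P) := by
    intro l hl
    obtain ⟨m, hm, rfl⟩ := Finset.mem_image.1 hl
    exact (key m hm).1
  refine ⟨himage, fun l hl => isLine_of_mem_spannedLines (himage l hl), fun p hp => ?_⟩
  obtain ⟨l, hl, hpl⟩ := hS.2.2 p (hsub p hp)
  exact ⟨τ l, Finset.mem_image_of_mem τ hl, (key l hl).2 p hp hpl⟩

theorem isYes_keepPoints_iff {N k r t : ℕ} (hkN : k < N) (hrN : k * r ≤ N) (hN : 1 < N)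
    (P : List (ℚ × ℚ)) :
    (⟨keepPoints N P, k, r, t⟩ : DiverseInst spannedPointLineCover).IsYes ↔
      (⟨P, k, r, t⟩ : DiverseInst spannedPointLineCover).IsYes := by
  have hsub := (keepPoints_spec (N := N) (by omega) P).1
  constructor
  · rintro ⟨S, hS, ht⟩
    exact ⟨S, fun i => ⟨⟨fun l hl => spannedLines_mono hsub ((hS i).1.1 l hl),
      IsLineCover.of_keepPoints hkN (hS i).2 (hS i).1.2⟩, (hS i).2⟩, ht⟩
  · refine DiverseInst.IsYes.transfer (Q := spannedPointLineCover) fun U hU => ?_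
    obtain ⟨τ, h1, h2⟩ := exists_spanned_injection hN P U (hU.trans hrN)
    exact ⟨τ, h1, fun S hSU hS _ => h2 S hSU hS⟩

theorem hasDiverseKernel_spannedPointLineCover :
    HasDiverseKernel spannedPointLineCover (fun k r => k ^ 2 * (k + r)) := by
  refine HasDiverseKernel.of_reduction (Q := spannedPointLineCover) ([] : List (ℚ × ℚ)) rfl
    -- This `N` exceeds `k` and `1` and is at least `k * r`: covers extend to dropped points, and
    -- substitute lines do not run out.
    (fun P k r => decide ((keepPoints (k * r + k + 2) P).length ≤ k * (k * r + k + 2)))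
    (fun P k r => keepPoints (k * r + k + 2) P) ?_ ?_ ?_ ?_ ?_ ?_ ?_
  · exact show PT (fun x : List (ℚ × ℚ) × ℕ × ℕ =>
      decide ((keepPoints (x.2.1 * x.2.2 + x.2.1 + 2) x.1).length ≤
        x.2.1 * (x.2.1 * x.2.2 + x.2.1 + 2))) by fun_prop
  · exact show PT (fun x : List (ℚ × ℚ) × ℕ × ℕ =>
      keepPoints (x.2.1 * x.2.2 + x.2.1 + 2) x.1) by fun_prop
  · intro P k r _ h S hS
    by_contra! hSk
    have h1 := IsLineCover.length_keepPoints_le (N := k * r + k + 2) (by omega) hS.2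
    have h2 := Nat.mul_le_mul_right (k * r + k + 2) hSk
    exact decide_eq_false_iff_not.1 h (h1.trans h2)
  · intro P r h
    have h' : (keepPoints 2 P).length ≤ 0 := by simpa using of_decide_eq_true h
    exact ⟨fun l hl => absurd hl (Finset.notMem_empty l), isLineCover_empty (by omega) h'⟩
  · intro P k r t _ _ _
    exact isYes_keepPoints_iff (by omega) (by omega) (by omega) P
  · refine ⟨Polynomial.X * (Polynomial.X * Polynomial.X + Polynomial.X + 2),
      fun P k r _ _ h => (of_decide_eq_true h).trans ?_⟩
    simp only [Polynomial.eval_mul, Polynomial.eval_add, Polynomial.eval_X, Polynomial.eval_ofNat]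
    gcongr <;> omega
  · refine ⟨3, fun P k r hk _ h => (of_decide_eq_true h).trans ?_⟩
    have h1 : 1 ≤ k := by omega
    have h2 : k * 1 ≤ k * k := Nat.mul_le_mul_left k h1
    have h3 : k * k * 1 ≤ k * k * k := Nat.mul_le_mul_left _ h1
    have h4 : 0 ≤ k * k * r := Nat.zero_le _
    calc k * (k * r + k + 2) = k * k * r + k * k + 2 * k := by ring
      _ ≤ 3 * (k * k * k + k * k * r) := by omega
      _ = 3 * (k ^ 2 * (k + r)) := by ring

open Enc

/-! ### Feedback arc sets in tournaments: the algorithm -/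

/-- The vertices forming a triangle with the arc `(u, v)`. -/
def triWitness (M : List (List Bool)) (u v : ℕ) : List ℕ :=
  (List.range M.length).filter fun w => entry M v w && entry M w u

/-- The arcs in more than `k` triangles. -/
def forcedArc (M : List (List Bool)) (k u v : ℕ) : Bool :=
  entry M u v && decide (k + 1 ≤ (triWitness M u v).length)

/-- The tournament with all forced arcs reversed. -/
def flipped (M : List (List Bool)) (k u v : ℕ) : Bool :=
  (entry M u v && !forcedArc M k u v) || forcedArc M k v u

/-- The vertices in triangles after flipping, on forced arcs, and among the first `k + 1` vertices
forming triangles with forced arcs. -/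
def isCore (M : List (List Bool)) (k x : ℕ) : Bool :=
  (List.range M.length).any fun a => (forcedArc M k x a || forcedArc M k a x) ||
    (List.range M.length).any fun b => (flipped M k x a && flipped M k a b && flipped M k b x) ||
      (forcedArc M k a b && decide (x ∈ (triWitness M a b).take (k + 1)))

/-- The core vertices. -/
def coreVertices (M : List (List Bool)) (k : ℕ) : List ℕ :=
  (List.range M.length).filter fun x => isCore M k x

/-- The core vertices and `m` others. -/
def coreAnd (M : List (List Bool)) (k m : ℕ) : List ℕ :=
  keepVertices (List.range M.length) (fun x => isCore M k x) m

section
variable {γ : Type} [Enc γ]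

@[fun_prop]
theorem PT.tri_witness {M : γ → List (List Bool)} {u v : γ → ℕ} (hM : PT M) (hu : PT u)
    (hv : PT v) : PT (fun c => triWitness (M c) (u c) (v c)) := by
  unfold triWitness; fun_prop

@[fun_prop]
theorem PT.forced_arc {M : γ → List (List Bool)} {k u v : γ → ℕ} (hM : PT M) (hk : PT k)
    (hu : PT u) (hv : PT v) : PT (fun c => forcedArc (M c) (k c) (u c) (v c)) := by
  unfold forcedArc; fun_prop

@[fun_prop]
theorem PT.flipped_arc {M : γ → List (List Bool)} {k u v : γ → ℕ} (hM : PT M) (hk : PT k)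
    (hu : PT u) (hv : PT v) : PT (fun c => flipped (M c) (k c) (u c) (v c)) := by
  unfold flipped; fun_prop

@[fun_prop]
theorem PT.is_core {M : γ → List (List Bool)} {k x : γ → ℕ} (hM : PT M) (hk : PT k)
    (hx : PT x) : PT (fun c => isCore (M c) (k c) (x c)) := by
  unfold isCore; fun_prop

@[fun_prop]
theorem PT.core_vertices {M : γ → List (List Bool)} {k : γ → ℕ} (hM : PT M) (hk : PT k) :
    PT (fun c => coreVertices (M c) (k c)) := by
  unfold coreVertices; fun_prop

@[fun_prop]
theorem PT.core_and {M : γ → List (List Bool)} {k m : γ → ℕ} (hM : PT M) (hk : PT k)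
    (hm : PT m) : PT (fun c => coreAnd (M c) (k c) (m c)) := by
  unfold coreAnd; fun_prop

end

/-! ### Feedback arc sets in tournaments: correctness -/

/-- The matrix is the adjacency matrix of a tournament. -/
structure IsTournament (M : List (List Bool)) : Prop where
  lt : ∀ {u v}, entry M u v = true → u < M.length ∧ v < M.length
  asymm : ∀ {u v}, entry M u v = true → ¬ entry M v u = true
  total : ∀ {u v}, u < M.length → v < M.length → u ≠ v → entry M u v = true ∨ entry M v u = true

/-- The arcs inside `W` that are not in `S`. -/
def Remaining (M : List (List Bool)) (W : ℕ → Prop) (S : Finset (ℕ × ℕ)) (a b : ℕ) : Prop :=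
  W a ∧ W b ∧ entry M a b = true ∧ (a, b) ∉ S

/-- Removing `S` from the subtournament on `W` leaves no directed cycle. -/
def IsFas (M : List (List Bool)) (W : ℕ → Prop) (S : Finset (ℕ × ℕ)) : Prop :=
  ∀ v, ¬ Relation.TransGen (Remaining M W S) v v

theorem mem_triWitness {M : List (List Bool)} (hM : IsTournament M) {u v w : ℕ} :
    w ∈ triWitness M u v ↔ entry M v w = true ∧ entry M w u = true := by
  simp only [triWitness, List.mem_filter, List.mem_range, Bool.and_eq_true, and_iff_right_iff_imp]
  exact fun h => (hM.lt h.2).1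

theorem nodup_triWitness (M : List (List Bool)) (u v : ℕ) : (triWitness M u v).Nodup :=
  List.nodup_range.filter _

theorem forcedArc_iff {M : List (List Bool)} {k u v : ℕ} :
    forcedArc M k u v = true ↔ entry M u v = true ∧ k + 1 ≤ (triWitness M u v).length := by
  simp [forcedArc]

theorem flipped_iff {M : List (List Bool)} {k u v : ℕ} :
    flipped M k u v = true ↔
      (entry M u v = true ∧ ¬ forcedArc M k u v = true) ∨ forcedArc M k v u = true := by
  simp [flipped]

namespace IsTournament
variable {M : List (List Bool)} (hM : IsTournament M) {k : ℕ}
include hM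

theorem flipped_asymm {u v : ℕ} (h : flipped M k u v = true) : ¬ flipped M k v u = true := by
  intro h'
  rw [flipped_iff] at h h'
  have h1 := fun h : forcedArc M k u v = true => (forcedArc_iff.1 h).1
  have h2 := fun h : forcedArc M k v u = true => (forcedArc_iff.1 h).1
  have h3 := hM.asymm (u := u) (v := v)
  tauto

theorem flipped_lt {u v : ℕ} (h : flipped M k u v = true) : u < M.length ∧ v < M.length := by
  rcases flipped_iff.1 h with h | h
  · exact hM.lt h.1
  · exact (hM.lt (forcedArc_iff.1 h).1).symm

theorem flipped_total {u v : ℕ} (hu : u < M.length) (hv : v < M.length) (h : u ≠ v) :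
    flipped M k u v = true ∨ flipped M k v u = true := by
  rw [flipped_iff, flipped_iff]
  rcases hM.total hu hv h with h | h
  · by_cases hf : forcedArc M k u v = true <;> tauto
  · by_cases hf : forcedArc M k v u = true <;> tauto

theorem isCore_iff {x : ℕ} : isCore M k x = true ↔
    (∃ a, forcedArc M k x a = true ∨ forcedArc M k a x = true) ∨
    (∃ a b, flipped M k x a = true ∧ flipped M k a b = true ∧ flipped M k b x = true) ∨
    ∃ a b, forcedArc M k a b = true ∧ x ∈ (triWitness M a b).take (k + 1) := by
  have h1 : ∀ {a b}, forcedArc M k a b = true → a < M.length ∧ b < M.length :=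
    fun h => hM.lt (forcedArc_iff.1 h).1
  simp only [isCore, List.any_eq_true, Bool.or_eq_true, Bool.and_eq_true, List.mem_range,
    decide_eq_true_eq]
  constructor
  · rintro ⟨a, -, h | ⟨b, -, h | h⟩⟩
    · exact Or.inl ⟨a, h⟩
    · exact Or.inr (Or.inl ⟨a, b, h.1.1, h.1.2, h.2⟩)
    · exact Or.inr (Or.inr ⟨a, b, h⟩)
  · rintro (⟨a, h⟩ | ⟨a, b, h⟩ | ⟨a, b, h⟩)
    · exact ⟨a, h.elim (fun h => (h1 h).2) fun h => (h1 h).1, Or.inl h⟩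
    · exact ⟨a, (hM.flipped_lt h.1).2, Or.inr ⟨b, (hM.flipped_lt h.2.1).2,
        Or.inl ⟨⟨h.1, h.2.1⟩, h.2.2⟩⟩⟩
    · exact ⟨a, (h1 h.1).1, Or.inr ⟨b, (h1 h.1).2, Or.inr h⟩⟩

/-- Whatever is reachable from `y` is an out-neighbour of `y`: arcs `y → b → z → y` would form a
triangle. A cycle through `y` would make `y` its own out-neighbour. -/
theorem not_transGen_flipped {y : ℕ} (hy : ¬ isCore M k y = true) :
    ¬ Relation.TransGen (fun a b => flipped M k a b = true) y y := by
  suffices h : ∀ z, Relation.TransGen (fun a b => flipped M k a b = true) y z →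
      flipped M k y z = true from fun h' => hM.flipped_asymm (h y h') (h y h')
  intro z hz
  induction hz with
  | single h => exact h
  | @tail b z _ hbz ih =>
    by_cases hzy : y = z
    · subst hzy
      exact absurd hbz (hM.flipped_asymm ih)
    · refine (hM.flipped_total (hM.flipped_lt ih).1 (hM.flipped_lt hbz).2 hzy).resolve_right
        fun h => hy (hM.isCore_iff.2 (Or.inr (Or.inl ⟨b, z, ih, hbz, h⟩)))

/-- Small sets of arcs cannot meet all paths through many witnesses. -/
theorem exists_witness {S : Finset (ℕ × ℕ)} (hS : S.card ≤ k) {u v : ℕ} {T : List ℕ}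
    (hT : T.Nodup) (hTk : k < T.length) (hTw : ∀ w ∈ T, w ∈ triWitness M u v) :
    ∃ w ∈ T, (v, w) ∉ S ∧ (w, u) ∉ S := by
  by_contra! hno
  have hw : ∀ w ∈ T, w ≠ v := fun w hw h => by
    have := ((mem_triWitness hM).1 (hTw w hw)).1
    subst h
    exact hM.asymm this this
  -- Each witness `w` is charged to `(v, w)` or `(w, u)`, whichever is in `S`. Since `w ≠ v`, the
  -- charges are distinct.
  have h := Finset.card_le_card_of_injOn (s := T.toFinset) (t := S)
    (fun w => if (v, w) ∈ S then (v, w) else (w, u)) (fun w hwT => by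
      have hwT' := hno w (by simpa using hwT)
      by_cases h : (v, w) ∈ S
      · simp [h]
      · simpa [h] using hwT' h) (fun w hwT w' hwT' h => by
      have h1 := hw w (by simpa using hwT)
      have h2 := hw w' (by simpa using hwT')
      dsimp only at h
      split_ifs at h <;> simp only [Prod.mk.injEq] at h <;> simp_all)
  rw [List.toFinset_card_of_nodup hT] at h
  omega

/-- Forced arcs are in every small feedback arc set. -/
theorem mem_of_forcedArc {W : ℕ → Prop} (hW : ∀ v, isCore M k v = true → W v)
    {S : Finset (ℕ × ℕ)} (hS : S.card ≤ k) (hfas : IsFas M W S) {u v : ℕ}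
    (h : forcedArc M k u v = true) : (u, v) ∈ S := by
  by_contra huv
  obtain ⟨he, hk⟩ := forcedArc_iff.1 h
  -- Only the first `k + 1` witnesses are known to be core vertices, hence in `W`; that many
  -- suffice.
  obtain ⟨w, hw, h1, h2⟩ := hM.exists_witness hS (T := (triWitness M u v).take (k + 1))
    ((nodup_triWitness M u v).sublist (List.take_sublist _ _))
    (by rw [List.length_take]; omega) fun w hw => List.mem_of_mem_take hw
  obtain ⟨h3, h4⟩ := (mem_triWitness hM).1 (List.mem_of_mem_take hw)
  have hu : W u := hW u (hM.isCore_iff.2 (Or.inl ⟨v, Or.inl h⟩))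
  have hv : W v := hW v (hM.isCore_iff.2 (Or.inl ⟨u, Or.inr h⟩))
  have hw : W w := hW w (hM.isCore_iff.2 (Or.inr (Or.inr ⟨u, v, h, hw⟩)))
  exact hfas u (((Relation.TransGen.single ⟨hu, hv, he, huv⟩).tail ⟨hv, hw, h3, h1⟩).tail
    ⟨hw, hu, h4, h2⟩)

/-- Small feedback arc sets are determined by the core vertices. -/
theorem isFas_of_core {V W : ℕ → Prop} (hW : ∀ v, isCore M k v = true → W v)
    {S : Finset (ℕ × ℕ)} (hS : S.card ≤ k) (hfas : IsFas M W S) : IsFas M V S := by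
  -- Forced arcs lie in `S`, so the remaining arcs survive the flipping; by `not_transGen_flipped`
  -- their cycles visit core vertices only.
  have hflip : ∀ a b, Remaining M V S a b → flipped M k a b = true := fun a b h =>
    flipped_iff.2 (Or.inl ⟨h.2.2.1, fun hf => h.2.2.2 (hM.mem_of_forcedArc hW hS hfas hf)⟩)
  have hcyc : ∀ y, Relation.TransGen (Remaining M V S) y y → W y := fun y hy => by
    by_contra hno
    exact hM.not_transGen_flipped (fun h => hno (hW y h)) (Relation.TransGen.mono hflip _ _ hy)
  intro v hv
  refine hfas v ?_
  suffices h : ∀ z, Relation.TransGen (Remaining M V S) v z →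
      Relation.ReflTransGen (Remaining M V S) z v → Relation.TransGen (Remaining M W S) v z from
    h v hv .refl
  intro z hz
  induction hz with
  | single h =>
    intro hzv
    exact .single ⟨hcyc _ (hv), hcyc _ (.trans_right hzv (.single h)), h.2.2⟩
  | @tail b z hvb hbz ih =>
    intro hzv
    refine (ih (.head hbz hzv)).tail ⟨hcyc b ?_, hcyc z ?_, hbz.2.2⟩
    · exact .trans_right (.head hbz hzv) hvb
    · exact .trans_right hzv (hvb.tail hbz)

/-- A reversed forced arc has more than `k` witnesses, one of which gives a detour of two arcs
avoiding `S`. The only obstruction left is an unforced arc in `S`. -/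
theorem transGen_of_flipped {S : Finset (ℕ × ℕ)} (hS : S.card ≤ k) {u v : ℕ}
    (h : flipped M k u v = true) :
    (entry M u v = true ∧ ¬ forcedArc M k u v = true ∧ (u, v) ∈ S) ∨
      Relation.TransGen (Remaining M (fun _ => True) S) u v := by
  rcases flipped_iff.1 h with ⟨h1, h2⟩ | h
  · by_cases hS : (u, v) ∈ S
    · exact Or.inl ⟨h1, h2, hS⟩
    · exact Or.inr (.single ⟨trivial, trivial, h1, hS⟩)
  · obtain ⟨w, hw, h1, h2⟩ := hM.exists_witness hS (nodup_triWitness M v u)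
      (forcedArc_iff.1 h).2 fun w hw => hw
    obtain ⟨h3, h4⟩ := (mem_triWitness hM).1 hw
    exact Or.inr ((Relation.TransGen.single ⟨trivial, trivial, h3, h1⟩).tail
      ⟨trivial, trivial, h4, h2⟩)

/-- The arcs of `S` have at most `2 * k` ends and `k * (k + 1)` listed witnesses, and these include
the core. Indeed forced arcs lie in `S`, and a flipped triangle avoiding `S` would yield a remaining
cycle via detours. So it has an arc in `S`, either at `x` or opposite to it. -/
theorem length_coreVertices_le {S : Finset (ℕ × ℕ)} (hS : S.card ≤ k)
    (hfas : IsFas M (fun _ => True) S) : (coreVertices M k).length ≤ k * k + 3 * k := by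
  have hforced : ∀ {u v}, forcedArc M k u v = true → (u, v) ∈ S := fun h =>
    hM.mem_of_forcedArc (fun _ _ => trivial) hS hfas h
  let T : ℕ × ℕ → Finset ℕ := fun e => ((triWitness M e.1 e.2).take (k + 1)).toFinset
  have hfst : ∀ {a b}, (a, b) ∈ S → a ∈ S.image Prod.fst ∪ S.image Prod.snd ∪ S.biUnion T :=
    fun h => Finset.mem_union_left _ (Finset.mem_union_left _ (Finset.mem_image_of_mem Prod.fst h))
  have hsnd : ∀ {a b}, (a, b) ∈ S → b ∈ S.image Prod.fst ∪ S.image Prod.snd ∪ S.biUnion T :=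
    fun h => Finset.mem_union_left _ (Finset.mem_union_right _ (Finset.mem_image_of_mem Prod.snd h))
  have hT : ∀ {a b x}, (a, b) ∈ S → x ∈ (triWitness M a b).take (k + 1) →
      x ∈ S.image Prod.fst ∪ S.image Prod.snd ∪ S.biUnion T := fun h hx =>
    Finset.mem_union_right _ (Finset.mem_biUnion.2 ⟨_, h, List.mem_toFinset.2 hx⟩)
  refine (length_filter_le_of_subset (F := S.image Prod.fst ∪ S.image Prod.snd ∪ S.biUnion T)
    List.nodup_range fun x _ hx => ?_).trans ?_
  · rcases hM.isCore_iff.1 hx with ⟨a, h | h⟩ | ⟨a, b, h1, h2, h3⟩ | ⟨a, b, h, hxT⟩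
    · exact hfst (hforced h)
    · exact hsnd (hforced h)
    · rcases hM.transGen_of_flipped hS h1 with ⟨-, -, h⟩ | t1
      · exact hfst h
      rcases hM.transGen_of_flipped hS h3 with ⟨-, -, h⟩ | t3
      · exact hsnd h
      rcases hM.transGen_of_flipped hS h2 with ⟨hab, hnf, h⟩ | t2
      · rcases flipped_iff.1 h1 with ⟨h1, -⟩ | h1
        · rcases flipped_iff.1 h3 with ⟨h3, -⟩ | h3
          -- The opposite arc is unforced, so it has at most `k` witnesses and `take (k + 1)` cuts
          -- off none, in particular not `x`.
          · refine hT h ?_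
            have hlen : (triWitness M a b).length ≤ k := by
              by_contra! hlt
              exact hnf (forcedArc_iff.2 ⟨hab, hlt⟩)
            rw [List.take_of_length_le (by omega), mem_triWitness hM]
            exact ⟨h3, h1⟩
          · exact hfst (hforced h3)
        · exact hsnd (hforced h1)
      · exact absurd ((t1.trans t2).trans t3) (hfas x)
    · exact hT (hforced h) hxT
  · have h1 : (S.image Prod.fst).card ≤ k := Finset.card_image_le.trans hS
    have h2 : (S.image Prod.snd).card ≤ k := Finset.card_image_le.trans hS
    have h3 : (S.biUnion T).card ≤ k * (k + 1) :=
      (Finset.card_biUnion_le_card_mul _ _ (k + 1) fun e _ =>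
        (List.toFinset_card_le _).trans (List.length_take_le _ _)).trans
        (Nat.mul_le_mul_right _ hS)
    refine (Finset.card_union_le _ _).trans ?_
    have := Finset.card_union_le (S.image Prod.fst) (S.image Prod.snd)
    nlinarith

end IsTournament

open Enc

/-! ### Feedback arc sets: the kernel -/

/-- Acyclicity does not depend on the names of the vertices. -/
theorem isFas_iff_of_embedding {α : Type} {M : List (List Bool)} {W : ℕ → Prop}
    {S : Finset (ℕ × ℕ)} {ι : α → ℕ} {R : α → α → Prop} (hι : Function.Injective ι)
    (hW : ∀ v, W v ↔ ∃ a, ι a = v)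
    (hR : ∀ a b, R a b ↔ entry M (ι a) (ι b) = true ∧ (ι a, ι b) ∉ S) :
    IsFas M W S ↔ ∀ a, ¬ Relation.TransGen R a a := by
  constructor
  · intro h a ha
    exact h (ι a) (Relation.TransGen.lift ι (fun a b hab =>
      ⟨(hW _).2 ⟨a, rfl⟩, (hW _).2 ⟨b, rfl⟩, (hR a b).1 hab⟩) _ _ ha)
  · intro h v hv
    have key : ∀ a z, Relation.TransGen (Remaining M W S) (ι a) z →
        ∃ b, ι b = z ∧ Relation.TransGen R a b := by
      intro a z hz
      induction hz with
      | single h =>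
        obtain ⟨b, rfl⟩ := (hW _).1 h.2.1
        exact ⟨b, rfl, .single ((hR _ _).2 h.2.2)⟩
      | tail _ h ih =>
        obtain ⟨c, rfl, hc⟩ := ih
        obtain ⟨b, rfl⟩ := (hW _).1 h.2.1
        exact ⟨b, rfl, hc.tail ((hR _ _).2 h.2.2)⟩
    have hWv : W v := by
      obtain ⟨w, hw, -⟩ := Relation.TransGen.head'_iff.1 hv
      exact hw.1
    obtain ⟨a, rfl⟩ := (hW v).1 hWv
    obtain ⟨b, hb, hab⟩ := key a _ hv
    obtain rfl := hι hb
    exact h _ hab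

namespace TournamentInst

open Classical in
/-- The rows of the adjacency matrix. -/
noncomputable def rows (I : TournamentInst) : List (List Bool) :=
  matrixRows fun u v => decide (I.D.Adj u v)

theorem length_rows (I : TournamentInst) : I.rows.length = I.n := length_matrixRows _

theorem entry_rows {I : TournamentInst} {u v : ℕ} :
    entry I.rows u v = true ↔ ∃ (hu : u < I.n) (hv : v < I.n), I.D.Adj ⟨u, hu⟩ ⟨v, hv⟩ := by
  simp [rows, entry_matrixRows]

theorem entry_rows_fin {I : TournamentInst} {u v : Fin I.n} :
    entry I.rows u v = true ↔ I.D.Adj u v :=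
  entry_rows.trans ⟨fun ⟨_, _, h⟩ => h, fun h => ⟨u.2, v.2, h⟩⟩

theorem isTournament_rows (I : TournamentInst) : IsTournament I.rows where
  lt h := by
    obtain ⟨hu, hv, -⟩ := entry_rows.1 h
    rw [length_rows]
    exact ⟨hu, hv⟩
  asymm h h' := by
    obtain ⟨hu, hv, h⟩ := entry_rows.1 h
    obtain ⟨_, _, h'⟩ := entry_rows.1 h'
    exact I.asymm _ _ h h'
  total {u v} hu hv h := by
    rw [length_rows] at hu hv
    rw [entry_rows, entry_rows]
    exact (I.total ⟨u, hu⟩ ⟨v, hv⟩ fun h' => h (congrArg Fin.val h')).imp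
      (fun h => ⟨hu, hv, h⟩) fun h => ⟨hv, hu, h⟩

/-- The kept vertices. -/
noncomputable def kept (I : TournamentInst) (k m : ℕ) : List ℕ := coreAnd I.rows k m

/-- The kernel. -/
noncomputable def reduced (I : TournamentInst) (k r : ℕ) : TournamentInst where
  n := (I.kept k (2 * k * r)).length
  D := ⟨fun i j => entry I.rows (I.kept k (2 * k * r))[i] (I.kept k (2 * k * r))[j] = true⟩
  irrefl i h := I.isTournament_rows.asymm h h
  asymm i j h := I.isTournament_rows.asymm h
  total i j h := by
    have hlt : ∀ i : Fin (I.kept k (2 * k * r)).length,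
        (I.kept k (2 * k * r))[i] < I.rows.length := fun i =>
      List.mem_range.1 (mem_of_mem_keepVertices (List.getElem_mem _))
    exact I.isTournament_rows.total (hlt i) (hlt j) fun h' =>
      h (getElem_injective (nodup_keepVertices List.nodup_range) h')

theorem rows_reduced (I : TournamentInst) (k r : ℕ) :
    (I.reduced k r).rows = matrixOf (I.kept k (2 * k * r)) (entry I.rows) := by
  rw [← matrixRows_getElem]
  refine congrArg matrixRows (funext₂ fun i j => Bool.eq_iff_iff.2 ?_)
  exact @decide_eq_true_iff _ (Classical.propDecidable _)

noncomputable instance : Enc TournamentInst := ⟨TournamentInst.enc⟩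

section
variable {γ : Type} [Enc γ]

@[fun_prop]
theorem pt_rows {f : γ → TournamentInst} (hf : PT f) : PT (fun c => (f c).rows) :=
  hf.of_enc_eq fun _ => rfl

@[fun_prop]
theorem pt_kept {f : γ → TournamentInst} {k m : γ → ℕ} (hf : PT f) (hk : PT k) (hm : PT m) :
    PT (fun c => (f c).kept (k c) (m c)) := by
  unfold kept; fun_prop

theorem pt_reduced : PT (fun x : TournamentInst × ℕ × ℕ => x.1.reduced x.2.1 x.2.2) := by
  refine (show PT (fun x : TournamentInst × ℕ × ℕ =>
    matrixOf (x.1.kept x.2.1 (2 * x.2.1 * x.2.2)) (entry x.1.rows)) by fun_prop).of_enc_eq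
      fun x => ?_
  rw [← rows_reduced]
  rfl

end

/-- The arc with the given end vertices, as a pair of numbers. -/
def arcLabel {n : ℕ} (e : Fin n × Fin n) : ℕ × ℕ := (e.1, e.2)

theorem arcLabel_injective {n : ℕ} : Function.Injective (arcLabel (n := n)) := fun e f h => by
  simp only [arcLabel, Prod.mk.injEq] at h
  exact Prod.ext (Fin.ext h.1) (Fin.ext h.2)

theorem isSolution_iff {I : TournamentInst} {S : Finset (Fin I.n × Fin I.n)} :
    feedbackArcSet.IsSolution I S ↔ (∀ e ∈ S, I.D.Adj e.1 e.2) ∧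
      IsFas I.rows (· < I.n) (S.image arcLabel) := by
  refine and_congr_right fun _ => (isFas_iff_of_embedding Fin.val_injective
    (fun v => ⟨fun h => ⟨⟨v, h⟩, rfl⟩, ?_⟩) fun a b => ?_).symm
  · rintro ⟨a, rfl⟩; exact a.2
  · rw [entry_rows_fin]
    exact and_congr_right fun _ => not_congr
      (arcLabel_injective.mem_finset_image (s := S) (a := (a, b))).symm

/-- The label of an arc in the kernel. -/
def keptLabel {W : List ℕ} (e : Fin W.length × Fin W.length) : ℕ × ℕ := (W[e.1], W[e.2])

theorem keptLabel_injective {W : List ℕ} (hW : W.Nodup) :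
    Function.Injective (keptLabel (W := W)) := fun e f h => by
  simp only [keptLabel, Prod.mk.injEq] at h
  exact Prod.ext (getElem_injective hW h.1) (getElem_injective hW h.2)

theorem nodup_kept (I : TournamentInst) (k m : ℕ) : (I.kept k m).Nodup :=
  nodup_keepVertices List.nodup_range

theorem lt_of_mem_kept {I : TournamentInst} {k m v : ℕ} (h : v ∈ I.kept k m) : v < I.n :=
  I.length_rows ▸ List.mem_range.1 (mem_of_mem_keepVertices h)

theorem mem_kept_of_isCore {I : TournamentInst} {k m v : ℕ} (h : isCore I.rows k v = true) :
    v ∈ I.kept k m := by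
  refine mem_keepVertices_of (List.mem_range.2 ?_) h
  have hM := I.isTournament_rows
  rcases hM.isCore_iff.1 h with ⟨a, h | h⟩ | ⟨a, b, h, -⟩ | ⟨a, b, -, h⟩
  · exact (hM.lt (forcedArc_iff.1 h).1).1
  · exact (hM.lt (forcedArc_iff.1 h).1).2
  · exact (hM.flipped_lt h).1
  · exact (hM.lt ((mem_triWitness hM).1 (List.mem_of_mem_take h)).1).2

theorem isSolution_reduced_iff {I : TournamentInst} {k r : ℕ}
    {S : Finset (Fin (I.kept k (2 * k * r)).length × Fin (I.kept k (2 * k * r)).length)} :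
    feedbackArcSet.IsSolution (I.reduced k r) S ↔
      (∀ e ∈ S, entry I.rows (keptLabel e).1 (keptLabel e).2 = true) ∧
      IsFas I.rows (· ∈ I.kept k (2 * k * r)) (S.image keptLabel) := by
  refine and_congr_right fun _ => (isFas_iff_of_embedding
    (getElem_injective (I.nodup_kept k (2 * k * r)))
    (fun v => ⟨fun h => ?_, ?_⟩) fun a b => ?_).symm
  · obtain ⟨i, hi, h⟩ := List.getElem_of_mem h
    exact ⟨⟨i, hi⟩, h⟩
  · rintro ⟨i, rfl⟩; exact List.getElem_mem _
  · exact and_congr_right fun _ => not_congr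
      ((keptLabel_injective (I.nodup_kept k (2 * k * r))).mem_finset_image
        (s := S) (a := (a, b))).symm

/-- A tournament on many vertices has many arcs. -/
theorem exists_arc_notMem {M : List (List Bool)} (hM : IsTournament M) {W : List ℕ}
    (hW : W.Nodup) (hlt : ∀ v ∈ W, v < M.length) {m : ℕ} (hm : 2 * m ≤ W.length)
    {F : Finset (Fin W.length × Fin W.length)} (hF : F.card < m) :
    ∃ e, entry M (keptLabel e).1 (keptLabel e).2 = true ∧ e ∉ F := by
  classical
  let z : Fin W.length := ⟨0, by omega⟩
  -- The star at `z` has one arc for each other vertex, at least `2 * m - 1 ≥ m` arcs, more than `F`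
  -- contains.
  let g : Fin W.length → Fin W.length × Fin W.length := fun j =>
    if entry M W[z] W[j] = true then (z, j) else (j, z)
  have hg : Set.InjOn g (Finset.univ.erase z : Finset (Fin W.length)) := by
    intro i hi j hj hij
    have hi' : i ≠ z := by simpa using hi
    have hj' : j ≠ z := by simpa using hj
    simp only [g] at hij
    split_ifs at hij <;> simp only [Prod.mk.injEq] at hij <;> simp_all
  obtain ⟨e, he, heF⟩ := Finset.exists_mem_notMem_of_card_lt_card (s := F)
    (t := (Finset.univ.erase z).image g) (by
      rw [Finset.card_image_of_injOn hg, Finset.card_erase_of_mem (Finset.mem_univ z),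
        Finset.card_univ, Fintype.card_fin]
      omega)
  refine ⟨e, ?_, heF⟩
  obtain ⟨j, hj, rfl⟩ := Finset.mem_image.1 he
  have hj' : j ≠ z := (Finset.mem_erase.1 hj).1
  by_cases h : entry M W[z] W[j] = true
  · simp only [g, if_pos h]
    exact h
  · simp only [g, if_neg h]
    refine (hM.total (hlt _ (List.getElem_mem _)) (hlt _ (List.getElem_mem _))
      fun h' => hj' (getElem_injective hW h').symm).resolve_left h

/-- A dropped arc has a dropped end, so at least `2 * k * r` vertices are kept and unused arcs exist
to replace it; extra arcs do not create cycles. Conversely, a small solution on the kept vertices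
solves the whole tournament by `isFas_of_core`. -/
theorem isYes_reduced_iff (I : TournamentInst) {k r t : ℕ} (hk : k ≠ 0) (hr : r ≠ 0) :
    (⟨I.reduced k r, k, r, t⟩ : DiverseInst feedbackArcSet).IsYes ↔
      (⟨I, k, r, t⟩ : DiverseInst feedbackArcSet).IsYes := by
  have hnd := I.nodup_kept k (2 * k * r)
  have hM := I.isTournament_rows
  refine isYes_iff_of_labels (Q := feedbackArcSet) (φ := arcLabel (n := I.n))
    (ψ := keptLabel (W := I.kept k (2 * k * r)))
    (fun e => entry I.rows (keptLabel e).1 (keptLabel e).2 = true) hk hr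
    arcLabel_injective (keptLabel_injective hnd) (fun b => ?_) (fun a ha F hF => ?_)
    (fun S T hS hSk hTk h hok => ?_) (fun S T hS hSk hTk h hT => ?_)
  · exact ⟨(⟨_, lt_of_mem_kept (List.getElem_mem b.1.2)⟩,
      ⟨_, lt_of_mem_kept (List.getElem_mem b.2.2)⟩), rfl⟩
  · refine exists_arc_notMem hM hnd (fun v hv => I.length_rows.symm ▸ lt_of_mem_kept hv) ?_ hF
    obtain ⟨u, v⟩ := a
    have : ∃ w < I.n, w ∉ I.kept k (2 * k * r) := by
      by_contra! hall
      obtain ⟨i, hi, hiu⟩ := List.getElem_of_mem (hall u u.2)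
      obtain ⟨j, hj, hjv⟩ := List.getElem_of_mem (hall v v.2)
      exact ha (⟨i, hi⟩, ⟨j, hj⟩) (Prod.ext hiu hjv)
    obtain ⟨w, hw, hwW⟩ := this
    rw [← mul_assoc]
    exact le_length_keepVertices (List.mem_range.2 (I.length_rows.symm ▸ hw)) hwW
  · obtain ⟨hS1, hS2⟩ := isSolution_iff.1 hS
    refine isSolution_reduced_iff.2 ⟨fun e he => ?_, fun v hv => ?_⟩
    · rcases hok e he with h | ⟨a, ha, hae⟩
      · exact h
      · rw [hae]
        exact entry_rows_fin.2 (hS1 a ha)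
    · refine hS2 v (Relation.TransGen.mono (fun a b hab => ?_) _ _ hv)
      refine ⟨lt_of_mem_kept hab.1, lt_of_mem_kept hab.2.1, hab.2.2.1, fun hmem => hab.2.2.2 ?_⟩
      obtain ⟨e, he, hel⟩ := Finset.mem_image.1 hmem
      obtain ⟨i, hi, hia⟩ := List.getElem_of_mem hab.1
      obtain ⟨j, hj, hjb⟩ := List.getElem_of_mem hab.2.1
      have hl : keptLabel (W := I.kept k (2 * k * r)) (⟨i, hi⟩, ⟨j, hj⟩) = (a, b) :=
        Prod.ext hia hjb
      exact Finset.mem_image.2 ⟨_, h e he (⟨i, hi⟩, ⟨j, hj⟩) (hl.trans hel.symm), hl⟩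
  · obtain ⟨hS1, hS2⟩ := isSolution_reduced_iff.1 hS
    refine isSolution_iff.2 ⟨fun e he => ?_, ?_⟩
    · obtain ⟨a, ha, hea⟩ := hT e he
      have := hS1 a ha
      rw [← hea] at this
      exact entry_rows_fin.1 this
    · have himage : T.image arcLabel = S.image keptLabel := by
        ext l
        constructor
        · intro hl
          obtain ⟨e, he, rfl⟩ := Finset.mem_image.1 hl
          obtain ⟨a, ha, hea⟩ := hT e he
          exact Finset.mem_image.2 ⟨a, ha, hea.symm⟩
        · intro hl
          obtain ⟨a, ha, rfl⟩ := Finset.mem_image.1 hl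
          have hb : arcLabel (n := I.n) (⟨_, lt_of_mem_kept (List.getElem_mem a.1.2)⟩,
            ⟨_, lt_of_mem_kept (List.getElem_mem a.2.2)⟩) = keptLabel a := rfl
          exact Finset.mem_image.2 ⟨_, h a ha _ hb, hb⟩
      refine hM.isFas_of_core (k := k) (W := (· ∈ I.kept k (2 * k * r)))
        (fun v hv => mem_kept_of_isCore (m := 2 * k * r) hv) (Finset.card_image_le.trans hTk) ?_
      rw [himage]
      exact hS2

theorem length_kept_le (I : TournamentInst) (k m : ℕ) :
    (I.kept k m).length ≤ (coreVertices I.rows k).length + m := length_keepVertices_le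

end TournamentInst

open TournamentInst in
theorem hasDiverseKernel_feedbackArcSet :
    HasDiverseKernel feedbackArcSet (fun k r => k * (k + r)) := by
  have hkept : ∀ (I : TournamentInst) (k r : ℕ),
      decide ((coreVertices (rows I) k).length ≤ k * k + 3 * k) = true →
        (reduced I k r).n ≤ k * k + 3 * k + 2 * k * r := fun I k r h =>
    (length_kept_le I k (2 * k * r)).trans (Nat.add_le_add_right (of_decide_eq_true h) _)
  refine HasDiverseKernel.of_reduction (Q := feedbackArcSet)
    (⟨0, ⟨fun _ _ => False⟩, fun u => u.elim0, fun u => u.elim0, fun u => u.elim0⟩) rfl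
    (fun I k _ => decide ((coreVertices (rows I) k).length ≤ k * k + 3 * k))
    (fun I k r => reduced I k r) ?_ pt_reduced ?_ ?_
    (fun I k r t hk hr _ => isYes_reduced_iff I hk hr) ?_ ?_
  · exact show PT (fun x : TournamentInst × ℕ × ℕ =>
      decide ((coreVertices (rows x.1) x.2.1).length ≤ x.2.1 * x.2.1 + 3 * x.2.1)) by fun_prop
  · intro I k r _ h S hS
    by_contra! hSk
    refine of_decide_eq_false h ?_
    obtain ⟨-, hfas⟩ := isSolution_iff.1 hS
    have hM := isTournament_rows I
    have hcard := (Finset.card_image_le (s := S) (f := arcLabel)).trans hSk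
    exact hM.length_coreVertices_le hcard
      (hM.isFas_of_core (fun v hv => lt_of_mem_kept (mem_kept_of_isCore (m := 0) hv)) hcard hfas)
  -- For `k = 0` the core is empty, so acyclicity may be checked on the empty subtournament.
  · intro I r h
    have hM := isTournament_rows I
    have h0 : coreVertices (rows I) 0 = [] := List.length_eq_zero_iff.1
      (Nat.le_zero.1 (of_decide_eq_true h))
    refine isSolution_iff.2 ⟨fun e he => absurd he (Finset.notMem_empty e), ?_⟩
    refine hM.isFas_of_core (k := 0) (W := fun _ => False) (fun v hv => ?_)
      (le_of_eq rfl) fun v hv => ?_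
    · have hv' := mem_kept_of_isCore (m := 0) hv
      have : v ∈ coreVertices (rows I) 0 :=
        List.mem_filter.2 ⟨mem_of_mem_keepVertices hv', hv⟩
      rw [h0] at this
      exact absurd this List.not_mem_nil
    · obtain ⟨w, hw, -⟩ := Relation.TransGen.head'_iff.1 hv
      exact hw.1
  · let s : Polynomial ℕ := Polynomial.X * Polynomial.X + 3 * Polynomial.X +
      2 * Polynomial.X * Polynomial.X
    refine ⟨s * (s * 4 + 2) + 1, fun I k r _ _ h => ?_⟩
    have hn : (reduced I k r).n ≤ s.eval (k + r) := by
      refine (hkept I k r h).trans ?_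
      simp only [s, Polynomial.eval_add, Polynomial.eval_mul, Polynomial.eval_ofNat,
        Polynomial.eval_X]
      gcongr <;> omega
    refine (encMatrix_size_le _).trans ?_
    simp only [Polynomial.eval_add, Polynomial.eval_mul, Polynomial.eval_one,
      Polynomial.eval_ofNat]
    gcongr
  · refine ⟨4, fun I k r hk _ h => (hkept I k r h).trans ?_⟩
    have : k * 1 ≤ k * k := Nat.mul_le_mul_left k (by omega)
    nlinarith [Nat.zero_le (k * r)]

theorem corollary5p4 :
    HasDiverseKernel vertexCover (fun k r => k * (k + r)) ∧
    (∀ d : ℕ, HasDiverseKernel (hittingSet d) (fun k r => k ^ d + k * r)) ∧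
    (HasDiverseKernel pointLineCover (fun k r => k * (k + r)) ∧
      HasDiverseKernel spannedPointLineCover (fun k r => k ^ 2 * (k + r))) ∧
    HasDiverseKernel feedbackArcSet (fun k r => k * (k + r)) :=
  ⟨hasDiverseKernel_vertexCover, hasDiverseKernel_hittingSet,
    ⟨hasDiverseKernel_pointLineCover, hasDiverseKernel_spannedPointLineCover⟩,
    hasDiverseKernel_feedbackArcSet⟩
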